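/- Let $\mathfrak g$ be a complex finite-dimensional simple Lie algebra with simple roots $\alpha_i$ $(i\in I)$, Cartan matrix $\mathsf C=(c_{i,j})$, $c_{i,j}=\langle h_i,\alpha_j\rangle$, and minimal symmetrizer $(d_i)_{i\in I}$ ($d_i\in\mathbb Z_{\ge1}$, $\min_i d_i=1$), so that $(\alpha_i,\alpha_j)=d_ic_{i,j}=d_jc_{j,i}$. Let $s_i(\alpha_j)=\alpha_j-c_{i,j}\alpha_i$ be the simple reflections, $\mathsf W$ the Weyl group they generate, and $w_\circ$ its longest element. Put $q_i=q^{d_i}$, $[n]_i=\frac{q_i^n-q_i^{-n}}{q_i-q_i^{-1}}$, $[n]_i!=\prod_{k=1}^n[k]_i$, and $\left[{n\atop s}\right]_i=\frac{[n]_i!}{[s]_i!\,[n-s]_i!}$. Let $\widehat{\mathcal A}_q(\mathfrak n)$ be the $\mathbb Q(q^{1/2})$-algebra generated by $y_{i,m}$ $(i\in I,\ m\in\mathbb Z)$ with the relations $$\sum_{s=0}^{1-c_{i,j}}(-1)^s\left[{1-c_{i,j}\atop s}\right]_i y_{i,k}^{1-c_{i,j}-s}\,y_{j,k}\,y_{i,k}^{s}=0\quad(i\ne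 j),$$ $$y_{i,k}y_{j,k+1}=q^{(\alpha_i,\alpha_j)}y_{j,k+1}y_{i,k}+\delta_{i,j}\bigl(1-q^{(\alpha_i,\alpha_i)}\bigr),$$ $$y_{i,k}y_{j,l}=q^{-(-1)^{k+l}(\alpha_i,\alpha_j)}y_{j,l}y_{i,k}\quad(l>k+1),$$ and let $\widehat{\mathcal A}_q(\mathfrak n)_m$ be the subalgebra generated by the $y_{i,m}$, $i\in I$. Write $y_{i,m}^{(k)}=y_{i,m}^k/[k]_i!$. Then there are (necessarily unique) algebra automorphisms $T_i$ $(i\in I)$ of $\widehat{\mathcal A}_q(\mathfrak n)$ such that, for all $j\in I$ and $m\in\mathbb Z$: if $c_{i,j}\ge0$, then $T_i^{\pm1}(y_{j,m})=y_{j,m\pm\delta_{i,j}}$; and if $c_{i,j}<0$, then $$T_i(y_{j,m})=\frac{\sum_{k=0}^{-c_{i,j}}(-1)^kq_i^{-c_{i,j}/2-k}\,y_{i,m}^{(k)}\,y_{j,m}\,y_{i,m}^{(-c_{i,j}-k)}}{(q_i-q_i^{-1})^{-c_{i,j}}},\qquad T_i^{-1}(y_{j,m})=\frac{\sum_{k=0}^{-c_{i,j}}(-1)^kq_i^{-c_{i,j}/2-k}\,y_{i,m}^{(-c_{i,j}-k)}\,y_{j,m}\,y_{i,m}^{(k)}}{(q_i-q_i^{-1})^{-c_{i,j}}}.$$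 These automorphisms satisfy the following. (a) If $s_{i_1}\cdots s_{i_{r-1}}s_{i_r}$ is a reduced expression of an element of $\mathsf W$ and $s_{i_1}\cdots s_{i_{r-1}}(\alpha_{i_r})=\alpha_j$, then for all $m\in\mathbb Z$ $$T_{i_1}^{\pm1}\cdots T_{i_{r-1}}^{\pm1}(y_{i_r,m})=y_{j,m}.$$ (b) Let $i\mapsto i^*$ be the map $I\to I$ with $w_\circ(\alpha_i)=-\alpha_{i^*}$. For every reduced expression $w_\circ=s_{i_1}\cdots s_{i_\ell}$, with $T_{w_\circ}^{\pm1}:=T_{i_1}^{\pm1}\cdots T_{i_\ell}^{\pm1}$, and all $i\in I$, $m\in\mathbb Z$, $$T_{w_\circ}^{\pm1}(y_{i,m})=y_{i^*,m\pm1}\in\widehat{\mathcal A}_q(\mathfrak n)_{m\pm1}.$$ -/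

import Mathlib

noncomputable section

/-- A Cartan datum of a complex finite-dimensional simple Lie algebra with simple roots indexed
by `I`: an indecomposable Cartan matrix `C` of finite type, `C i j = ⟨h_i, α_j⟩`, together with
its minimal symmetrizer `d`, so that `(α_i, α_j) = d i * C i j` and the shortest simple roots
satisfy `(α_i, α_i) = 2`. -/
structure SimpleCartanDatum (I : Type*) [Fintype I] where
  /-- the Cartan matrix -/
  C : Matrix I I ℤ
  /-- the diagonal of the symmetrizer -/
  d : I → ℕ
  diag : ∀ i, C i i = 2
  off_diag : ∀ i j, i ≠ j → C i j ≤ 0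
  d_pos : ∀ i, 0 < d i
  d_min : ∃ i, d i = 1
  symm : ∀ i j, (d i : ℤ) * C i j = (d j : ℤ) * C j i
  /-- finite type: the form `(·, ·)` is positive definite on the root lattice -/
  pos_def : ∀ x : I → ℤ, x ≠ 0 → 0 < ∑ i, ∑ j, (d i : ℤ) * C i j * x i * x j
  /-- simplicity: the Dynkin diagram is connected -/
  indecomposable : ∀ S : Set I, S.Nonempty → Sᶜ.Nonempty → ∃ i ∈ S, ∃ j ∈ Sᶜ, C i j ≠ 0

namespace SimpleCartanDatum

variable {I : Type*} [Fintype I] [DecidableEq I] (D : SimpleCartanDatum I)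

/-! ### Root lattice and Weyl group -/

/-- The simple root `α_i` in the root lattice `⨁ ℤ α_i = (I → ℤ)`. -/
def simpleRoot (_D : SimpleCartanDatum I) (i : I) : I → ℤ := Pi.single i 1

/-- The simple coroot `h_i` as a linear form on the root lattice, `⟨h_i, α_j⟩ = C i j`. -/
def simpleCoroot (i : I) : Module.Dual ℤ (I → ℤ) := ∑ j, D.C i j • LinearMap.proj j

lemma simpleCoroot_simpleRoot (i j : I) : D.simpleCoroot i (D.simpleRoot j) = D.C i j := by
  simp [simpleCoroot, simpleRoot, Pi.single_apply]

/-- The simple reflection `s_i(x) = x - ⟨h_i, x⟩ α_i`. -/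
def simpleReflection (i : I) : (I → ℤ) ≃ₗ[ℤ] (I → ℤ) :=
  Module.reflection (x := D.simpleRoot i) (f := D.simpleCoroot i)
    ((D.simpleCoroot_simpleRoot i i).trans (D.diag i))

/-- The Weyl group, generated by the simple reflections. -/
def weylGroup : Subgroup ((I → ℤ) ≃ₗ[ℤ] (I → ℤ)) :=
  Subgroup.closure (Set.range D.simpleReflection)

/-- The product `s_{i_1} ⋯ s_{i_r}` of a word `(i_1, …, i_r)`. -/
def wordProd (l : List I) : (I → ℤ) ≃ₗ[ℤ] (I → ℤ) := (l.map D.simpleReflection).prod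

/-- `l ∈ I(w)`: the word `l` is a reduced expression of `w`. -/
def IsReducedWord (w : (I → ℤ) ≃ₗ[ℤ] (I → ℤ)) (l : List I) : Prop :=
  D.wordProd l = w ∧ ∀ l' : List I, D.wordProd l' = w → l.length ≤ l'.length

/-- The length `ℓ(w)` of an element of the Weyl group: the least number of factors in an
expression of `w` as a product of simple reflections. -/
def length (w : (I → ℤ) ≃ₗ[ℤ] (I → ℤ)) : ℕ :=
  sInf {n | ∃ l : List I, l.length = n ∧ D.wordProd l = w}

/-- `w` is the longest element `w_∘` of the Weyl group. -/
def IsLongest (w : (I → ℤ) ≃ₗ[ℤ] (I → ℤ)) : Prop :=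
  w ∈ D.weylGroup ∧ ∀ w' ∈ D.weylGroup, D.length w' ≤ D.length w

/-! ### The base field `ℚ(q^{1/2})` and quantum integers -/

/-- The field `ℚ(q^{1/2})`. -/
abbrev QField : Type := RatFunc ℚ

/-- `qHalf e = (q^{1/2})^e = q^{e/2}`. -/
def qHalf (e : ℤ) : QField := (RatFunc.X : RatFunc ℚ) ^ e

/-- `q^e`. -/
def qPow (e : ℤ) : QField := qHalf (2 * e)

/-- `(α_i, α_j)`. -/
def form (i j : I) : ℤ := (D.d i : ℤ) * D.C i j

/-- `q_i - q_i^{-1}` where `q_i = q^{d_i}`. -/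
def qDiff (i : I) : QField := qPow (D.d i) - qPow (-(D.d i : ℤ))

/-- `[n]_i = (q_i^n - q_i^{-n}) / (q_i - q_i^{-1})`. -/
def qInt (i : I) (n : ℕ) : QField :=
  (qPow ((D.d i : ℤ) * n) - qPow (-((D.d i : ℤ) * n))) / D.qDiff i

/-- `[n]_i! = [1]_i ⋯ [n]_i`. -/
def qFactorial (i : I) (n : ℕ) : QField := ∏ k ∈ Finset.range n, D.qInt i (k + 1)

/-- The quantum binomial coefficient (used for `m ≤ n`). -/
def qBinom (i : I) (n m : ℕ) : QField :=
  D.qFactorial i n / (D.qFactorial i m * D.qFactorial i (n - m))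

/-- `-c_{i,j}` as a natural number, for `i ≠ j`. -/
def negC (i j : I) : ℕ := (-D.C i j).toNat

/-! ### The algebra `Â_q(𝔫)` -/

/-- The free generator that is mapped to `y_{i,m}`. -/
def gen (_D : SimpleCartanDatum I) (i : I) (m : ℤ) : FreeAlgebra QField (I × ℤ) :=
  FreeAlgebra.ι QField (i, m)

/-- The defining relations: the quantum Serre relations in each level, and the quantum boson
relations between different levels. -/
inductive Rel : FreeAlgebra QField (I × ℤ) → FreeAlgebra QField (I × ℤ) → Prop
  | serre (i j : I) (k : ℤ) (hij : i ≠ j) :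
      Rel (∑ s ∈ Finset.range (D.negC i j + 2),
            ((-1) ^ s * D.qBinom i (D.negC i j + 1) s) •
              (D.gen i k ^ (D.negC i j + 1 - s) * D.gen j k * D.gen i k ^ s)) 0
  | boson_same (i : I) (k : ℤ) :
      Rel (D.gen i k * D.gen i (k + 1))
        (qPow (D.form i i) • (D.gen i (k + 1) * D.gen i k) +
          algebraMap QField _ (1 - qPow (D.form i i)))
  | boson_next (i j : I) (k : ℤ) (hij : i ≠ j) :
      Rel (D.gen i k * D.gen j (k + 1))
        (qPow (D.form i j) • (D.gen j (k + 1) * D.gen i k))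
  | boson_far (i j : I) (k l : ℤ) (hkl : k + 1 < l) :
      Rel (D.gen i k * D.gen j l)
        (qPow (((k + l + 1).negOnePow : ℤ) * D.form i j) • (D.gen j l * D.gen i k))

/-- The `ℚ(q^{1/2})`-algebra `Â_q(𝔫)`. -/
abbrev AHat : Type _ := RingQuot D.Rel

/-- The generators `y_{i,m}` of `Â_q(𝔫)`. -/
def y (i : I) (m : ℤ) : D.AHat := RingQuot.mkAlgHom QField D.Rel (D.gen i m)

/-- The divided power `y_{i,m}^{(k)} = y_{i,m}^k / [k]_i!`. -/
def yDiv (i : I) (m : ℤ) (k : ℕ) : D.AHat := (D.qFactorial i k)⁻¹ • D.y i m ^ k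

/-- The subalgebra `Â_q(𝔫)_m` generated by the `y_{i,m}`, `i ∈ I`. -/
def level (m : ℤ) : Subalgebra QField D.AHat := Algebra.adjoin QField (Set.range fun i => D.y i m)

/-! ### The braid symmetries on generators -/

/-- The element prescribed for `T_i(y_{j,m})`; here `q_i^{-c/2 - k} = (q^{1/2})^{d_i (-c - 2k)}`. -/
def braidImage (i j : I) (m : ℤ) : D.AHat :=
  if 0 ≤ D.C i j then D.y j (m + if i = j then 1 else 0)
  else (D.qDiff i ^ D.negC i j)⁻¹ • ∑ k ∈ Finset.range (D.negC i j + 1),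
    ((-1) ^ k * qHalf ((D.d i : ℤ) * (D.negC i j - 2 * k))) •
      (D.yDiv i m k * D.y j m * D.yDiv i m (D.negC i j - k))

/-- The element prescribed for `T_i⁻¹(y_{j,m})`. -/
def braidInvImage (i j : I) (m : ℤ) : D.AHat :=
  if 0 ≤ D.C i j then D.y j (m - if i = j then 1 else 0)
  else (D.qDiff i ^ D.negC i j)⁻¹ • ∑ k ∈ Finset.range (D.negC i j + 1),
    ((-1) ^ k * qHalf ((D.d i : ℤ) * (D.negC i j - 2 * k))) •
      (D.yDiv i m (D.negC i j - k) * D.y j m * D.yDiv i m k)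

/-- `T` is the family of automorphisms `T_i` of `Â_q(𝔫)` with the prescribed values of `T_i` and
`T_i⁻¹` on the generators; there is at most one such family. -/
def IsBraidFamily (T : I → (D.AHat ≃ₐ[QField] D.AHat)) : Prop :=
  ∀ (i j : I) (m : ℤ),
    T i (D.y j m) = D.braidImage i j m ∧ (T i).symm (D.y j m) = D.braidInvImage i j m

/-- `T_{i_1} ∘ ⋯ ∘ T_{i_r}` for a word `(i_1, …, i_r)`. -/
def braidWord (T : I → (D.AHat ≃ₐ[QField] D.AHat)) (l : List I) : D.AHat ≃ₐ[QField] D.AHat :=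
  (l.map T).prod

/-- `T_{i_1}⁻¹ ∘ ⋯ ∘ T_{i_r}⁻¹` for a word `(i_1, …, i_r)`. -/
def braidInvWord (T : I → (D.AHat ≃ₐ[QField] D.AHat)) (l : List I) : D.AHat ≃ₐ[QField] D.AHat :=
  (l.map fun i => (T i).symm).prod

end SimpleCartanDatum

end

/-! Fix `i ≠ j` and a level `m`; put `f = y_{i,m}`, `e = y_{i,m+1}`, `x = y_{j,m}`, `a = -c_{i,j}`,
`r = q^{(α_i,α_j)} = q_i^{-a}`. The sum prescribed for `T_i(x)` is, up to a scalar, the term `x_a`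
of the chain `x_0 = x`, `x_{s+1} = x_s f - r q_i^{2s} f x_s`, and the Serre relation says `x_{a+1} =
0`. The relation between `f` and `e` makes `q`-commutation with `e` run down the same chain
(`qad_mul_next`), so `f` and `e` act on it like the raising and lowering operators of quantum `sl₂`,
and `T_i` sends the lowest vector to the highest one while replacing `f` by `e`.

That `T_i` respects the defining relations (`isSolution_braidImage`) follows from this picture. By
the `q`-Leibniz rule, passing to the highest vector is multiplicative (`IsTopPower.mul`), which
carries over Serre relations between indices other than `i`. Those involving `i` come from lowering
(`rqad_qad_succ`) and from differentiating a Serre relation along `f` (`serre_swap`). Relations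
between levels come from `qad_mul_qad` and `qad_mul_qad_self`. The anti-automorphism `y_{i,m} ↦
y_{i,-m}` conjugates `T_i` into its inverse, because `a` lowerings undo `a` raisings.

The braid relations are checked on each `y_{k,m}`. For `k ∈ {i, j}` they reduce to the rank two
cases of (a), such as `T_i T_j (y_i) = y_j` for a simple bond. For other `k`, positive definiteness
of the form leaves few diagrams, each settled by a commutator identity.

The rest is combinatorics of the Weyl group. Factor an element as `p u`, with `u` in the dihedral
group of two simple reflections and `p` minimal in its coset. Induction on length then gives
positivity of roots, Matsumoto's theorem (`Reduced.prod_map_eq`) and a reduction of (a) to rank two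
(`Reduced.prod_map_apply_eq`). For (b), the longest element has a reduced word ending in any given
`i`; the last `T_i` raises the level of `y_{i,m}` by one, and (a) handles the remaining letters. The
statements for inverses follow by reversing levels. -/

noncomputable section

/-! ### Weyl group combinatorics -/

namespace SimpleCartanDatum

open CoxeterSystem (alternatingWord alternatingWord_succ alternatingWord_succ'
  length_alternatingWord)

variable {I : Type*} [Fintype I] [DecidableEq I] (D : SimpleCartanDatum I)

/-! ### Finite type restrictions on the Cartan matrix -/

lemma C_eq_zero_of_C_eq_zero {i j : I} (h : D.C i j = 0) : D.C j i = 0 := by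
  have h1 := D.symm i j
  have h2 := D.d_pos j
  rw [h, mul_zero, eq_comm, mul_eq_zero] at h1
  rcases h1 with h1 | h1
  · omega
  · exact h1

lemma pos_def_pair {i j : I} (hij : i ≠ j) (s t : ℤ) (hs : s ≠ 0) :
    0 < 2 * D.d i * s ^ 2 + 2 * D.d j * t ^ 2 + 2 * (D.d i * D.C i j) * s * t := by
  have h := D.pos_def (Pi.single i s + Pi.single j t) (by
    intro h
    apply hs
    simpa [hij] using congrFun h i)
  simp only [Pi.add_apply, mul_add, Finset.sum_add_distrib, add_mul] at h
  simp only [Pi.single_apply, mul_ite, mul_zero, ite_mul, zero_mul, Finset.sum_ite_eq',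
    Finset.mem_univ, if_true, D.diag] at h
  simp only [Finset.sum_ite_eq, Finset.sum_ite_eq', Finset.mem_univ, if_true, D.diag,
    ← D.symm i j] at h
  linarith

lemma pos_def_triple {i j k : I} (hij : i ≠ j) (hik : i ≠ k) (hjk : j ≠ k) (s t u : ℤ)
    (hs : s ≠ 0) :
    0 < 2 * D.d i * s ^ 2 + 2 * D.d j * t ^ 2 + 2 * D.d k * u ^ 2
      + 2 * (D.d i * D.C i j) * s * t + 2 * (D.d i * D.C i k) * s * u
      + 2 * (D.d j * D.C j k) * t * u := by
  have h := D.pos_def (Pi.single i s + Pi.single j t + Pi.single k u) (by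
    intro h
    apply hs
    simpa [hij, hik] using congrFun h i)
  simp only [Pi.add_apply, mul_add, Finset.sum_add_distrib, add_mul] at h
  simp only [Pi.single_apply, mul_ite, mul_zero, ite_mul, zero_mul, Finset.sum_ite_eq',
    Finset.mem_univ, if_true, D.diag] at h
  simp only [Finset.sum_ite_eq, Finset.sum_ite_eq', Finset.mem_univ, if_true, D.diag,
    ← D.symm i j, ← D.symm i k, ← D.symm j k] at h
  linarith

/-- The form takes the value `2 d_j (4 - c_{i,j} c_{j,i})` at `2 α_j - c_{i,j} α_i`. -/
lemma C_mul_C_lt {i j : I} (hij : i ≠ j) : D.C i j * D.C j i < 4 := by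
  have h := D.pos_def_pair hij.symm 2 (-D.C i j) two_ne_zero
  rw [← D.symm i j] at h
  have h2 : (D.d i : ℤ) * D.C i j * D.C i j = D.d j * (D.C i j * D.C j i) := by
    rw [D.symm i j]; ring
  have h3 : 0 < (D.d j : ℤ) := by exact_mod_cast D.d_pos j
  nlinarith

/-- Evaluate the form at `2 α_j - c_{i,j} α_i - c_{k,j} α_k`; the cross term in `α_i, α_k` is
nonpositive and can be dropped. This limits the bonds that meet at one node. -/
lemma C_mul_C_add_lt {i j k : I} (hij : i ≠ j) (hik : i ≠ k) (hjk : j ≠ k) :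
    D.C i j * D.C j i + D.C j k * D.C k j < 4 := by
  have h := D.pos_def_triple hij.symm hjk hik 2 (-D.C i j) (-D.C k j) two_ne_zero
  rw [← D.symm i j, ← D.symm k j] at h
  have h2 : (D.d i : ℤ) * D.C i j * D.C i j = D.d j * (D.C i j * D.C j i) := by
    rw [D.symm i j]; ring
  have h4 : (D.d k : ℤ) * D.C k j * D.C k j = D.d j * (D.C j k * D.C k j) := by
    rw [D.symm k j]; ring
  have h3 : 0 < (D.d j : ℤ) := by exact_mod_cast D.d_pos j
  have h5 : 0 ≤ (D.d i : ℤ) * (-D.C i k) * (-D.C i j * -D.C k j) := by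
    have a1 := D.off_diag i k hik
    have a2 := D.off_diag i j hij
    have a3 := D.off_diag k j hjk.symm
    have a4 : 0 ≤ -D.C i k := by linarith
    have a5 : 0 ≤ -D.C i j := by linarith
    have a6 : 0 ≤ -D.C k j := by linarith
    positivity
  nlinarith

/-- A Dynkin diagram of finite type has no triangle: on one, `α_i + α_j + α_k` would have
nonpositive norm. -/
lemma C_eq_zero_of_ne_zero {i j k : I} (hij : i ≠ j) (hik : i ≠ k) (hjk : j ≠ k)
    (h1 : D.C i j ≠ 0) (h2 : D.C j k ≠ 0) : D.C i k = 0 := by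
  by_contra h3
  have h := D.pos_def_triple hij hik hjk 1 1 1 one_ne_zero
  have a1 := D.off_diag i j hij
  have a2 := D.off_diag j k hjk
  have a3 := D.off_diag k i hik.symm
  have h3' : D.C k i ≠ 0 := fun h => h3 (D.C_eq_zero_of_C_eq_zero h)
  rw [D.symm i k] at h
  have b1 : D.C i j ≤ -1 := by omega
  have b2 : D.C j k ≤ -1 := by omega
  have b3 : D.C k i ≤ -1 := by omega
  have d1 : 0 < (D.d i : ℤ) := by exact_mod_cast D.d_pos i
  have d2 : 0 < (D.d j : ℤ) := by exact_mod_cast D.d_pos j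
  have d3 : 0 < (D.d k : ℤ) := by exact_mod_cast D.d_pos k
  nlinarith

lemma cartan_cases {i j : I} (hij : i ≠ j) :
    (D.C i j = 0 ∧ D.C j i = 0) ∨ (D.C i j = -1 ∧ D.C j i = -1) ∨
    (D.C i j = -1 ∧ D.C j i = -2) ∨ (D.C i j = -2 ∧ D.C j i = -1) ∨
    (D.C i j = -1 ∧ D.C j i = -3) ∨ (D.C i j = -3 ∧ D.C j i = -1) := by
  by_cases h0 : D.C i j = 0
  · exact Or.inl ⟨h0, D.C_eq_zero_of_C_eq_zero h0⟩
  have h0' : D.C j i ≠ 0 := fun h => h0 (D.C_eq_zero_of_C_eq_zero h)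
  have h1 := D.off_diag i j hij
  have h2 := D.off_diag j i hij.symm
  have h3 := D.C_mul_C_lt hij
  have h4 : -3 ≤ D.C i j := by nlinarith [show D.C j i ≤ -1 by omega]
  have h5 : -3 ≤ D.C j i := by nlinarith [show D.C i j ≤ -1 by omega]
  generalize D.C i j = x at *
  generalize D.C j i = y at *
  interval_cases x <;> interval_cases y <;> simp_all

/-- The order of `s_i s_j`, read off from the Cartan matrix. -/
def braidOrder (i j : I) : ℕ :=
  if D.C i j * D.C j i = 0 then 2 else if D.C i j * D.C j i = 1 then 3
  else if D.C i j * D.C j i = 2 then 4 else 6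

lemma braidOrder_comm (i j : I) : D.braidOrder i j = D.braidOrder j i := by
  simp only [braidOrder, mul_comm (D.C i j)]

lemma braidOrder_pos (i j : I) : 0 < D.braidOrder i j := by
  unfold braidOrder; split_ifs <;> norm_num

/-! ### Words in the simple reflections -/

lemma simpleReflection_apply (i : I) (x : I → ℤ) :
    D.simpleReflection i x = x - D.simpleCoroot i x • D.simpleRoot i := rfl

@[simp] lemma simpleReflection_mul_self (i : I) :
    D.simpleReflection i * D.simpleReflection i = 1 := by
  ext1 x
  exact Module.involutive_reflection ((D.simpleCoroot_simpleRoot i i).trans (D.diag i)) x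

@[simp] lemma wordProd_nil : D.wordProd [] = 1 := rfl

@[simp] lemma wordProd_cons (i : I) (l : List I) :
    D.wordProd (i :: l) = D.simpleReflection i * D.wordProd l := by simp [wordProd]

@[simp] lemma wordProd_append (l l' : List I) :
    D.wordProd (l ++ l') = D.wordProd l * D.wordProd l' := by simp [wordProd]

lemma simpleReflection_simpleRoot (i j : I) :
    D.simpleReflection i (D.simpleRoot j) = D.simpleRoot j - D.C i j • D.simpleRoot i := by
  rw [simpleReflection_apply, simpleCoroot_simpleRoot]

lemma simpleReflection_simpleRoot_self (i : I) :
    D.simpleReflection i (D.simpleRoot i) = -D.simpleRoot i := by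
  rw [simpleReflection_simpleRoot, D.diag, two_smul]; abel

lemma simpleRoot_ne_zero (i : I) : D.simpleRoot i ≠ 0 := by
  intro h; simpa [simpleRoot] using congrFun h i

lemma det_wordProd (l : List I) :
    LinearMap.det (D.wordProd l).toLinearMap = (-1) ^ l.length := by
  induction l with
  | nil => simp [wordProd, LinearEquiv.coe_one]
  | cons i l ih =>
    have h1 : (D.wordProd (i :: l)).toLinearMap =
        (D.simpleReflection i).toLinearMap * (D.wordProd l).toLinearMap := by
      rw [wordProd_cons]; rfl
    have h2 : (D.simpleReflection i).toLinearMap =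
        LinearMap.transvection (D.simpleCoroot i) (-D.simpleRoot i) := by
      refine LinearMap.ext fun x => ?_
      rw [LinearMap.transvection.apply, smul_neg, ← sub_eq_add_neg]
      rfl
    rw [h1, map_mul, ih, h2, LinearMap.transvection.det, map_neg, simpleCoroot_simpleRoot, D.diag,
      List.length_cons, pow_succ]
    ring

/-- The determinant is a sign character, each simple reflection contributing `-1`. -/
lemma length_parity {l l' : List I} (h : D.wordProd l = D.wordProd l') :
    (Even l.length ↔ Even l'.length) := by
  have h1 := D.det_wordProd l
  rw [h, det_wordProd] at h1
  rcases Nat.even_or_odd l.length with h2 | h2 <;> rcases Nat.even_or_odd l'.length with h3 | h3 <;>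
    simp_all [Even.neg_one_pow, Odd.neg_one_pow, ← Nat.not_even_iff_odd]

/-- A word of minimal length among those with the same product. -/
def Reduced (l : List I) : Prop :=
  ∀ l' : List I, D.wordProd l' = D.wordProd l → l.length ≤ l'.length

variable {D}

lemma Reduced.congr {l l' : List I} (h : D.Reduced l) (h1 : D.wordProd l' = D.wordProd l)
    (h2 : l'.length ≤ l.length) : D.Reduced l' :=
  fun l'' h3 => h2.trans (h l'' (h3.trans h1))

variable (D) in
lemma exists_reduced (l : List I) : ∃ l', D.wordProd l' = D.wordProd l ∧ D.Reduced l' := by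
  classical
  have h : ∃ n, ∃ l', D.wordProd l' = D.wordProd l ∧ l'.length = n := ⟨_, l, rfl, rfl⟩
  obtain ⟨l', h1, h2⟩ := Nat.find_spec h
  refine ⟨l', h1, fun l'' h3 => ?_⟩
  rw [h2]
  exact Nat.find_min' h ⟨l'', h3.trans h1, rfl⟩

lemma Reduced.left {l l' : List I} (h : D.Reduced (l ++ l')) : D.Reduced l := by
  intro l'' h1
  have := h (l'' ++ l') (by simp [h1])
  simpa using this

lemma Reduced.right {l l' : List I} (h : D.Reduced (l ++ l')) : D.Reduced l' := by
  intro l'' h1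
  have := h (l ++ l'') (by simp [h1])
  simpa using this

lemma not_reduced_of_eq_append {l p : List I} {i : I} (h : D.wordProd l = D.wordProd (p ++ [i]))
    (hl : p.length < l.length + 1) : ¬ D.Reduced (l ++ [i]) := by
  intro h1
  have := h1 p (by simp [h, mul_assoc])
  simp at this
  omega

/-- A weak exchange property that needs only parity. A shorter word `p` for `w s_i` gives the word
`p ++ [i]` for `w`, whose length exceeds that of `l` by at most one; parity excludes the excess. -/
lemma exists_eq_append_of_not_reduced {l : List I} {i : I} (hl : D.Reduced l)
    (h : ¬ D.Reduced (l ++ [i])) :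
    ∃ p, D.wordProd (p ++ [i]) = D.wordProd l ∧ (p ++ [i]).length = l.length := by
  unfold Reduced at h
  push Not at h
  obtain ⟨p, h1, h2⟩ := h
  have h3 : D.wordProd (p ++ [i]) = D.wordProd l := by
    simp [h1, mul_assoc]
  refine ⟨p, h3, ?_⟩
  have h4 := hl _ h3
  have h5 := D.length_parity h3
  simp at h2 h4 h5 ⊢
  rcases Nat.lt_or_ge p.length l.length with h6 | h6
  · omega
  · have : p.length = l.length := by omega
    rw [this] at h5
    grind

/-- Move trailing letters `i` or `j` from `p` to `u` for as long as possible. The process stops at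
the shortest element of the coset of the subgroup generated by `s_i` and `s_j`. -/
lemma exists_parabolic {l : List I} (hl : D.Reduced l) (i j : I) :
    ∃ p u, D.wordProd (p ++ u) = D.wordProd l ∧ (p ++ u).length = l.length ∧
      (∀ x ∈ u, x = i ∨ x = j) ∧ D.Reduced (p ++ [i]) ∧ D.Reduced (p ++ [j]) := by
  suffices H : ∀ n, ∀ p u, p.length = n → D.wordProd (p ++ u) = D.wordProd l →
      (p ++ u).length = l.length → (∀ x ∈ u, x = i ∨ x = j) →
      ∃ p u, D.wordProd (p ++ u) = D.wordProd l ∧ (p ++ u).length = l.length ∧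
      (∀ x ∈ u, x = i ∨ x = j) ∧ D.Reduced (p ++ [i]) ∧ D.Reduced (p ++ [j]) from
    H _ l [] rfl (by simp) (by simp) (by simp)
  intro n
  induction n using Nat.strong_induction_on with
  | _ n ih =>
    intro p u hp h1 h2 h3
    by_cases h : D.Reduced (p ++ [i]) ∧ D.Reduced (p ++ [j])
    · exact ⟨p, u, h1, h2, h3, h⟩
    · obtain ⟨x, hx, hx'⟩ : ∃ x, (x = i ∨ x = j) ∧ ¬ D.Reduced (p ++ [x]) := by
        by_cases hi : D.Reduced (p ++ [i])
        · exact ⟨j, Or.inr rfl, fun hj => h ⟨hi, hj⟩⟩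
        · exact ⟨i, Or.inl rfl, hi⟩
      have hpr : D.Reduced p := (hl.congr h1 h2.le).left
      obtain ⟨p', h4, h5⟩ := exists_eq_append_of_not_reduced hpr hx'
      simp only [List.length_append, List.length_cons, List.length_nil] at h5 h2
      refine ih p'.length (by omega) p' (x :: u) rfl ?_ ?_ ?_
      · rw [← h1, wordProd_append _ p, ← h4]; simp [mul_assoc]
      · simp; omega
      · intro y hy
        rcases List.mem_cons.1 hy with rfl | hy
        · exact hx
        · exact h3 y hy

/-- Two equal neighbouring letters would cancel. Note that `alternatingWord i j n` ends in its
second argument `j`. -/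
lemma eq_alternatingWord {i j : I} {u : List I} (hu : D.Reduced u)
    (h : ∀ x ∈ u, x = i ∨ x = j) :
    u = alternatingWord i j u.length ∨ u = alternatingWord j i u.length := by
  induction u using List.reverseRecOn with
  | nil => simp [alternatingWord]
  | append_singleton u x ih =>
    have ih := ih hu.left (fun y hy => h y (by simp [hy]))
    have hx := h x (by simp)
    have key : ∀ a, u ≠ [] → u = alternatingWord a x u.length → False := by
      intro a h1 h2
      obtain ⟨n, hn⟩ := Nat.exists_eq_succ_of_ne_zero (List.length_pos_iff.2 h1).ne'
      rw [hn, alternatingWord_succ] at h2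
      refine not_reduced_of_eq_append (l := u) (p := alternatingWord x a n) (i := x) ?_ ?_ hu
      · rw [h2]; simp
      · simp; omega
    simp only [List.length_append, List.length_cons, List.length_nil, alternatingWord_succ,
      List.concat_eq_append, zero_add]
    by_cases h0 : u = []
    · subst h0
      rcases hx with rfl | rfl <;> simp [alternatingWord]
    · rcases hx with rfl | rfl <;> rcases ih with ih | ih
      · right; rw [← ih]
      · exact (key _ h0 ih).elim
      · exact (key _ h0 ih).elim
      · left; rw [← ih]

lemma exists_alternatingWord_suffix {i j : I} {k n : ℕ} (h : k ≤ n) :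
    ∃ p, alternatingWord i j n = p ++ alternatingWord i j k := by
  induction n, h using Nat.le_induction with
  | base => exact ⟨[], rfl⟩
  | succ n _ ih =>
    obtain ⟨p, hp⟩ := ih
    rw [alternatingWord_succ', hp]
    exact ⟨(if Even n then j else i) :: p, rfl⟩

/-! ### Dihedral parabolic subgroups -/

/-- The coordinates of `⋯ s_i s_j (α_i)` (`n` factors) in the basis `α_i, α_j`, where
`a = -c_{i,j}` and `b = -c_{j,i}`. -/
def dihedralCoeff (a b : ℤ) : ℕ → ℤ × ℤ
  | 0 => (1, 0)
  | n + 1 => if Even n then ((dihedralCoeff a b n).1, b * (dihedralCoeff a b n).1 -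
        (dihedralCoeff a b n).2)
      else (a * (dihedralCoeff a b n).2 - (dihedralCoeff a b n).1, (dihedralCoeff a b n).2)

variable (D) in
lemma wordProd_alternatingWord_simpleRoot (i j : I) (n : ℕ) :
    D.wordProd (alternatingWord i j n) (D.simpleRoot i) =
      (dihedralCoeff (-D.C i j) (-D.C j i) n).1 • D.simpleRoot i +
      (dihedralCoeff (-D.C i j) (-D.C j i) n).2 • D.simpleRoot j := by
  induction n with
  | zero => simp [alternatingWord, dihedralCoeff]
  | succ n ih =>
    rw [alternatingWord_succ', wordProd_cons, LinearEquiv.mul_apply, ih, map_add, map_smul,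
      map_smul, dihedralCoeff]
    split_ifs
    · rw [simpleReflection_simpleRoot_self, simpleReflection_simpleRoot]
      module
    · rw [simpleReflection_simpleRoot_self, simpleReflection_simpleRoot]
      module

variable (D) in
lemma dihedralCoeff_nonneg {i j : I} (hij : i ≠ j) {n : ℕ} (hn : n < D.braidOrder i j) :
    0 ≤ (dihedralCoeff (-D.C i j) (-D.C j i) n).1 ∧
      0 ≤ (dihedralCoeff (-D.C i j) (-D.C j i) n).2 := by
  rcases D.cartan_cases hij with h | h | h | h | h | h <;> obtain ⟨h1, h2⟩ := h <;>
    simp only [h1, h2, braidOrder] at hn ⊢ <;> norm_num at hn ⊢ <;>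
    interval_cases n <;> simp [dihedralCoeff, Nat.even_iff]

variable (D) in
-- Determines when a rank two root is simple. This occurs only one letter short of the longest
-- element of the dihedral group, which exchanges the two simple roots up to sign for order three
-- and preserves each up to sign for even order.
lemma dihedralCoeff_eq_zero {i j : I} (hij : i ≠ j) {n : ℕ} (hn : n < D.braidOrder i j)
    (hn0 : 0 < n) (h0 : (dihedralCoeff (-D.C i j) (-D.C j i) n).1 = 0 ∨
      (dihedralCoeff (-D.C i j) (-D.C j i) n).2 = 0) :
    n = D.braidOrder i j - 1 ∧
      dihedralCoeff (-D.C i j) (-D.C j i) n = if D.braidOrder i j = 3 then (0, 1) else (1, 0) := by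
  rcases D.cartan_cases hij with h | h | h | h | h | h <;> obtain ⟨h1, h2⟩ := h <;>
    simp only [h1, h2, braidOrder] at hn h0 ⊢ <;> norm_num at hn h0 ⊢ <;>
    interval_cases n <;> simp [dihedralCoeff, Nat.even_iff] at h0 ⊢

variable (D) in
lemma wordProd_alternatingWord_comm {i j : I} (hij : i ≠ j) :
    D.wordProd (alternatingWord i j (D.braidOrder i j)) =
      D.wordProd (alternatingWord j i (D.braidOrder i j)) := by
  ext1 x
  have e1 := D.simpleCoroot_simpleRoot i i
  have e2 := D.simpleCoroot_simpleRoot j j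
  have e3 := D.simpleCoroot_simpleRoot i j
  have e4 := D.simpleCoroot_simpleRoot j i
  rw [D.diag] at e1 e2
  rcases D.cartan_cases hij with h | h | h | h | h | h <;> obtain ⟨h1, h2⟩ := h <;>
    rw [h1] at e3 <;> rw [h2] at e4 <;> simp only [h1, h2, braidOrder] <;>
    norm_num [alternatingWord, simpleReflection_apply, -zsmul_eq_mul, e1, e2, e3, e4] <;> module

/-- In a suffix with one letter too many, the braid relation rewrites all but the last letter so as
to end in that same letter, and the two cancel. -/
lemma Reduced.alternatingWord_le {i j : I} (hij : i ≠ j) {n : ℕ}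
    (h : D.Reduced (alternatingWord i j n)) : n ≤ D.braidOrder i j := by
  by_contra hn
  push Not at hn
  obtain ⟨p, hp⟩ := exists_alternatingWord_suffix (i := i) (j := j) (Nat.succ_le_of_lt hn)
  rw [hp] at h
  have h := h.right
  rw [Nat.succ_eq_add_one, alternatingWord_succ, List.concat_eq_append] at h
  obtain ⟨m, hm⟩ := Nat.exists_eq_succ_of_ne_zero (D.braidOrder_pos i j).ne'
  refine not_reduced_of_eq_append (p := alternatingWord j i m) ?_ ?_ h
  · rw [← D.wordProd_alternatingWord_comm hij, hm, alternatingWord_succ, List.concat_eq_append]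
  · simp; omega

/-! ### Positivity -/

lemma exists_parabolic_alternating {l : List I} (hl : D.Reduced l) {i j : I} (hij : i ≠ j) :
    ∃ p n, (∃ a b, (a = i ∧ b = j ∨ a = j ∧ b = i) ∧
      D.wordProd (p ++ alternatingWord a b n) = D.wordProd l) ∧
      p.length + n = l.length ∧ n ≤ D.braidOrder i j ∧
      D.Reduced (p ++ [i]) ∧ D.Reduced (p ++ [j]) := by
  obtain ⟨p, u, h1, h2, h3, h4, h5⟩ := exists_parabolic hl i j
  have hu : D.Reduced u := (hl.congr h1 h2.le).right
  rw [List.length_append] at h2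
  rcases eq_alternatingWord hu h3 with h6 | h6
  · refine ⟨p, u.length, ⟨i, j, by simp, by rw [← h6, h1]⟩, h2, ?_, h4, h5⟩
    rw [h6] at hu
    exact hu.alternatingWord_le hij
  · refine ⟨p, u.length, ⟨j, i, by simp, by rw [← h6, h1]⟩, h2, ?_, h4, h5⟩
    rw [h6] at hu
    rw [braidOrder_comm]
    exact hu.alternatingWord_le hij.symm

/-- Take `j` to be the last letter of `l`. The dihedral part is nonempty because `p` admits the
letter `j` and `l` does not. It cannot end in `i`, since `l ++ [i]` would shorten, and it is not of
full length, since it could then be rewritten to end in `i`. -/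
lemma Reduced.exists_parabolic_lt {l : List I} {i : I} (hl : D.Reduced (l ++ [i]))
    (h0 : l ≠ []) :
    ∃ j p n, i ≠ j ∧ 0 < n ∧ n < D.braidOrder i j ∧
      D.wordProd (p ++ alternatingWord i j n) = D.wordProd l ∧ p.length + n = l.length ∧
      D.Reduced (p ++ [i]) ∧ D.Reduced (p ++ [j]) := by
  obtain ⟨l₁, j, rfl⟩ : ∃ l₁ j, l = l₁ ++ [j] := by
    rcases List.eq_nil_or_concat l with h | ⟨l₁, j, h⟩
    · exact absurd h h0
    · exact ⟨l₁, j, by simpa using h⟩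
  have hij : i ≠ j := by
    rintro rfl
    refine not_reduced_of_eq_append (p := l₁) rfl ?_ hl
    simp
  obtain ⟨p, n, ⟨a, b, hab, h1⟩, h2, h3, h4, h5⟩ := exists_parabolic_alternating hl.left hij
  have no_end : ∀ k, n = k + 1 → D.wordProd (p ++ alternatingWord j i n) ≠
      D.wordProd (l₁ ++ [j]) := by
    rintro k rfl h
    refine not_reduced_of_eq_append (p := p ++ alternatingWord i j k) ?_ ?_ hl
    · rw [← h, alternatingWord_succ]; simp
    · simp at h2 ⊢; omega
  have hn0 : n ≠ 0 := by
    rintro rfl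
    have h1 : D.wordProd p = D.wordProd (l₁ ++ [j]) := by
      rw [← h1]; simp [alternatingWord]
    refine not_reduced_of_eq_append h1 ?_ h5
    simp at h2; omega
  obtain ⟨k, hk⟩ := Nat.exists_eq_succ_of_ne_zero hn0
  rcases hab with ⟨rfl, rfl⟩ | ⟨rfl, rfl⟩
  · refine ⟨b, p, n, hij, Nat.pos_of_ne_zero hn0, lt_of_le_of_ne h3 ?_, h1, h2, h4, h5⟩
    rintro rfl
    apply no_end k hk
    rw [← h1, wordProd_append, wordProd_append, D.wordProd_alternatingWord_comm hij]
  · exact absurd h1 (no_end k hk)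

/-- The dihedral part sends `α_i` to a nonnegative combination of `α_i` and `α_j`, and by induction
the shorter factor `p` sends both of these to nonnegative vectors. -/
theorem Reduced.wordProd_simpleRoot_nonneg {l : List I} {i : I} (hl : D.Reduced (l ++ [i])) :
    0 ≤ D.wordProd l (D.simpleRoot i) := by
  induction hn : l.length using Nat.strong_induction_on generalizing l i with
  | _ n ih =>
    by_cases h0 : l = []
    · subst h0
      intro k
      simp only [wordProd_nil, simpleRoot, Pi.zero_apply, LinearEquiv.coe_one, id_eq]
      by_cases hk : k = i
      · subst hk; simp
      · simp [hk]
    · obtain ⟨j, p, m, hij, hm0, hm, h1, h2, h3, h4⟩ := hl.exists_parabolic_lt h0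
      have e1 := ih p.length (by omega) h3 rfl
      have e2 := ih p.length (by omega) h4 rfl
      rw [← h1, wordProd_append, LinearEquiv.mul_apply, wordProd_alternatingWord_simpleRoot,
        map_add, map_smul, map_smul]
      obtain ⟨c1, c2⟩ := D.dihedralCoeff_nonneg hij hm
      exact add_nonneg (smul_nonneg c1 e1) (smul_nonneg c2 e2)

theorem Reduced.wordProd_simpleRoot_nonpos {l : List I} {i : I} (hl : D.Reduced (l ++ [i])) :
    D.wordProd (l ++ [i]) (D.simpleRoot i) ≤ 0 := by
  have := hl.wordProd_simpleRoot_nonneg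
  rw [wordProd_append, LinearEquiv.mul_apply, wordProd_cons, wordProd_nil, mul_one,
    simpleReflection_simpleRoot_self, map_neg]
  simpa using this

/-! ### Independence of the reduced expression -/

variable (D) in
/-- The family `g` satisfies the braid relations. -/
def BraidRelations {G : Type*} [Monoid G] (g : I → G) : Prop :=
  ∀ i j, i ≠ j → ((alternatingWord i j (D.braidOrder i j)).map g).prod =
    ((alternatingWord j i (D.braidOrder i j)).map g).prod

/-- Matsumoto's theorem. If the last letters `i` and `j` differ, the dihedral part is the longest
one, hence can be written to end in either letter; induction compares each word with the matching
form, and one braid relation connects the two. -/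
theorem Reduced.prod_map_eq {G : Type*} [Monoid G] {g : I → G} (hg : D.BraidRelations g)
    {l l' : List I} (hl : D.Reduced l) (hl' : D.Reduced l')
    (h : D.wordProd l = D.wordProd l') : (l.map g).prod = (l'.map g).prod := by
  induction hn : l.length using Nat.strong_induction_on generalizing l l' with
  | _ n ih =>
    have hlen : l.length = l'.length := le_antisymm (hl _ h.symm) (hl' _ h)
    rcases List.eq_nil_or_concat l with rfl | ⟨l₁, i, h1⟩
    · rw [List.eq_nil_of_length_eq_zero hlen.symm]
    rcases List.eq_nil_or_concat l' with rfl | ⟨l₂, j, h2⟩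
    · simp [h1] at hlen
    rw [List.concat_eq_append] at h1 h2
    subst h1 h2
    simp only [List.length_append, List.length_cons, List.length_nil] at hn hlen
    by_cases hij : i = j
    · subst hij
      have := ih l₁.length (by omega) hl.left hl'.left (by simpa using h) rfl
      simp [this]
    obtain ⟨p, m, ⟨a, b, hab, h1⟩, h2, h3, h4, h5⟩ := exists_parabolic_alternating hl hij
    -- Both `α_i` and `α_j` become nonpositive, as both words are reduced, whereas a shorter
    -- dihedral part would keep one of them nonnegative.
    have hm : m = D.braidOrder i j := by
      by_contra hne
      have hlt : m < D.braidOrder i j := lt_of_le_of_ne h3 hne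
      have e1 := h4.wordProd_simpleRoot_nonneg
      have e2 := h5.wordProd_simpleRoot_nonneg
      have n1 := hl.wordProd_simpleRoot_nonpos
      have n2 := hl'.wordProd_simpleRoot_nonpos
      rw [← h] at n2
      have key : ∀ x, 0 ≤ D.wordProd (l₁ ++ [i]) (D.simpleRoot x) →
          D.wordProd (l₁ ++ [i]) (D.simpleRoot x) ≤ 0 → False := by
        intro x hx1 hx2
        have := le_antisymm hx2 hx1
        rw [LinearEquiv.map_eq_zero_iff] at this
        exact D.simpleRoot_ne_zero x this
      rcases hab with ⟨rfl, rfl⟩ | ⟨rfl, rfl⟩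
      · refine key a ?_ n1
        rw [← h1, wordProd_append, LinearEquiv.mul_apply, wordProd_alternatingWord_simpleRoot,
          map_add, map_smul, map_smul]
        obtain ⟨c1, c2⟩ := D.dihedralCoeff_nonneg hij hlt
        exact add_nonneg (smul_nonneg c1 e1) (smul_nonneg c2 e2)
      · refine key a ?_ n2
        rw [← h1, wordProd_append, LinearEquiv.mul_apply, wordProd_alternatingWord_simpleRoot,
          map_add, map_smul, map_smul]
        rw [braidOrder_comm] at hlt
        obtain ⟨c1, c2⟩ := D.dihedralCoeff_nonneg (Ne.symm hij) hlt
        exact add_nonneg (smul_nonneg c1 e2) (smul_nonneg c2 e1)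
    have w1 : D.wordProd (p ++ alternatingWord i j m) = D.wordProd (l₁ ++ [i]) ∧
        D.wordProd (p ++ alternatingWord j i m) = D.wordProd (l₁ ++ [i]) := by
      have := D.wordProd_alternatingWord_comm hij
      rw [← hm] at this
      rcases hab with ⟨rfl, rfl⟩ | ⟨rfl, rfl⟩
      · exact ⟨h1, by rw [← h1, wordProd_append, wordProd_append, this]⟩
      · exact ⟨by rw [← h1, wordProd_append, wordProd_append, this], h1⟩
    obtain ⟨k, hk⟩ := Nat.exists_eq_succ_of_ne_zero (D.braidOrder_pos i j).ne'
    have step : ∀ (x y : I) (q : List I), D.Reduced (q ++ [y]) → q.length < n →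
        q.length + 1 = p.length + m →
        D.wordProd (p ++ alternatingWord x y m) = D.wordProd (q ++ [y]) →
        ((q ++ [y]).map g).prod = (p.map g).prod * ((alternatingWord x y m).map g).prod := by
      intro x y q hq hqn hql hw
      rw [hm, hk, Nat.succ_eq_add_one, alternatingWord_succ, List.concat_eq_append] at hw ⊢
      have hw' : D.wordProd q = D.wordProd (p ++ alternatingWord y x k) := by
        rw [← List.append_assoc, wordProd_append, wordProd_append D q] at hw
        exact (mul_right_cancel hw).symm
      have := ih q.length hqn hq.left (hq.left.congr hw'.symm (by simp; omega)) hw' rfl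
      simp [this, mul_assoc]
    simp only [List.length_append, List.length_cons, List.length_nil] at h2
    rw [step j i l₁ hl (by omega) (by omega) w1.2,
      step i j l₂ hl' (by omega) (by omega) (w1.1.trans h), hm, hg i j hij]

/-- If `g` satisfies the braid relations and permutes the generators `y_i` as prescribed in rank
two, then a reduced word that maps a simple root to a simple root maps `y_i` accordingly. -/
theorem Reduced.prod_map_apply_eq {R A : Type*} [CommSemiring R] [Semiring A] [Algebra R A]
    {g : I → A ≃ₐ[R] A} (hg : D.BraidRelations g) (y : I → A)
    (hy : ∀ i j, i ≠ j → ((alternatingWord i j (D.braidOrder i j - 1)).map g).prod (y i) =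
      y (if D.braidOrder i j = 3 then j else i))
    {l : List I} {i j : I} (hl : D.Reduced (l ++ [i]))
    (h : D.wordProd l (D.simpleRoot i) = D.simpleRoot j) : (l.map g).prod (y i) = y j := by
  induction hn : l.length using Nat.strong_induction_on generalizing l i with
  | _ n ih =>
    by_cases h0 : l = []
    · subst h0
      have : i = j := by
        have := congrFun h j
        by_contra hij
        simp [simpleRoot, Ne.symm hij] at this
      simp [this]
    obtain ⟨k, p, m, hik, hm0, hm, h1, h2, h3, h4⟩ := hl.exists_parabolic_lt h0
    have e1 := h3.wordProd_simpleRoot_nonneg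
    have e2 := h4.wordProd_simpleRoot_nonneg
    obtain ⟨c1, c2⟩ := D.dihedralCoeff_nonneg hik hm
    have h5 := h
    rw [← h1, wordProd_append, LinearEquiv.mul_apply, wordProd_alternatingWord_simpleRoot,
      map_add, map_smul, map_smul] at h5
    -- Otherwise the simple root `α_j` is a combination with positive coefficients of two
    -- nonnegative vectors. Both are then multiples of `α_j`, against the independence of `α_i` and
    -- `α_k`.
    have hz : (dihedralCoeff (-D.C i k) (-D.C k i) m).1 = 0 ∨
        (dihedralCoeff (-D.C i k) (-D.C k i) m).2 = 0 := by
      by_contra hne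
      push Not at hne
      have c1' := lt_of_le_of_ne c1 hne.1.symm
      have c2' := lt_of_le_of_ne c2 hne.2.symm
      have off : ∀ x, x ≠ j → D.wordProd p (D.simpleRoot i) x = 0 ∧
          D.wordProd p (D.simpleRoot k) x = 0 := by
        intro x hx
        have := congrFun h5 x
        simp only [Pi.add_apply, Pi.smul_apply, smul_eq_mul, simpleRoot,
          Pi.single_eq_of_ne hx] at this
        have f1 := e1 x
        have f2 := e2 x
        simp only [Pi.zero_apply, simpleRoot] at f1 f2 ⊢
        constructor <;> nlinarith
      have s1 : ∀ x, (∀ z, z ≠ j → D.wordProd p (D.simpleRoot x) z = 0) →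
          D.wordProd p (D.simpleRoot x) =
            D.wordProd p (D.simpleRoot x) j • D.simpleRoot j := by
        intro x hx
        ext z
        by_cases hz : z = j
        · subst hz; simp [simpleRoot]
        · rw [hx z hz]; simp [simpleRoot, hz]
      have t1 := s1 i (fun z hz => (off z hz).1)
      have t2 := s1 k (fun z hz => (off z hz).2)
      set u := D.wordProd p (D.simpleRoot i) j
      set v := D.wordProd p (D.simpleRoot k) j
      have t3 : D.wordProd p (v • D.simpleRoot i - u • D.simpleRoot k) = 0 := by
        rw [map_sub, map_smul, map_smul, t1, t2]; module
      rw [LinearEquiv.map_eq_zero_iff] at t3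
      have t4 : u = 0 := by
        have := congrFun t3 k
        simpa [simpleRoot, hik.symm] using this
      rw [t4, zero_smul, LinearEquiv.map_eq_zero_iff] at t1
      exact D.simpleRoot_ne_zero i t1
    obtain ⟨hmM, hc⟩ := D.dihedralCoeff_eq_zero hik hm hm0 hz
    have hpr : (l.map g).prod = (p.map g).prod *
        ((alternatingWord i k (D.braidOrder i k - 1)).map g).prod := by
      rw [← hmM, ← List.prod_append, ← List.map_append]
      exact hl.left.prod_map_eq hg (hl.left.congr h1 (by simp; omega)) h1.symm
    rw [hpr, AlgEquiv.mul_apply, hy i k hik]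
    rw [hc] at h5
    split_ifs with h6
    · refine ih p.length (by omega) h4 ?_ rfl
      simpa [h6] using h5
    · refine ih p.length (by omega) h3 ?_ rfl
      simpa [h6] using h5

/-! ### The longest element -/

variable (D) in
lemma isReducedWord_iff (w : (I → ℤ) ≃ₗ[ℤ] (I → ℤ)) (l : List I) :
    D.IsReducedWord w l ↔ D.wordProd l = w ∧ D.Reduced l := by
  constructor
  · rintro ⟨rfl, h⟩
    exact ⟨rfl, h⟩
  · rintro ⟨rfl, h⟩
    exact ⟨rfl, h⟩

variable (D) in
lemma wordProd_mem (l : List I) : D.wordProd l ∈ D.weylGroup := by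
  refine Subgroup.list_prod_mem _ fun x hx => ?_
  obtain ⟨i, -, rfl⟩ := List.mem_map.1 hx
  exact Subgroup.subset_closure ⟨i, rfl⟩

variable (D) in
lemma wordProd_reverse (l : List I) : D.wordProd l.reverse = (D.wordProd l)⁻¹ := by
  induction l with
  | nil => simp
  | cons i l ih =>
    rw [List.reverse_cons, wordProd_append, ih, wordProd_cons, wordProd_cons, wordProd_nil, mul_one,
      mul_inv_rev]
    exact congrArg _ <| eq_inv_of_mul_eq_one_left (D.simpleReflection_mul_self i)

variable (D) in
lemma exists_wordProd_eq {w : (I → ℤ) ≃ₗ[ℤ] (I → ℤ)} (hw : w ∈ D.weylGroup) :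
    ∃ l, D.wordProd l = w := by
  induction hw using Subgroup.closure_induction with
  | mem x hx => obtain ⟨i, rfl⟩ := hx; exact ⟨[i], by simp⟩
  | one => exact ⟨[], rfl⟩
  | mul x y _ _ hx hy =>
    obtain ⟨l, rfl⟩ := hx
    obtain ⟨l', rfl⟩ := hy
    exact ⟨l ++ l', by simp⟩
  | inv x _ hx =>
    obtain ⟨l, rfl⟩ := hx
    exact ⟨l.reverse, D.wordProd_reverse l⟩

lemma Reduced.length_eq {l : List I} (h : D.Reduced l) : D.length (D.wordProd l) = l.length := by
  refine le_antisymm (Nat.sInf_le ⟨l, rfl, rfl⟩) ?_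
  refine le_csInf ⟨_, l, rfl, rfl⟩ ?_
  rintro n ⟨l', rfl, h1⟩
  exact h l' h1

lemma Reduced.reverse {l : List I} (h : D.Reduced l) : D.Reduced l.reverse := by
  intro l' h1
  have := h l'.reverse (by rw [wordProd_reverse, h1, wordProd_reverse, inv_inv])
  simpa using this

lemma IsLongest.not_reduced {l : List I} (h : D.IsLongest (D.wordProd l)) (hl : D.Reduced l)
    (i : I) : ¬ D.Reduced (l ++ [i]) := by
  intro h1
  have := h.2 _ (D.wordProd_mem (l ++ [i]))
  rw [h1.length_eq, hl.length_eq] at this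
  simp at this

lemma IsLongest.inv {w : (I → ℤ) ≃ₗ[ℤ] (I → ℤ)} (h : D.IsLongest w) : D.IsLongest w⁻¹ := by
  refine ⟨inv_mem h.1, fun w' hw' => ?_⟩
  obtain ⟨l, rfl⟩ := D.exists_wordProd_eq h.1
  obtain ⟨l₁, e1, h1⟩ := D.exists_reduced l
  have := h.2 w' hw'
  rw [← e1] at this ⊢
  rwa [← wordProd_reverse, h1.reverse.length_eq, List.length_reverse, ← h1.length_eq]

lemma IsLongest.apply_simpleRoot_nonpos {w : (I → ℤ) ≃ₗ[ℤ] (I → ℤ)} (h : D.IsLongest w) (i : I) :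
    w (D.simpleRoot i) ≤ 0 := by
  obtain ⟨l, rfl⟩ := D.exists_wordProd_eq h.1
  obtain ⟨l₁, e1, h1⟩ := D.exists_reduced l
  rw [← e1] at h ⊢
  obtain ⟨p, e2, h2⟩ := exists_eq_append_of_not_reduced h1 (h.not_reduced h1 i)
  rw [← e2]
  exact (h1.congr e2 h2.le).wordProd_simpleRoot_nonpos

lemma eq_sum_smul_simpleRoot (x : I → ℤ) : x = ∑ k, x k • D.simpleRoot k := by
  ext j
  simp [simpleRoot, Finset.sum_apply, Pi.single_apply]

/-- Compare heights. With `β = -w α_i = ∑ β_k α_k ≥ 0`, applying `-w⁻¹` writes `α_i`, of height one,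
as `∑ β_k (-w⁻¹ α_k)`, where every `-w⁻¹ α_k` has height at least one. Hence `∑ β_k ≤ 1`. -/
lemma IsLongest.exists_apply_eq {w : (I → ℤ) ≃ₗ[ℤ] (I → ℤ)} (h : D.IsLongest w) (i : I) :
    ∃ j, w (D.simpleRoot i) = -D.simpleRoot j := by
  set β : I → ℤ := -w (D.simpleRoot i) with hβ
  have hβ0 : 0 ≤ β := by simpa [hβ] using h.apply_simpleRoot_nonpos i
  have hβne : β ≠ 0 := by
    rw [hβ, neg_ne_zero, Ne, LinearEquiv.map_eq_zero_iff]
    exact D.simpleRoot_ne_zero i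
  have hinv : D.simpleRoot i = ∑ k, β k • (-(w⁻¹ (D.simpleRoot k))) := by
    have h1 : -(w⁻¹ β) = D.simpleRoot i := by
      rw [hβ, map_neg, neg_neg]
      exact LinearEquiv.symm_apply_apply w _
    rw [← h1]
    conv_lhs => rw [eq_sum_smul_simpleRoot (D := D) β]
    simp only [map_sum, smul_neg, Finset.sum_neg_distrib, map_smul]
  have hht : ∀ k, 1 ≤ ∑ x, (-(w⁻¹ (D.simpleRoot k))) x := by
    intro k
    have h0 : 0 ≤ -(w⁻¹ (D.simpleRoot k)) := by simpa using h.inv.apply_simpleRoot_nonpos k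
    have h1 : -(w⁻¹ (D.simpleRoot k)) ≠ 0 := by
      rw [neg_ne_zero, Ne, LinearEquiv.map_eq_zero_iff]
      exact D.simpleRoot_ne_zero k
    obtain ⟨x, hx⟩ := Function.ne_iff.1 h1
    have h2 : 0 < ∑ x, (-(w⁻¹ (D.simpleRoot k))) x :=
      Finset.sum_pos' (fun y _ => h0 y) ⟨x, Finset.mem_univ _, lt_of_le_of_ne (h0 x) (Ne.symm hx)⟩
    omega
  have hsum : ∑ k, β k ≤ 1 := by
    have h1 : ∑ x, D.simpleRoot i x = 1 := by simp [simpleRoot]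
    rw [← h1, hinv]
    simp only [Finset.sum_apply, Pi.smul_apply, smul_eq_mul]
    rw [Finset.sum_comm]
    refine Finset.sum_le_sum fun k _ => ?_
    rw [← Finset.mul_sum]
    exact le_mul_of_one_le_right (hβ0 k) (hht k)
  obtain ⟨j, hj⟩ := Function.ne_iff.1 hβne
  have hj' : 1 ≤ β j := by
    have := lt_of_le_of_ne (hβ0 j) (Ne.symm hj)
    simp at this
    omega
  refine ⟨j, ?_⟩
  rw [← neg_eq_iff_eq_neg, ← hβ]
  ext k
  rw [← Finset.add_sum_erase _ _ (Finset.mem_univ j)] at hsum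
  have hnn : ∀ k ∈ Finset.univ.erase j, 0 ≤ β k := fun k _ => hβ0 k
  by_cases hk : k = j
  · subst hk
    have := Finset.sum_nonneg hnn
    simp [simpleRoot]
    omega
  · have := Finset.single_le_sum hnn (Finset.mem_erase.2 ⟨hk, Finset.mem_univ k⟩)
    have h0 := hβ0 k
    simp [simpleRoot, hk] at h0 ⊢
    omega

end SimpleCartanDatum

end

/-! ### Calculus of iterated `q`-commutators -/

noncomputable section

namespace QuantumAdjoint

/-! ### Quantum integers -/

section Scalars

variable {K : Type*} [Field K]

/-- `q` is not a root of unity (and not zero). -/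
structure Generic (q : K) : Prop where
  ne_zero : q ≠ 0
  pow_ne_one : ∀ n : ℕ, 0 < n → q ^ n ≠ 1

/-- The quantum integer `[n]`. -/
def qNum (q : K) (n : ℕ) : K := (q ^ n - (q ^ n)⁻¹) / (q - q⁻¹)

/-- The quantum factorial `[n]!`. -/
def qFac (q : K) (n : ℕ) : K := ∏ k ∈ Finset.range n, qNum q (k + 1)

@[simp] lemma qNum_zero (q : K) : qNum q 0 = 0 := by simp [qNum]

@[simp] lemma qFac_zero (q : K) : qFac q 0 = 1 := by simp [qFac]

lemma qFac_succ (q : K) (n : ℕ) : qFac q (n + 1) = qFac q n * qNum q (n + 1) :=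
  Finset.prod_range_succ _ _

variable {q : K} (hq : Generic q)
include hq

lemma Generic.sub_inv_pow_ne_zero {n : ℕ} (hn : 0 < n) : q ^ n - (q ^ n)⁻¹ ≠ 0 := by
  intro h
  have h0 := pow_ne_zero n hq.ne_zero
  have h1 : q ^ (n * 2) = 1 := by
    rw [pow_mul, sq]
    nth_rw 2 [sub_eq_zero.1 h]
    exact mul_inv_cancel₀ h0
  exact hq.pow_ne_one _ (by omega) h1

lemma Generic.sub_inv_ne_zero : q - q⁻¹ ≠ 0 := by
  simpa using hq.sub_inv_pow_ne_zero one_pos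

lemma Generic.qNum_ne_zero {n : ℕ} (hn : 0 < n) : qNum q n ≠ 0 :=
  div_ne_zero (hq.sub_inv_pow_ne_zero hn) hq.sub_inv_ne_zero

lemma Generic.qFac_ne_zero (n : ℕ) : qFac q n ≠ 0 :=
  Finset.prod_ne_zero_iff.2 fun _ _ => hq.qNum_ne_zero (Nat.succ_pos _)

lemma Generic.qNum_add (k l : ℕ) : qNum q l + q ^ (k + l) * qNum q k = q ^ k * qNum q (k + l) := by
  have h0 := hq.ne_zero
  have h1 := hq.sub_inv_ne_zero
  have h2 := pow_ne_zero k h0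
  have h3 := pow_ne_zero l h0
  simp only [qNum, pow_add]
  field_simp
  ring

end Scalars

/-! ### Iterated `q`-commutators -/

section Adjoint

variable {K B : Type*} [Field K] [Ring B] [Algebra K B]

/-- Iterated `q`-commutators: `x_0 = x` and `x_{s+1} = x_s f - r q^{2s} f x_s`. -/
def qad (q r : K) (f x : B) : ℕ → B
  | 0 => x
  | s + 1 => qad q r f x s * f - (r * q ^ (2 * s)) • (f * qad q r f x s)

/-- The mirror image of `qad`: `x_0 = x` and `x_{s+1} = f x_s - r q^{2s} x_s f`. -/
def rqad (q r : K) (f x : B) : ℕ → B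
  | 0 => x
  | s + 1 => f * rqad q r f x s - (r * q ^ (2 * s)) • (rqad q r f x s * f)

variable (q r : K) (f x y : B)

@[simp] lemma qad_zero : qad q r f x 0 = x := rfl

@[simp] lemma rqad_zero : rqad q r f x 0 = x := rfl

lemma qad_succ (s : ℕ) : qad q r f x (s + 1) =
    qad q r f x s * f - (r * q ^ (2 * s)) • (f * qad q r f x s) := rfl

lemma rqad_succ (s : ℕ) : rqad q r f x (s + 1) =
    f * rqad q r f x s - (r * q ^ (2 * s)) • (rqad q r f x s * f) := rfl

lemma qad_add (s : ℕ) : qad q r f (x + y) s = qad q r f x s + qad q r f y s := by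
  induction s with
  | zero => rfl
  | succ s ih => simp only [qad_succ, ih, add_mul, mul_add, smul_add]; abel

lemma qad_smul (c : K) (s : ℕ) : qad q r f (c • x) s = c • qad q r f x s := by
  induction s with
  | zero => rfl
  | succ s ih => simp only [qad_succ, ih, smul_mul_assoc, mul_smul_comm]; module

lemma qad_zero_right (s : ℕ) : qad q r f (0 : B) s = 0 := by
  simpa using qad_smul q r f (0 : B) (0 : K) s

lemma qad_smul_left (c : K) (s : ℕ) : qad q r (c • f) x s = c ^ s • qad q r f x s := by
  induction s with
  | zero => simp
  | succ s ih =>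
    simp only [qad_succ, ih, smul_mul_assoc, mul_smul_comm, pow_succ]; module

lemma rqad_smul (c : K) (s : ℕ) : rqad q r f (c • x) s = c • rqad q r f x s := by
  induction s with
  | zero => rfl
  | succ s ih => simp only [rqad_succ, ih, smul_mul_assoc, mul_smul_comm]; module

lemma qad_shift (s t : ℕ) :
    qad q r f x (s + t) = qad q (r * q ^ (2 * s)) f (qad q r f x s) t := by
  induction t with
  | zero => rfl
  | succ t ih =>
    rw [← add_assoc, qad_succ, ih, qad_succ, mul_assoc, ← pow_add, mul_add]

/-- Left and right multiplication by `f` commute, hence so do all twisted commutators with `f`. -/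
lemma qad_commutator (c : K) (s : ℕ) :
    qad q r f (x * f - c • (f * x)) s = qad q r f x s * f - c • (f * qad q r f x s) := by
  induction s with
  | zero => rfl
  | succ s ih =>
    simp only [qad_succ, ih, sub_mul, mul_sub, smul_mul_assoc, mul_smul_comm, mul_assoc]
    module

lemma qad_eq_zero_of_le {q r : K} {f x : B} {n m : ℕ} (h : qad q r f x n = 0) (hm : n ≤ m) :
    qad q r f x m = 0 := by
  obtain ⟨t, rfl⟩ := Nat.exists_eq_add_of_le hm
  rw [qad_shift, h, qad_zero_right]

lemma map_qad {C : Type*} [Ring C] [Algebra K C] (φ : B →ₐ[K] C) (s : ℕ) :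
    φ (qad q r f x s) = qad q r (φ f) (φ x) s := by
  induction s with
  | zero => rfl
  | succ s ih => simp [qad_succ, ih]

lemma map_rqad {C : Type*} [Ring C] [Algebra K C] (φ : B →ₐ[K] C) (s : ℕ) :
    φ (rqad q r f x s) = rqad q r (φ f) (φ x) s := by
  induction s with
  | zero => rfl
  | succ s ih => simp [rqad_succ, ih]

lemma op_rqad (s : ℕ) : MulOpposite.op (rqad q r f x s) =
    qad q r (MulOpposite.op f) (MulOpposite.op x) s := by
  induction s with
  | zero => rfl
  | succ s ih => simp [rqad_succ, qad_succ, ih]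

lemma op_qad (s : ℕ) : MulOpposite.op (qad q r f x s) =
    rqad q r (MulOpposite.op f) (MulOpposite.op x) s := by
  induction s with
  | zero => rfl
  | succ s ih => simp [rqad_succ, qad_succ, ih]

/-- The divided power `f^{(k)} = f^k / [k]!`. -/
def dpow (k : ℕ) : B := (qFac q k)⁻¹ • f ^ k

variable {q} (hq : Generic q)
include hq

lemma Generic.dpow_succ_mul (k : ℕ) : qNum q (k + 1) • dpow q f (k + 1) = dpow q f k * f := by
  have h1 := hq.qFac_ne_zero k
  have h2 := hq.qNum_ne_zero (Nat.succ_pos k)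
  rw [dpow, dpow, qFac_succ, smul_mul_assoc, ← pow_succ, smul_smul]
  congr 1
  field_simp

lemma Generic.mul_dpow (k : ℕ) : f * dpow q f k = dpow q f k * f := by
  rw [dpow, mul_smul_comm, smul_mul_assoc, pow_mul_comm']

/-- A `q`-binomial theorem, proved with the Pascal rule `Generic.qNum_add`. It is the link between
the recursive commutators and the explicit sums in the Serre relations and in the formulas for
`T_i`. -/
lemma Generic.qad_eq_sum (s : ℕ) : (qFac q s)⁻¹ • qad q r f x s =
    ∑ k ∈ Finset.range (s + 1), ((-1) ^ k * (r * q⁻¹) ^ k * q ^ (k * s)) •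
      (dpow q f k * x * dpow q f (s - k)) := by
  induction s with
  | zero => simp [dpow]
  | succ s ih =>
    have h1 := hq.qFac_ne_zero s
    have h2 := hq.qNum_ne_zero (Nat.succ_pos s)
    have h0 := hq.ne_zero
    have e1 : (qFac q (s + 1))⁻¹ • qad q r f x (s + 1) = (qNum q (s + 1))⁻¹ •
        (((qFac q s)⁻¹ • qad q r f x s) * f -
          (r * q ^ (2 * s)) • (f * ((qFac q s)⁻¹ • qad q r f x s))) := by
      rw [qad_succ, qFac_succ, mul_inv, smul_mul_assoc, mul_smul_comm, mul_comm _ (qNum q _)⁻¹,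
        mul_smul, smul_sub, smul_comm (qFac q s)⁻¹]
    rw [e1, inv_smul_eq_iff₀ h2, ih, Finset.sum_mul, Finset.mul_sum, Finset.smul_sum,
      Finset.smul_sum]
    have e2 : ∀ k ∈ Finset.range (s + 1 + 1), qNum q (s + 1) • ((-1) ^ k * (r * q⁻¹) ^ k *
        q ^ (k * (s + 1))) • (dpow q f k * x * dpow q f (s + 1 - k)) =
        ((-1) ^ k * (r * q⁻¹) ^ k * q ^ (k * s) * qNum q (s + 1 - k)) •
          (dpow q f k * x * dpow q f (s + 1 - k)) +
        ((-1) ^ k * (r * q⁻¹) ^ k * q ^ (k * s) * q ^ (s + 1) * qNum q k) •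
          (dpow q f k * x * dpow q f (s + 1 - k)) := by
      intro k hk
      have hk' : k + (s + 1 - k) = s + 1 := by
        have := Finset.mem_range.1 hk
        omega
      have := hq.qNum_add k (s + 1 - k)
      rw [hk'] at this
      rw [smul_smul, ← add_smul]
      congr 1
      have e : q ^ (k * (s + 1)) = q ^ (k * s) * q ^ k := by rw [← pow_add]; ring
      rw [e]
      linear_combination (-(-1) ^ k * (r * q⁻¹) ^ k * q ^ (k * s)) * this
    rw [Finset.sum_congr rfl e2, Finset.sum_add_distrib, Finset.sum_range_succ _ (s + 1),
      Finset.sum_range_succ' _ (s + 1)]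
    simp only [Nat.sub_self, qNum_zero, mul_zero, zero_smul, add_zero]
    rw [sub_eq_add_neg, ← Finset.sum_neg_distrib]
    congr 1
    · refine Finset.sum_congr rfl fun k hk => ?_
      have hk' : s + 1 - k = s - k + 1 := by
        have := Finset.mem_range.1 hk
        omega
      rw [hk', mul_smul _ (qNum q (s - k + 1)), ← mul_smul_comm (qNum q (s - k + 1)),
        hq.dpow_succ_mul, smul_mul_assoc, mul_assoc (dpow q f k * x)]
    · refine Finset.sum_congr rfl fun k hk => ?_
      have hk' : s + 1 - (k + 1) = s - k := by omega
      rw [hk', mul_smul _ (qNum q (k + 1)), ← smul_mul_assoc (qNum q (k + 1)),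
        ← smul_mul_assoc (qNum q (k + 1)), hq.dpow_succ_mul, ← hq.mul_dpow,
        mul_smul_comm, smul_smul, ← neg_smul, ← mul_assoc f, ← mul_assoc f]
      congr 1
      have e : q ^ ((k + 1) * s) * q ^ (s + 1) = q ^ (k * s) * q ^ (2 * s) * q := by
        rw [← pow_add, ← pow_add, ← pow_succ]; ring_nf
      rw [mul_assoc _ (q ^ ((k + 1) * s)), e, pow_succ, pow_succ]
      field_simp

lemma Generic.rqad_eq_sum (s : ℕ) : (qFac q s)⁻¹ • rqad q r f x s =
    ∑ k ∈ Finset.range (s + 1), ((-1) ^ k * (r * q⁻¹) ^ k * q ^ (k * s)) •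
      (dpow q f (s - k) * x * dpow q f k) := by
  apply MulOpposite.op_injective
  have := hq.qad_eq_sum r (MulOpposite.op f) (MulOpposite.op x) s
  rw [MulOpposite.op_smul, op_rqad, this, Finset.op_sum]
  refine Finset.sum_congr rfl fun k _ => ?_
  simp only [dpow, MulOpposite.op_smul, MulOpposite.op_mul, MulOpposite.op_pow, mul_assoc,
    smul_mul_assoc, mul_smul_comm]
  rw [smul_comm (qFac q k)⁻¹]

/-- Both mirror images of the quantum Serre element coincide up to sign. -/
lemma Generic.qad_eq_zero_iff {a : ℕ} (hr : r * q ^ a = 1) :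
    qad q r f x (a + 1) = 0 ↔ rqad q r f x (a + 1) = 0 := by
  have h0 := inv_ne_zero (hq.qFac_ne_zero (a + 1))
  have hr' : r * q⁻¹ * q ^ (a + 1) = 1 := by
    rw [← hr, pow_succ]
    have := hq.ne_zero
    field_simp
  -- For `r = q^{-a}` all powers of `q` in the binomial formula cancel, so that reversing the
  -- summation changes only signs.
  have hr'' : ∀ k, (r * q⁻¹) ^ k * q ^ (k * (a + 1)) = 1 := by
    intro k
    rw [mul_comm k, pow_mul, ← mul_pow, hr', one_pow]
  have e : (qFac q (a + 1))⁻¹ • qad q r f x (a + 1) =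
      (-1 : K) ^ (a + 1) • (qFac q (a + 1))⁻¹ • rqad q r f x (a + 1) := by
    rw [hq.qad_eq_sum, hq.rqad_eq_sum, ← Finset.sum_range_reflect, Finset.smul_sum]
    refine Finset.sum_congr rfl fun k hk => ?_
    have hk' := Finset.mem_range.1 hk
    have e1 : a + 1 + 1 - 1 - k = a + 1 - k := by omega
    have e2 : a + 1 - (a + 1 - k) = k := by omega
    rw [e1, e2, smul_smul, mul_assoc (_ ^ _), hr'', mul_assoc (_ ^ k), hr'', mul_one, mul_one]
    congr 1
    obtain ⟨l, hl⟩ := Nat.exists_eq_add_of_le (show k ≤ a + 1 by omega)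
    rw [hl, Nat.add_sub_cancel_left, pow_add]
    have : ((-1 : K) ^ k) * (-1) ^ k = 1 := by rw [← mul_pow]; simp
    linear_combination -(-1 : K) ^ l * this
  rw [← smul_eq_zero_iff_right h0, e, smul_eq_zero_iff_right (pow_ne_zero _ (by simp)),
    smul_eq_zero_iff_right h0]

/-- The `q`-Leibniz rule. -/
lemma Generic.qad_mul (ρ : K) (N : ℕ) : (qFac q N)⁻¹ • qad q (r * ρ) f (x * y) N =
    ∑ s ∈ Finset.range (N + 1), (ρ ^ s * q ^ (s * (N - s))) •
      (((qFac q s)⁻¹ • qad q r f x s) * ((qFac q (N - s))⁻¹ • qad q ρ f y (N - s))) := by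
  induction N with
  | zero => simp
  | succ N ih =>
    have h1 := hq.qFac_ne_zero N
    have h2 := hq.qNum_ne_zero (Nat.succ_pos N)
    have h0 := hq.ne_zero
    have e1 : (qFac q (N + 1))⁻¹ • qad q (r * ρ) f (x * y) (N + 1) = (qNum q (N + 1))⁻¹ •
        (((qFac q N)⁻¹ • qad q (r * ρ) f (x * y) N) * f -
          (r * ρ * q ^ (2 * N)) • (f * ((qFac q N)⁻¹ • qad q (r * ρ) f (x * y) N))) := by
      rw [qad_succ, qFac_succ, mul_inv, smul_mul_assoc, mul_smul_comm, mul_comm _ (qNum q _)⁻¹,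
        mul_smul, smul_sub, smul_comm (qFac q N)⁻¹]
    have step : ∀ (r : K) (x : B) (s : ℕ), ((qFac q s)⁻¹ • qad q r f x s) * f =
        qNum q (s + 1) • ((qFac q (s + 1))⁻¹ • qad q r f x (s + 1)) +
          (r * q ^ (2 * s)) • (f * ((qFac q s)⁻¹ • qad q r f x s)) := by
      intro r x s
      have h1 := hq.qFac_ne_zero s
      have h2 := hq.qNum_ne_zero (Nat.succ_pos s)
      rw [smul_smul, qFac_succ, show qNum q (s + 1) * (qFac q s * qNum q (s + 1))⁻¹ =
        (qFac q s)⁻¹ by field_simp, qad_succ]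
      simp only [smul_mul_assoc, mul_smul_comm]
      module
    set X : ℕ → B := fun s => (qFac q s)⁻¹ • qad q r f x s
    set Y : ℕ → B := fun s => (qFac q s)⁻¹ • qad q ρ f y s
    have sx : ∀ s, X s * f = qNum q (s + 1) • X (s + 1) + (r * q ^ (2 * s)) • (f * X s) := step r x
    have sy : ∀ s, Y s * f = qNum q (s + 1) • Y (s + 1) + (ρ * q ^ (2 * s)) • (f * Y s) := step ρ y
    rw [e1, inv_smul_eq_iff₀ h2, ih]
    change (∑ s ∈ Finset.range (N + 1), (ρ ^ s * q ^ (s * (N - s))) • (X s * Y (N - s))) * f -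
      (r * ρ * q ^ (2 * N)) •
        (f * ∑ s ∈ Finset.range (N + 1), (ρ ^ s * q ^ (s * (N - s))) • (X s * Y (N - s))) =
      qNum q (N + 1) • ∑ s ∈ Finset.range (N + 1 + 1),
        (ρ ^ s * q ^ (s * (N + 1 - s))) • (X s * Y (N + 1 - s))
    clear_value X Y
    rw [Finset.sum_mul, Finset.mul_sum, Finset.smul_sum, Finset.smul_sum, ← Finset.sum_sub_distrib]
    have e2 : ∀ s ∈ Finset.range (N + 1 + 1),
        qNum q (N + 1) • (ρ ^ s * q ^ (s * (N + 1 - s))) • (X s * Y (N + 1 - s)) =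
        (ρ ^ s * q ^ (s * (N - s)) * qNum q (N + 1 - s)) • (X s * Y (N + 1 - s)) +
        (ρ ^ s * q ^ (s * (N + 1 - s) + (N + 1 - s)) * qNum q s) • (X s * Y (N + 1 - s)) := by
      intro s hs
      have hs' := Finset.mem_range.1 hs
      obtain ⟨t, ht⟩ := Nat.exists_eq_add_of_le (show s ≤ N + 1 by omega)
      rw [smul_smul, ← add_smul]
      congr 1
      rw [show N + 1 - s = t by omega, ht]
      -- The case `t = 0` is `s = N + 1`, where the subtraction `N - s` is truncated.
      rcases Nat.eq_zero_or_pos t with rfl | ht0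
      · simp; ring
      rw [show N - s = t - 1 by omega]
      have e : q ^ (s * t) = q ^ (s * (t - 1)) * q ^ s := by
        rw [← pow_add]
        congr 1
        obtain ⟨u, rfl⟩ := Nat.exists_eq_succ_of_ne_zero ht0.ne'
        simp; ring
      have := hq.qNum_add s t
      rw [pow_add, e]
      rw [pow_add] at this
      linear_combination (-ρ ^ s * q ^ (s * (t - 1))) * this
    rw [Finset.sum_congr rfl e2, Finset.sum_add_distrib, Finset.sum_range_succ _ (N + 1),
      Finset.sum_range_succ' _ (N + 1)]
    simp only [Nat.sub_self, qNum_zero, mul_zero, zero_smul, add_zero]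
    rw [← Finset.sum_add_distrib]
    refine Finset.sum_congr rfl fun s hs => ?_
    have hs' := Finset.mem_range.1 hs
    obtain ⟨t, ht⟩ := Nat.exists_eq_add_of_le (show s ≤ N by omega)
    rw [show N + 1 - s = t + 1 by omega, show N + 1 - (s + 1) = t by omega,
      show N - s = t by omega, ht, smul_mul_assoc, mul_assoc, sy, mul_add, mul_smul_comm,
      mul_smul_comm, ← mul_assoc, sx, add_mul, smul_mul_assoc, smul_mul_assoc, mul_smul_comm,
      mul_assoc]
    have e3 : q ^ ((s + 1) * t + t) = q ^ (s * t) * q ^ (2 * t) := by rw [← pow_add]; ring_nf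
    have e4 : q ^ (2 * (s + t)) = q ^ (2 * s) * q ^ (2 * t) := by rw [← pow_add]; ring_nf
    rw [e3, e4, pow_succ]
    module

end Adjoint

end QuantumAdjoint
end

/-! ### Highest vectors, and commutation with neighbouring levels -/

noncomputable section

namespace QuantumAdjoint

variable {K B : Type*} [Field K] [Ring B] [Algebra K B]

/-! ### Top divided powers -/

/-- `x` spans the lowest weight space of an `(n+1)`-dimensional module for the adjoint action of
`f`, and `X` is its top divided power, normalized by the scalar `η`. -/
def IsTopPower (q η : K) (f : B) (n : ℕ) (x X : B) : Prop :=
  qad q (q⁻¹ ^ n) f x n = (qFac q n * η ^ n) • X ∧ qad q (q⁻¹ ^ n) f x (n + 1) = 0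

section Top

variable {q η : K} {f : B}

lemma isTopPower_one : IsTopPower q η f 0 1 1 := by
  simp [IsTopPower, qad]

lemma IsTopPower.smul {n : ℕ} {x X : B} (h : IsTopPower q η f n x X) (c : K) :
    IsTopPower q η f n (c • x) (c • X) := by
  refine ⟨?_, ?_⟩
  · rw [qad_smul, h.1, smul_comm]
  · rw [qad_smul, h.2, smul_zero]

lemma IsTopPower.add {n : ℕ} {x X y Y : B} (h : IsTopPower q η f n x X) (h' : IsTopPower q η f n y Y) :
    IsTopPower q η f n (x + y) (X + Y) := by
  refine ⟨?_, ?_⟩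
  · rw [qad_add, h.1, h'.1, smul_add]
  · rw [qad_add, h.2, h'.2, add_zero]

lemma isTopPower_zero {n : ℕ} : IsTopPower q η f n (0 : B) 0 := by
  simp [IsTopPower, qad_zero_right]

lemma IsTopPower.sum {ι : Type*} {n : ℕ} (s : Finset ι) {x X : ι → B}
    (h : ∀ i ∈ s, IsTopPower q η f n (x i) (X i)) :
    IsTopPower q η f n (∑ i ∈ s, x i) (∑ i ∈ s, X i) := by
  classical
  induction s using Finset.induction_on with
  | empty => simpa using isTopPower_zero
  | insert a s ha ih =>
    rw [Finset.sum_insert ha, Finset.sum_insert ha]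
    exact (h a (by simp)).add (ih fun i hi => h i (by simp [hi]))

variable (hq : Generic q)
include hq

/-- In the `q`-Leibniz sum of order `n + m` only the term `s = n` survives, and in order `n + m + 1`
none does. -/
lemma IsTopPower.mul {n m : ℕ} {x X y Y : B} (h : IsTopPower q η f n x X) (h' : IsTopPower q η f m y Y) :
    IsTopPower q η f (n + m) (x * y) (X * Y) := by
  have hx : ∀ s, n < s → qad q (q⁻¹ ^ n) f x s = 0 := fun s hs => qad_eq_zero_of_le h.2 hs
  have hy : ∀ s, m < s → qad q (q⁻¹ ^ m) f y s = 0 := fun s hs => qad_eq_zero_of_le h'.2 hs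
  have h0 := hq.ne_zero
  constructor
  · have := hq.qad_mul (q⁻¹ ^ n) f x y (q⁻¹ ^ m) (n + m)
    rw [Finset.sum_eq_single n, ← pow_add] at this
    · rw [inv_smul_eq_iff₀ (hq.qFac_ne_zero _)] at this
      rw [this, Nat.add_sub_cancel_left, h.1, h'.1, smul_smul, smul_smul, ← mul_assoc, ← mul_assoc,
        inv_mul_cancel₀ (hq.qFac_ne_zero _), one_mul, smul_smul, ← mul_assoc _ (qFac q m),
        inv_mul_cancel₀ (hq.qFac_ne_zero _), one_mul,
        smul_mul_assoc, mul_smul_comm, smul_smul, smul_smul, pow_add]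
      congr 1
      have e : (q⁻¹ ^ m) ^ n * q ^ (n * m) = 1 := by
        rw [mul_comm n, pow_mul, ← mul_pow, inv_pow, inv_mul_cancel₀ (pow_ne_zero _ h0), one_pow]
      linear_combination (qFac q (n + m) * η ^ n * η ^ m) * e
    · intro s hs hsn
      have := Finset.mem_range.1 hs
      rcases lt_or_gt_of_ne hsn with h1 | h1
      · rw [hy (n + m - s) (by omega)]; simp
      · rw [hx s h1]; simp
    · intro h1; simp at h1
  · have := hq.qad_mul (q⁻¹ ^ n) f x y (q⁻¹ ^ m) (n + m + 1)
    rw [Finset.sum_eq_zero, ← pow_add,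
      smul_eq_zero_iff_right (inv_ne_zero (hq.qFac_ne_zero _))] at this
    · exact this
    · intro s _
      rcases lt_or_ge n s with h1 | h1
      · rw [hx s h1]; simp
      · rw [hy (n + m + 1 - s) (by omega)]; simp

lemma IsTopPower.pow {n : ℕ} {x X : B} (h : IsTopPower q η f n x X) (k : ℕ) :
    IsTopPower q η f (k * n) (x ^ k) (X ^ k) := by
  induction k with
  | zero => simpa using isTopPower_one
  | succ k ih =>
    rw [pow_succ, pow_succ, Nat.succ_mul]
    exact ih.mul hq h

lemma IsTopPower.unique {n : ℕ} {x X Y : B} (hη : η ≠ 0) (h : IsTopPower q η f n x X)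
    (h' : IsTopPower q η f n x Y) : X = Y := by
  have := h.1.symm.trans h'.1
  exact smul_right_injective B (mul_ne_zero (hq.qFac_ne_zero n) (pow_ne_zero n hη)) this

end Top

/-! ### Commutation with a neighbouring level -/

section Boson

variable (q r : K)

/-- The structure constants of the lowering operator. -/
def lowerCoeff (s : ℕ) : K := (1 - q ^ (2 * (s + 1))) * (1 - r ^ 2 * q ^ (2 * s))

variable {q r} {e f g x : B}

/-- The basic raising and lowering relation: `q`-commutation with `e` steps down the chain built
with `f`. For `r = q^{-a}` the coefficient `lowerCoeff q r s` vanishes at `s = a`, consistently with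
the chain stopping there. -/
lemma qad_mul_next (hfe : f * e = q ^ 2 • (e * f) + (1 - q ^ 2) • 1)
    (hxe : x * e = r • (e * x)) (s : ℕ) :
    qad q r f x (s + 1) * e = (r * q ^ (2 * (s + 1))) • (e * qad q r f x (s + 1)) +
      lowerCoeff q r s • qad q r f x s := by
  have hfe' : ∀ w, f * (e * w) = q ^ 2 • (e * (f * w)) + (1 - q ^ 2) • w := by
    intro w; rw [← mul_assoc, hfe, add_mul, smul_mul_assoc, smul_mul_assoc, one_mul, mul_assoc]
  induction s with
  | zero =>
    simp only [qad_succ, qad_zero, lowerCoeff, sub_mul, mul_sub, smul_mul_assoc, mul_assoc, hfe,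
      hxe, mul_add, mul_smul_comm, mul_one, hfe', smul_sub]
    rw [← mul_assoc x e f, hxe]
    simp only [smul_mul_assoc, mul_assoc]
    module
  | succ s ih =>
    rw [qad_succ q r f x (s + 1)]
    have h1 : qad q r f x (s + 1) = qad q r f x s * f - (r * q ^ (2 * s)) • (f * qad q r f x s) :=
      rfl
    have h1' : qad q r f x s * f = qad q r f x (s + 1) + (r * q ^ (2 * s)) • (f * qad q r f x s) :=
      by rw [h1]; abel
    generalize qad q r f x (s + 1) = u at *
    generalize qad q r f x s = v at *
    simp only [sub_mul, mul_sub, smul_mul_assoc, mul_assoc, hfe, ih, mul_add, mul_smul_comm,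
      mul_one, hfe', smul_sub, smul_add]
    rw [← mul_assoc u e f, ih]
    simp only [add_mul, smul_mul_assoc, mul_assoc, h1', lowerCoeff, smul_add]
    module

/-- The level before that of `f` does not lower: the two constants `1 - q ^ 2` arising in each
commutator cancel. -/
lemma prev_mul_qad (hgf : g * f = q ^ 2 • (f * g) + (1 - q ^ 2) • 1)
    (hgx : g * x = r • (x * g)) (s : ℕ) :
    g * qad q r f x s = (r * q ^ (2 * s)) • (qad q r f x s * g) := by
  have hgf' : ∀ w, g * (f * w) = q ^ 2 • (f * (g * w)) + (1 - q ^ 2) • w := by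
    intro w; rw [← mul_assoc, hgf, add_mul, smul_mul_assoc, smul_mul_assoc, one_mul, mul_assoc]
  induction s with
  | zero => simp [hgx]
  | succ s ih =>
    rw [qad_succ]
    generalize qad q r f x s = v at *
    simp only [sub_mul, mul_sub, smul_mul_assoc, mul_assoc, mul_smul_comm, hgf', ih, smul_add]
    rw [← mul_assoc g v f, ih]
    simp only [smul_mul_assoc, mul_assoc, hgf, mul_add, mul_smul_comm, mul_one]
    module

/-- `q`-commutation is inherited by iterated `q`-commutators. -/
lemma qad_mul_of_comm {ν μ : K} (hx : x * g = ν • (g * x)) (hf : f * g = μ • (g * f)) (s : ℕ) :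
    qad q r f x s * g = (ν * μ ^ s) • (g * qad q r f x s) := by
  induction s with
  | zero => simp [hx]
  | succ s ih =>
    rw [qad_succ]
    generalize qad q r f x s = v at *
    simp only [sub_mul, mul_sub, smul_mul_assoc, mul_assoc, mul_smul_comm, hf, ih]
    rw [← mul_assoc v g f, ih, ← mul_assoc f g v, hf]
    simp only [smul_mul_assoc, mul_assoc]
    module

lemma mul_qad_of_comm {ν μ : K} (hx : g * x = ν • (x * g)) (hf : g * f = μ • (f * g)) (s : ℕ) :
    g * qad q r f x s = (ν * μ ^ s) • (qad q r f x s * g) := by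
  induction s with
  | zero => simp [hx]
  | succ s ih =>
    rw [qad_succ]
    generalize qad q r f x s = v at *
    simp only [sub_mul, mul_sub, smul_mul_assoc, mul_assoc, mul_smul_comm, hf]
    rw [← mul_assoc g v f, ih, ← mul_assoc g f v, hf]
    simp only [smul_mul_assoc, mul_assoc, hf, ih, mul_smul_comm]
    module

variable {y : B} {r' κ : K}

/-- Expand the last commutator with `e` and move it past `x_{s+1}`. This creates `x_s`, and the two
hypotheses reorder everything. The terms in `x_s` and `y_t` then cancel, and only a multiple of the
constant `c` remains. -/
lemma qad_mul_qad_step (hfe : f * e = q ^ 2 • (e * f) + (1 - q ^ 2) • 1)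
    (hxe : x * e = r • (e * x)) {s t : ℕ} {c : K}
    (h1 : qad q r f x (s + 1) * qad q r' e y t = (κ * r' ^ (s + 1) * r ^ t * q ^ (2 * (s + 1) * t)) •
      (qad q r' e y t * qad q r f x (s + 1)))
    (h2 : qad q r f x s * qad q r' e y t = (κ * r' ^ s * r ^ t * q ^ (2 * s * t)) •
      (qad q r' e y t * qad q r f x s) + c • 1) :
    qad q r f x (s + 1) * qad q r' e y (t + 1) =
      (κ * r' ^ (s + 1) * r ^ (t + 1) * q ^ (2 * (s + 1) * (t + 1))) •
      (qad q r' e y (t + 1) * qad q r f x (s + 1)) +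
      (-(r' * q ^ (2 * t)) * lowerCoeff q r s * c) • 1 := by
  have h3 := qad_mul_next hfe hxe s
  have k1 : κ * r' ^ (s + 1) * r ^ t * q ^ (2 * (s + 1) * t) =
      κ * r' ^ s * r ^ t * q ^ (2 * s * t) * (r' * q ^ (2 * t)) := by ring
  have k2 : κ * r' ^ (s + 1) * r ^ (t + 1) * q ^ (2 * (s + 1) * (t + 1)) =
      κ * r' ^ s * r ^ t * q ^ (2 * s * t) * (r' * q ^ (2 * t)) * (r * q ^ (2 * (s + 1))) := by
    ring
  rw [qad_succ q r' e y t, k2]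
  rw [k1] at h1
  generalize qad q r f x (s + 1) = u at *
  generalize qad q r f x s = v at *
  generalize qad q r' e y t = w at *
  generalize r * q ^ (2 * (s + 1)) = ρ at *
  generalize r' * q ^ (2 * t) = σ at *
  generalize κ * r' ^ s * r ^ t * q ^ (2 * s * t) = k at *
  simp only [sub_mul, mul_sub, smul_mul_assoc, mul_smul_comm, mul_assoc]
  rw [← mul_assoc u w e, h1, ← mul_assoc u e w, h3]
  simp only [add_mul, smul_mul_assoc, mul_assoc, h1, h2, h3, mul_add, mul_smul_comm, smul_add,
    mul_one]
  module

lemma qad_mul_qad_zero (hxy : x * y = κ • (y * x)) (hfy : f * y = r' • (y * f)) (s : ℕ) :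
    qad q r f x s * y = (κ * r' ^ s) • (y * qad q r f x s) :=
  qad_mul_of_comm hxy hfy s

lemma qad_zero_mul_qad (hxe : x * e = r • (e * x)) (hxy : x * y = κ • (y * x)) (t : ℕ) :
    x * qad q r' e y t = (κ * r ^ t) • (qad q r' e y t * x) :=
  mul_qad_of_comm hxy hxe t

/-- Commutation of the images of two generators in neighbouring levels, different indices. -/
lemma qad_mul_qad (hfe : f * e = q ^ 2 • (e * f) + (1 - q ^ 2) • 1)
    (hxe : x * e = r • (e * x)) (hxy : x * y = κ • (y * x)) (hfy : f * y = r' • (y * f))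
    (s t : ℕ) : qad q r f x s * qad q r' e y t =
      (κ * r' ^ s * r ^ t * q ^ (2 * s * t)) • (qad q r' e y t * qad q r f x s) := by
  induction t generalizing s with
  | zero => simpa using qad_mul_qad_zero (r := r) hxy hfy s
  | succ t ih =>
    cases s with
    | zero => simpa using qad_zero_mul_qad (r' := r') hxe hxy (t + 1)
    | succ s =>
      have := qad_mul_qad_step (κ := κ) (c := 0) hfe hxe (ih (s + 1)) (by simpa using ih s)
      simpa using this

/-- Commutation of the images of two generators in neighbouring levels, equal indices. -/
lemma qad_mul_qad_self {c : K} (hfe : f * e = q ^ 2 • (e * f) + (1 - q ^ 2) • 1)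
    (hxe : x * e = r • (e * x)) (hxy : x * y = κ • (y * x) + c • 1) (hfy : f * y = r • (y * f))
    (s : ℕ) : qad q r f x s * qad q r e y s =
      (κ * r ^ s * r ^ s * q ^ (2 * s * s)) • (qad q r e y s * qad q r f x s) +
      ((∏ t ∈ Finset.range s, (-(r * q ^ (2 * t)) * lowerCoeff q r t)) * c) • 1 := by
  -- In the first commutator the constants coming from `x f y` and `f x y` cancel.
  have base : ∀ s, qad q r f x (s + 1) * y = (κ * r ^ (s + 1)) • (y * qad q r f x (s + 1)) := by
    intro s
    have h1 : qad q r f x 1 * y = (κ * r) • (y * qad q r f x 1) := by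
      simp only [qad_succ, qad_zero, sub_mul, mul_sub, smul_mul_assoc, mul_assoc, hxy, hfy, mul_add,
        mul_smul_comm, mul_one]
      rw [← mul_assoc x y f, hxy, ← mul_assoc f y x, hfy]
      simp only [add_mul, smul_mul_assoc, one_mul, mul_assoc]
      module
    rw [add_comm, qad_shift, qad_mul_of_comm h1 hfy s]
    congr 1; ring
  -- Away from the diagonal, with more commutators on the left, no constant appears; the constant
  -- `c` propagates along the diagonal only.
  have off : ∀ t s, qad q r f x (s + 1 + t) * qad q r e y t =
      (κ * r ^ (s + 1 + t) * r ^ t * q ^ (2 * (s + 1 + t) * t)) •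
        (qad q r e y t * qad q r f x (s + 1 + t)) := by
    intro t
    induction t with
    | zero => intro s; simpa using base s
    | succ t ih =>
      intro s
      have h1 := ih (s + 1)
      have h2 := ih s
      rw [show s + 1 + 1 + t = s + 1 + t + 1 by ring] at h1
      have := qad_mul_qad_step (κ := κ) (c := 0) hfe hxe h1 (by simpa using h2)
      simpa [add_assoc] using this
  induction s with
  | zero => simpa using hxy
  | succ s ih =>
    have h1 := off s 0
    rw [zero_add, add_comm 1 s] at h1
    have := qad_mul_qad_step (κ := κ) hfe hxe h1 ih
    rw [this, Finset.prod_range_succ]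
    congr 2
    ring

/-- The mirror commutators with `e` undo the commutators with `f`. -/
lemma rqad_qad (hfe : f * e = q ^ 2 • (e * f) + (1 - q ^ 2) • 1)
    (hxe : x * e = r • (e * x)) {a : ℕ} (hr : r * q ^ a = 1) (s t : ℕ) (hst : s + t = a) :
    rqad q r e (qad q r f x a) s =
      (∏ u ∈ Finset.range s, (-(r * q ^ (2 * u)) * lowerCoeff q r (a - 1 - u))) •
        qad q r f x t := by
  induction s generalizing t with
  | zero => simp [← hst]
  | succ s ih =>
    rw [rqad_succ, ih (t + 1) (by omega), Finset.prod_range_succ, show a - 1 - s = t by omega]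
    have h1 := qad_mul_next hfe hxe t
    have h2 : r * q ^ (2 * s) * (r * q ^ (2 * (t + 1))) = 1 := by
      have : r * q ^ (2 * s) * (r * q ^ (2 * (t + 1))) = (r * q ^ a) ^ 2 := by
        rw [← hst]; ring
      rw [this, hr, one_pow]
    generalize qad q r f x (t + 1) = u at *
    generalize qad q r f x t = v at *
    generalize (∏ u ∈ Finset.range s, (-(r * q ^ (2 * u)) * lowerCoeff q r (a - 1 - u))) = P at *
    generalize r * q ^ (2 * s) = ρ at *
    generalize r * q ^ (2 * (t + 1)) = σ at *
    simp only [smul_mul_assoc, mul_smul_comm, h1, smul_add, smul_smul]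
    rw [show ρ * (P * σ) = P by linear_combination P * h2]
    module

/-- After `a` lowerings nothing is left: the Serre relation between `e` and `x_a`. -/
lemma rqad_qad_succ (hfe : f * e = q ^ 2 • (e * f) + (1 - q ^ 2) • 1)
    (hxe : x * e = r • (e * x)) {a : ℕ} (hr : r * q ^ a = 1) :
    rqad q r e (qad q r f x a) (a + 1) = 0 := by
  rw [rqad_succ, rqad_qad hfe hxe hr a 0 (by simp), qad_zero]
  have h2 : r * q ^ (2 * a) * r = 1 := by
    have : r * q ^ (2 * a) * r = (r * q ^ a) ^ 2 := by ring
    rw [this, hr, one_pow]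
  simp only [smul_mul_assoc, mul_smul_comm, hxe]
  rw [smul_smul, smul_smul, mul_right_comm, h2, one_mul, sub_self]

end Boson

end QuantumAdjoint
end

/-! ### Exchanging the two roles in a Serre relation -/

noncomputable section

namespace QuantumAdjoint

variable {K B : Type*} [Field K] [Ring B] [Algebra K B]

/-! ### Twisted derivations along a commutator -/

/-- `x' = x f - ρ f x` is the `ρ`-commutator of `x` with `f`. -/
def IsDer (f : B) (ρ : K) (x x' : B) : Prop := x * f = x' + ρ • (f * x)

section Der

variable {f : B} {ρ σ : K} {x x' y y' : B}

lemma IsDer.mul (hx : IsDer f ρ x x') (hy : IsDer f σ y y') :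
    IsDer f (ρ * σ) (x * y) (x * y' + σ • (x' * y)) := by
  unfold IsDer at *
  rw [mul_assoc, hy, mul_add, mul_smul_comm, ← mul_assoc x f y, hx, add_mul, smul_mul_assoc,
    smul_add, smul_smul, mul_assoc, mul_comm ρ, add_assoc]

lemma IsDer.smul (hx : IsDer f ρ x x') (c : K) : IsDer f ρ (c • x) (c • x') := by
  unfold IsDer at *
  rw [smul_mul_assoc, hx, mul_smul_comm, smul_add, smul_comm]

lemma IsDer.add (hx : IsDer f ρ x x') (hy : IsDer f ρ y y') : IsDer f ρ (x + y) (x' + y') := by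
  unfold IsDer at *
  rw [add_mul, hx, hy, mul_add, smul_add]; abel

lemma IsDer.sub (hx : IsDer f ρ x x') (hy : IsDer f ρ y y') : IsDer f ρ (x - y) (x' - y') := by
  unfold IsDer at *
  rw [sub_mul, hx, hy, mul_sub, smul_sub]; abel

lemma IsDer.eq_zero (hx : IsDer f ρ x x') (h : x = 0) : x' = 0 := by
  unfold IsDer at hx
  simpa [h] using hx.symm

lemma IsDer.congr (hx : IsDer f ρ x x') (h : ρ = σ) : IsDer f σ x x' := h ▸ hx

lemma isDer_qad (q r : K) (f x : B) (s : ℕ) :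
    IsDer f (r * q ^ (2 * s)) (qad q r f x s) (qad q r f x (s + 1)) := by
  rw [IsDer, qad_succ]; abel

end Der

/-! ### The Serre relation with the roles of the generators exchanged -/

section SerreSwap

variable {p q r : K} {e f x x₀ x₁ x₂ x₃ : B}

/-- In this and the next four lemmas the hypothesis is a relation between `x₀` and `x₁`. Twisted
commutation with `f` is a derivation along the chain, and applying it until the degree in `f` is
right yields the target: zero, one, two, two and four times respectively. -/
lemma serre_swap_of_one_one (hp : p ≠ 0) (hr : r = (p ^ 1)⁻¹)
    (h : qad p r x₀ x₁ 1 = 0) : qad p (r * p ^ 2) x₁ x₀ 1 = 0 := by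
  have key : qad p (r * p ^ 2) x₁ x₀ 1 = (-p) • qad p r x₀ x₁ 1 := by
    subst hr
    simp only [qad_succ, qad_zero]
    match_scalars <;> field_simp <;> ring
  rw [key, h, smul_zero]

lemma serre_swap_of_one_two (hp : p ≠ 0) (hr : r = (p ^ 2)⁻¹) (h0 : IsDer f r x₀ x₁)
    (h1 : IsDer f (p ^ 2) x₁ 0) (h : qad p r x₀ x₁ 2 = 0) :
    qad p (r * p ^ 2) x₁ x₀ 2 = 0 := by
  subst hr
  have d := ((h1.mul h0).mul h0).sub
    (((((h0.mul h1).mul h0).smul (1 + (p ^ 2)⁻¹)).congr (by ring)).sub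
    ((((h0.mul h0).mul h1).smul ((p ^ 2)⁻¹)).congr (by ring)))
  have d := d.eq_zero (by
    rw [← h]
    simp only [qad_succ, qad_zero, mul_sub, sub_mul, smul_mul_assoc, mul_smul_comm, mul_assoc]
    match_scalars <;> field_simp <;> ring)
  refine Eq.trans ?_ ((congrArg ((-p ^ 2) • ·) d).trans (smul_zero _))
  simp only [qad_succ, qad_zero, mul_sub, sub_mul, smul_mul_assoc, mul_smul_comm, mul_assoc,
    mul_add, add_mul, mul_zero, zero_mul]
  match_scalars <;> field_simp <;> ring

lemma serre_swap_of_one_three (hp : p ≠ 0) (hp6 : 1 + p ^ 6 ≠ 0) (hr : r = (p ^ 3)⁻¹)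
    (h0 : IsDer f r x₀ x₁) (h1 : IsDer f (p ^ 3) x₁ 0) (h : qad p r x₀ x₁ 3 = 0) :
    qad p (r * p ^ 2) x₁ x₀ 3 = 0 := by
  subst hr
  have hw : (p ^ 3)⁻¹ * p ^ 3 = 1 := by field_simp
  have d := ((h1.mul (h0.mul (h0.mul h0))).sub
    (((h0.mul (h1.mul (h0.mul h0))).smul ((p ^ 3)⁻¹ + p⁻¹ + p)).congr (by ring))).add
    ((((h0.mul (h0.mul (h1.mul h0))).smul ((p ^ 4)⁻¹ + (p ^ 2)⁻¹ + 1)).congr (by ring)).sub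
    (((h0.mul (h0.mul (h0.mul h1))).smul (p ^ 3)⁻¹).congr (by ring)))
  have d := d.eq_zero (by
    rw [← h]
    simp only [qad_succ, qad_zero, mul_sub, sub_mul, smul_mul_assoc, mul_smul_comm, mul_assoc]
    match_scalars <;> field_simp <;> ring)
  have d2 := (((((h1.mul (h1.mul (h0.mul h0))).smul (-(p ^ 4)⁻¹ - (p ^ 2)⁻¹)).add
    (((h1.mul (h0.mul (h1.mul h0))).smul ((p ^ 7)⁻¹ + (p ^ 5)⁻¹ + 2 * (p ^ 3)⁻¹)).congr
      (by ring))).add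
    (((h1.mul (h0.mul (h0.mul h1))).smul (1 - (p ^ 6)⁻¹)).congr (by ring))).add
    (((h0.mul (h1.mul (h1.mul h0))).smul (1 - (p ^ 6)⁻¹)).congr (by ring))).add
    ((((h0.mul (h1.mul (h0.mul h1))).smul (-2 * (p ^ 3)⁻¹ - p⁻¹ - p)).congr (by ring)).add
    (((h0.mul (h0.mul (h1.mul h1))).smul ((p ^ 4)⁻¹ + (p ^ 2)⁻¹)).congr (by ring)))
  have d2 := d2.eq_zero (by
    rw [← d]
    simp only [mul_add, mul_zero, zero_mul, smul_mul_assoc, mul_smul_comm]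
    match_scalars <;> field_simp <;> ring)
  -- The second derivative is the target multiplied by a scalar with factor `1 + p ^ 6`, hence the
  -- nonvanishing hypothesis.
  refine Eq.trans ?_ ((congrArg ((-(1 + p ^ 6)⁻¹ * p ^ 6) • ·) d2).trans (smul_zero _))
  simp only [qad_succ, qad_zero, mul_sub, sub_mul, smul_mul_assoc, mul_smul_comm, mul_assoc,
    mul_add, add_mul, mul_zero, zero_mul]
  match_scalars <;> field_simp <;> ring

lemma serre_swap_of_two_one (hq : q ≠ 0) (hr : r = (q ^ 2)⁻¹) (h0 : IsDer f r x₀ x₁)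
    (h1 : IsDer f (1 : K) x₁ x₂) (h2 : IsDer f (q ^ 2) x₂ 0) (h : qad (q ^ 2) r x₀ x₁ 1 = 0) :
    qad (q ^ 2) (r * (q ^ 2) ^ 2) x₂ x₁ 1 = 0 := by
  subst hr
  have d := ((h1.mul h0).sub (((h0.mul h1).smul (q ^ 2)⁻¹).congr (by ring))).eq_zero (by
    rw [← h]; simp [qad_succ])
  have d2 := (((h1.mul h1).smul (1 - (q ^ 2)⁻¹)).add
    ((((h2.mul h0).smul (q ^ 2)⁻¹).congr (by field_simp)).sub
    (((h0.mul h2).smul (q ^ 2)⁻¹).congr (by field_simp)))).eq_zero (by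
      rw [← d]
      match_scalars <;> field_simp <;> ring)
  refine Eq.trans ?_ ((congrArg ((-q ^ 2) • ·) d2).trans (smul_zero _))
  simp only [qad_succ, qad_zero, mul_zero, zero_mul]
  match_scalars <;> field_simp <;> ring

lemma serre_swap_of_three_one (hq : q ≠ 0) (hq4 : 1 + q ^ 4 ≠ 0) (hr : r = (q ^ 3)⁻¹)
    (h0 : IsDer f r x₀ x₁) (h1 : IsDer f q⁻¹ x₁ x₂) (h2 : IsDer f q x₂ x₃)
    (h3 : IsDer f (q ^ 3) x₃ 0) (h : qad (q ^ 3) r x₀ x₁ 1 = 0) :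
    qad (q ^ 3) (r * (q ^ 3) ^ 2) x₃ x₂ 1 = 0 := by
  subst hr
  have d := ((h1.mul h0).sub (((h0.mul h1).smul (q ^ 3)⁻¹).congr (by ring))).eq_zero (by
    rw [← h]; simp [qad_succ])
  have d := (((h2.mul h0).smul (q ^ 3)⁻¹).add
    ((((h1.mul h1).smul (1 - (q ^ 4)⁻¹)).congr (by field_simp)).sub
    (((h0.mul h2).smul (q ^ 3)⁻¹).congr (by ring)))).eq_zero (by
      rw [← d]
      match_scalars <;> field_simp <;> ring)
  have d := ((((h3.mul h0).smul (q ^ 6)⁻¹).congr (by field_simp)).add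
    (((((h2.mul h1).smul (q⁻¹ + (q ^ 3)⁻¹ - (q ^ 5)⁻¹)).congr (by field_simp)).add
    (((h1.mul h2).smul (1 - (q ^ 2)⁻¹ - (q ^ 4)⁻¹)).congr (by field_simp))).sub
    (((h0.mul h3).smul (q ^ 3)⁻¹).congr (by field_simp)))).eq_zero (ρ := 1) (by
      rw [← d]
      match_scalars <;> field_simp <;> ring)
  have d := ((((h3.mul h1).smul ((q ^ 4)⁻¹ + (q ^ 2)⁻¹)).congr (by field_simp)).add
    ((((h2.mul h2).smul (q - (q ^ 5)⁻¹)).congr (by field_simp)).sub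
    (((h1.mul h3).smul ((q ^ 4)⁻¹ + (q ^ 2)⁻¹)).congr (by field_simp)))).eq_zero (ρ := q ^ 2) (by
      rw [← d]
      simp only [mul_add, add_mul, mul_zero, zero_mul, smul_mul_assoc, mul_smul_comm]
      match_scalars <;> field_simp <;> ring)
  refine Eq.trans ?_ ((congrArg ((-(1 + q ^ 4)⁻¹ * q ^ 5) • ·) d).trans (smul_zero _))
  simp only [qad_succ, qad_zero, mul_zero, zero_mul]
  match_scalars <;> field_simp <;> ring

/-- The first commutator of `e` with the top of the chain is a lowering, hence a multiple of the
preceding term. The relation to be shown loses one order and no longer involves `e`. -/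
lemma serre_swap_reduce (hfe : f * e = q ^ 2 • (e * f) + (1 - q ^ 2) • 1)
    (hxe : x * e = r • (e * x)) {b a' : ℕ} (hr : r * q ^ (b + 1) = 1)
    (h : qad p (r * p ^ 2) (qad q r f x (b + 1)) (qad q r f x b) a' = 0) :
    qad p r (qad q r f x (b + 1)) e (a' + 1) = 0 := by
  have h1 := qad_mul_next hfe hxe b
  rw [add_comm a' 1, qad_shift, mul_one]
  have h2 : qad p r (qad q r f x (b + 1)) e 1 = (-r * lowerCoeff q r b) • qad q r f x b := by
    rw [qad_succ, qad_zero, h1, mul_zero, pow_zero, mul_one, smul_add, smul_smul,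
      show r * (r * q ^ (2 * (b + 1))) = (r * q ^ (b + 1)) ^ 2 by ring, hr]
    module
  rw [h2, qad_smul, h, smul_zero]

/-- Twisted commutators with `x` commute, so the last one can be performed first; it turns `f` into
a nonzero multiple of `x_1`. -/
lemma qad_swap_eq_zero {a' : ℕ} (hr : r * p ^ a' = 1) (h : qad p r x f (a' + 1) = 0) :
    qad p r x (qad q r f x 1) a' = 0 := by
  have h1 := qad_commutator p r x f (r * p ^ (2 * a')) a'
  rw [← qad_succ, h] at h1
  have hc : r * p ^ (2 * a') * r = 1 := by
    rw [show r * p ^ (2 * a') * r = (r * p ^ a') ^ 2 by ring, hr, one_pow]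
  have h2 : f * x - (r * p ^ (2 * a')) • (x * f) = (-(r * p ^ (2 * a'))) • qad q r f x 1 := by
    simp only [qad_succ, qad_zero, mul_zero, pow_zero, mul_one, smul_sub, smul_smul, neg_mul, hc]
    module
  rw [h2, qad_smul] at h1
  refine (smul_eq_zero.1 h1).resolve_left fun h3 => ?_
  rw [neg_eq_zero] at h3
  simp [h3] at hc

/-- The Serre relation between `x_a` and `e` from the Serre relation between `x` and `f`. -/
lemma serre_swap (hq : Generic q) (hp : Generic p) {a a' : ℕ}
    (ha : (a = 0 ∧ a' = 0) ∨ (a = 1 ∧ a' = 1) ∨ (a = 1 ∧ a' = 2) ∨ (a = 2 ∧ a' = 1) ∨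
      (a = 1 ∧ a' = 3) ∨ (a = 3 ∧ a' = 1))
    (hr : r * q ^ a = 1) (hr' : r * p ^ a' = 1)
    (hfe : f * e = q ^ 2 • (e * f) + (1 - q ^ 2) • 1) (hxe : x * e = r • (e * x))
    (h1 : qad q r f x (a + 1) = 0) (h2 : qad p r x f (a' + 1) = 0) :
    qad p r (qad q r f x a) e (a' + 1) = 0 := by
  have hq0 := hq.ne_zero
  have hp0 := hp.ne_zero
  have hr0 : r ≠ 0 := left_ne_zero_of_mul_eq_one hr
  have key : ∀ {u v : K}, r * u = 1 → r * v = 1 → u = v := fun h h' =>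
    mul_left_cancel₀ hr0 (h.trans h'.symm)
  have d0 := isDer_qad q r f x 0
  have d1 := isDer_qad q r f x 1
  have d2 := isDer_qad q r f x 2
  have d3 := isDer_qad q r f x 3
  have hs := qad_swap_eq_zero (q := q) hr' h2
  have nz : ∀ {u : K} {n : ℕ}, Generic u → 0 < n → 1 + u ^ n ≠ 0 := by
    intro u n hu hn h
    refine hu.pow_ne_one (n * 2) (by omega) ?_
    rw [pow_mul, show u ^ n = -1 by linear_combination h]
    norm_num
  rw [mul_zero, pow_zero, mul_one] at d0
  rcases ha with h | h | h | h | h | h <;> obtain ⟨rfl, rfl⟩ := h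
  · simp only [pow_zero, mul_one] at hr
    subst hr
    simp [qad_succ, hxe]
  · refine serre_swap_reduce hfe hxe hr ?_
    exact serre_swap_of_one_one hp0 (eq_inv_of_mul_eq_one_left hr') hs
  · have hqp : q ^ 1 = p ^ 2 := key hr hr'
    rw [pow_one] at hqp
    rw [h1] at d1
    refine serre_swap_reduce hfe hxe hr ?_
    refine serre_swap_of_one_two hp0 (eq_inv_of_mul_eq_one_left hr') d0 (d1.congr ?_) hs
    rw [hqp]; linear_combination p ^ 2 * hr'
  · have hqp : q ^ 2 = p ^ 1 := key hr hr'
    rw [pow_one] at hqp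
    subst hqp
    rw [h1] at d2
    refine serre_swap_reduce hfe hxe hr ?_
    refine serre_swap_of_two_one hq0 (eq_inv_of_mul_eq_one_left hr) d0 (d1.congr ?_)
      (d2.congr ?_) hs
    · linear_combination hr
    · linear_combination q ^ 2 * hr
  · have hqp : q ^ 1 = p ^ 3 := key hr hr'
    rw [pow_one] at hqp
    rw [h1] at d1
    refine serre_swap_reduce hfe hxe hr ?_
    refine serre_swap_of_one_three hp0 (nz hp (by norm_num)) (eq_inv_of_mul_eq_one_left hr') d0
      (d1.congr ?_) hs
    rw [hqp]; linear_combination p ^ 3 * hr'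
  · have hqp : q ^ 3 = p ^ 1 := key hr hr'
    rw [pow_one] at hqp
    subst hqp
    rw [h1] at d3
    refine serre_swap_reduce hfe hxe hr ?_
    refine serre_swap_of_three_one hq0 (nz hq (by norm_num)) (eq_inv_of_mul_eq_one_left hr) d0
      (d1.congr ?_) (d2.congr ?_) (d3.congr ?_) hs
    · rw [eq_inv_of_mul_eq_one_left hr]; field_simp
    · rw [eq_inv_of_mul_eq_one_left hr]; field_simp
    · linear_combination q ^ 3 * hr

end SerreSwap

end QuantumAdjoint
end

/-! ### Scalars, relations and braid images in `Â_q(𝔫)` -/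

noncomputable section

namespace SimpleCartanDatum

open QuantumAdjoint

variable {I : Type*} [Fintype I] [DecidableEq I] (D : SimpleCartanDatum I)

/-! ### Scalars -/

lemma qHalf_ne_zero (e : ℤ) : qHalf e ≠ 0 := zpow_ne_zero _ RatFunc.X_ne_zero

lemma qHalf_add (a b : ℤ) : qHalf (a + b) = qHalf a * qHalf b := zpow_add₀ RatFunc.X_ne_zero _ _

lemma qHalf_mul_nat (a : ℤ) (n : ℕ) : qHalf (a * n) = qHalf a ^ n := by
  rw [qHalf, zpow_mul, zpow_natCast, qHalf]

lemma qPow_ne_zero (e : ℤ) : qPow e ≠ 0 := qHalf_ne_zero _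

lemma qPow_add (a b : ℤ) : qPow (a + b) = qPow a * qPow b := by
  rw [qPow, mul_add, qHalf_add, qPow, qPow]

lemma qPow_pow (a : ℤ) (n : ℕ) : qPow a ^ n = qPow (a * n) := by
  rw [qPow, qPow, ← mul_assoc, qHalf_mul_nat]

@[simp] lemma qPow_zero : qPow 0 = 1 := by simp [qPow, qHalf]

lemma qPow_neg (a : ℤ) : qPow (-a) = (qPow a)⁻¹ := by
  rw [qPow, qPow, qHalf, qHalf, mul_neg, zpow_neg]

lemma qPow_eq_qHalf_sq (a : ℤ) : qPow a = qHalf a ^ 2 := by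
  rw [qPow, mul_comm, ← qHalf_mul_nat]; rfl

/-- `q_i = q^{d_i}`. -/
def qi (i : I) : QField := qPow (D.d i)

lemma qi_pow (i : I) (n : ℕ) : D.qi i ^ n = qPow (D.d i * n) := qPow_pow _ _

lemma generic_qi (i : I) : Generic (D.qi i) := by
  refine ⟨qPow_ne_zero _, fun n hn h => ?_⟩
  rw [qi_pow, qPow, qHalf] at h
  have h1 : (RatFunc.X : RatFunc ℚ) ^ (2 * (D.d i * n)) = 1 := by
    rw [← h, ← zpow_natCast]; congr 1
  rw [← RatFunc.algebraMap_X, ← map_pow, ← map_one (algebraMap (Polynomial ℚ) (RatFunc ℚ))] at h1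
  have h2 := congrArg Polynomial.natDegree (RatFunc.algebraMap_injective ℚ h1)
  have := Nat.mul_pos (D.d_pos i) hn
  simp at h2
  rcases h2 with h2 | h2
  · have := D.d_pos i; omega
  · omega

lemma qDiff_eq (i : I) : D.qDiff i = D.qi i - (D.qi i)⁻¹ := by rw [qDiff, qPow_neg, qi]

lemma qInt_eq (i : I) (n : ℕ) : D.qInt i n = qNum (D.qi i) n := by
  rw [qInt, qNum, qDiff_eq, qPow_neg, qi_pow]

lemma qFactorial_eq (i : I) (n : ℕ) : D.qFactorial i n = qFac (D.qi i) n := by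
  simp only [qFactorial, qFac, qInt_eq]

lemma yDiv_eq (i : I) (m : ℤ) (k : ℕ) : D.yDiv i m k = dpow (D.qi i) (D.y i m) k := by
  rw [yDiv, dpow, qFactorial_eq]

lemma form_comm (i j : I) : D.form i j = D.form j i := D.symm i j

lemma form_self (i : I) : D.form i i = 2 * D.d i := by rw [form, D.diag]; ring

variable {D} in
lemma negC_cast {i j : I} (hij : i ≠ j) : (D.negC i j : ℤ) = -D.C i j :=
  Int.toNat_of_nonneg (by have := D.off_diag i j hij; omega)

variable {D} in
lemma form_eq {i j : I} (hij : i ≠ j) : D.form i j = -(D.d i * D.negC i j) := by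
  rw [negC_cast hij, form]; ring

variable {D} in
lemma qPow_form_mul {i j : I} (hij : i ≠ j) : qPow (D.form i j) * D.qi i ^ D.negC i j = 1 := by
  rw [qi_pow, ← qPow_add, form_eq hij]; simp

variable {D} in
lemma qPow_form_eq {i j : I} (hij : i ≠ j) : qPow (D.form i j) = (D.qi i)⁻¹ ^ D.negC i j := by
  rw [inv_pow]; exact eq_inv_of_mul_eq_one_left (qPow_form_mul hij)

lemma qi_sq (i : I) : D.qi i ^ 2 = qPow (D.form i i) := by
  rw [qi_pow, form_self]; congr 1; push_cast; ring

variable {D} in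
lemma negC_cases {i j : I} (hij : i ≠ j) :
    (D.negC i j = 0 ∧ D.negC j i = 0) ∨ (D.negC i j = 1 ∧ D.negC j i = 1) ∨
    (D.negC i j = 1 ∧ D.negC j i = 2) ∨ (D.negC i j = 2 ∧ D.negC j i = 1) ∨
    (D.negC i j = 1 ∧ D.negC j i = 3) ∨ (D.negC i j = 3 ∧ D.negC j i = 1) := by
  have h1 := negC_cast (D := D) hij
  have h2 := negC_cast (D := D) hij.symm
  rcases D.cartan_cases hij with h | h | h | h | h | h <;> omega

/-- The normalizing scalar `(q_i - q_i⁻¹) q_i^{-1/2}`. -/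
def eta (i : I) : QField := D.qDiff i / qHalf (D.d i)

lemma eta_ne_zero (i : I) : D.eta i ≠ 0 := by
  rw [eta, qDiff_eq]
  exact div_ne_zero (D.generic_qi i).sub_inv_ne_zero (qHalf_ne_zero _)

lemma eta_sq (i : I) : D.eta i ^ 2 = (D.qi i - (D.qi i)⁻¹) ^ 2 / D.qi i := by
  rw [eta, div_pow, qDiff_eq, ← qPow_eq_qHalf_sq, qi]

/-- The scalar in front of the iterated commutator in `T_i(y_{j,m})`. -/
def braidScalar (i : I) (a : ℕ) : QField := (qFac (D.qi i) a * D.eta i ^ a)⁻¹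

lemma braidScalar_zero (i : I) : D.braidScalar i 0 = 1 := by simp [braidScalar]

/-- The normalization of `T_i` is chosen for this identity. The product is the scalar collected on
climbing the diagonal in `qad_mul_qad_self`, and also on lowering `a` times, so it serves both the
relation between adjacent levels and the inverse of `T_i`. Finite type only needs `a ≤ 3`. -/
lemma braidScalar_sq_mul_prod (i : I) {a : ℕ} (ha : a ≤ 3) {r : QField}
    (hr : r * D.qi i ^ a = 1) : D.braidScalar i a ^ 2 * ∏ t ∈ Finset.range a,
      (-(r * D.qi i ^ (2 * t)) * lowerCoeff (D.qi i) r t) = 1 := by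
  have hq := D.generic_qi i
  have h0 := hq.ne_zero
  have h1 := hq.sub_inv_ne_zero
  have e : (qFac (D.qi i) a * D.eta i ^ a) ^ 2 =
      (qFac (D.qi i) a * (D.qi i - (D.qi i)⁻¹) ^ a) ^ 2 / D.qi i ^ a := by
    rw [mul_pow, ← pow_mul, mul_comm a, pow_mul, eta_sq, div_pow, mul_pow, ← pow_mul, ← pow_mul,
      mul_comm 2 a, mul_div_assoc]
  have f1 : ∀ n, qNum (D.qi i) n = (D.qi i ^ n - (D.qi i ^ n)⁻¹) / (D.qi i - (D.qi i)⁻¹) :=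
    fun _ => rfl
  have h2 := hq.qFac_ne_zero a
  rw [braidScalar, inv_pow, e]
  rw [inv_mul_eq_one₀ (div_ne_zero (pow_ne_zero _ (mul_ne_zero h2 (pow_ne_zero _ h1)))
    (pow_ne_zero _ h0))]
  rw [eq_inv_of_mul_eq_one_left hr]
  have h3 : D.qi i ^ 2 - 1 ≠ 0 := sub_ne_zero.2 (hq.pow_ne_one 2 (by norm_num))
  clear e hr hq h2
  generalize D.qi i = q at *
  interval_cases a <;>
    simp only [qFac, f1, Finset.prod_range_succ, Finset.prod_range_zero, lowerCoeff]
  · simp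
  · field_simp
    ring
  · field_simp
    ring
  · field_simp
    ring

/-! ### The defining relations -/

lemma y_same (i : I) (k : ℤ) : D.y i k * D.y i (k + 1) =
    D.qi i ^ 2 • (D.y i (k + 1) * D.y i k) + (1 - D.qi i ^ 2) • 1 := by
  have := RingQuot.mkAlgHom_rel QField (Rel.boson_same (D := D) i k)
  rw [map_mul, map_add, map_smul, map_mul, AlgHom.commutes, Algebra.algebraMap_eq_smul_one] at this
  rw [qi_sq]
  exact this

lemma y_next {i j : I} (hij : i ≠ j) (k : ℤ) : D.y i k * D.y j (k + 1) =
    qPow (D.form i j) • (D.y j (k + 1) * D.y i k) := by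
  have := RingQuot.mkAlgHom_rel QField (Rel.boson_next (D := D) i j k hij)
  rw [map_mul, map_smul, map_mul] at this
  exact this

lemma y_far (i j : I) {k l : ℤ} (h : k + 1 < l) : D.y i k * D.y j l =
    qPow (((k + l + 1).negOnePow : ℤ) * D.form i j) • (D.y j l * D.y i k) := by
  have := RingQuot.mkAlgHom_rel QField (Rel.boson_far (D := D) i j k l h)
  rw [map_mul, map_smul, map_mul] at this
  exact this

section

variable {B : Type*} [Ring B] [Algebra QField B]

/-- The quantum Serre element in `u` and `v`. -/
def serreSum (i j : I) (u v : B) : B :=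
  ∑ s ∈ Finset.range (D.negC i j + 2), ((-1) ^ s * D.qBinom i (D.negC i j + 1) s) •
    (u ^ (D.negC i j + 1 - s) * v * u ^ s)

variable {D} in
lemma serreSum_eq {i j : I} (hij : i ≠ j) (u v : B) : D.serreSum i j u v =
    rqad (D.qi i) (qPow (D.form i j)) u v (D.negC i j + 1) := by
  have hq := D.generic_qi i
  have h := hq.rqad_eq_sum (qPow (D.form i j)) u v (D.negC i j + 1)
  rw [inv_smul_eq_iff₀ (hq.qFac_ne_zero _)] at h
  have hr := qPow_form_mul (D := D) hij
  have hr' : ∀ k, (qPow (D.form i j) * (D.qi i)⁻¹) ^ k *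
      D.qi i ^ (k * (D.negC i j + 1)) = 1 := by
    intro k
    have h0 := hq.ne_zero
    rw [mul_comm k, pow_mul, ← mul_pow, pow_succ, mul_right_comm, ← mul_assoc, hr,
      one_mul, mul_inv_cancel₀ h0, one_pow]
  rw [h, serreSum, Finset.smul_sum]
  refine Finset.sum_congr rfl fun k _ => ?_
  rw [mul_assoc _ _ (_ ^ (k * _)), hr', dpow, dpow, qBinom, qFactorial_eq, qFactorial_eq,
    qFactorial_eq, smul_mul_assoc, smul_mul_assoc, mul_smul_comm, smul_smul, smul_smul, smul_smul]
  congr 1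
  have := hq.qFac_ne_zero k
  have := hq.qFac_ne_zero (D.negC i j + 1 - k)
  field_simp

/-- An assignment of the generators that satisfies the defining relations. -/
structure IsSolution (φ : I → ℤ → B) : Prop where
  serre : ∀ i j k, i ≠ j → D.serreSum i j (φ i k) (φ j k) = 0
  same : ∀ i k, φ i k * φ i (k + 1) =
    D.qi i ^ 2 • (φ i (k + 1) * φ i k) + (1 - D.qi i ^ 2) • 1
  next : ∀ i j k, i ≠ j → φ i k * φ j (k + 1) = qPow (D.form i j) • (φ j (k + 1) * φ i k)
  far : ∀ i j k l, k + 1 < l → φ i k * φ j l =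
    qPow (((k + l + 1).negOnePow : ℤ) * D.form i j) • (φ j l * φ i k)

variable {D}

/-- The homomorphism defined by a solution of the defining relations. -/
def IsSolution.lift {φ : I → ℤ → B} (h : D.IsSolution φ) : D.AHat →ₐ[QField] B :=
  RingQuot.liftAlgHom QField ⟨FreeAlgebra.lift QField fun x : I × ℤ => φ x.1 x.2, by
    intro x y hxy
    cases hxy with
    | serre i j k hij =>
      rw [map_zero, ← h.serre i j k hij, map_sum, serreSum]
      simp only [gen, map_smul, map_mul, map_pow, FreeAlgebra.lift_ι_apply]
    | boson_same i k =>
      simp only [gen, map_add, map_smul, map_mul, FreeAlgebra.lift_ι_apply, AlgHom.commutes]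
      rw [h.same, qi_sq, Algebra.algebraMap_eq_smul_one]
    | boson_next i j k hij =>
      simp only [gen, map_smul, map_mul, FreeAlgebra.lift_ι_apply]
      exact h.next i j k hij
    | boson_far i j k l hkl =>
      simp only [gen, map_smul, map_mul, FreeAlgebra.lift_ι_apply]
      exact h.far i j k l hkl⟩

@[simp] lemma IsSolution.lift_y {φ : I → ℤ → B} (h : D.IsSolution φ) (i : I) (m : ℤ) :
    h.lift (D.y i m) = φ i m := by
  simp [lift, y, gen]

lemma algHom_ext {φ ψ : D.AHat →ₐ[QField] B} (h : ∀ i m, φ (D.y i m) = ψ (D.y i m)) : φ = ψ := by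
  apply RingQuot.ringQuot_ext'
  apply FreeAlgebra.hom_ext
  ext ⟨i, m⟩
  exact h i m

end

variable {D} in
lemma y_serreSum {i j : I} (hij : i ≠ j) (k : ℤ) : D.serreSum i j (D.y i k) (D.y j k) = 0 := by
  have := RingQuot.mkAlgHom_rel QField (Rel.serre (D := D) i j k hij)
  rw [map_zero, map_sum] at this
  rw [← this, serreSum]
  simp only [map_smul, map_mul, map_pow]
  rfl

variable {D} in
lemma y_rqad {i j : I} (hij : i ≠ j) (k : ℤ) :
    rqad (D.qi i) (qPow (D.form i j)) (D.y i k) (D.y j k) (D.negC i j + 1) = 0 := by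
  rw [← serreSum_eq hij, y_serreSum hij]

variable {D} in
lemma y_qad {i j : I} (hij : i ≠ j) (k : ℤ) :
    qad (D.qi i) (qPow (D.form i j)) (D.y i k) (D.y j k) (D.negC i j + 1) = 0 := by
  rw [(D.generic_qi i).qad_eq_zero_iff _ _ _ (qPow_form_mul hij), y_rqad hij]

/-! ### The braid images -/

lemma braidImage_self (i : I) (m : ℤ) : D.braidImage i i m = D.y i (m + 1) := by
  simp [braidImage, D.diag]

lemma braidInvImage_self (i : I) (m : ℤ) : D.braidInvImage i i m = D.y i (m - 1) := by
  simp [braidInvImage, D.diag]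

variable {D} in
lemma braidScalar_coeff {i j : I} (hij : i ≠ j) (k : ℕ) :
    (D.eta i ^ D.negC i j)⁻¹ * ((-1) ^ k * (qPow (D.form i j) * (D.qi i)⁻¹) ^ k *
      D.qi i ^ (k * D.negC i j)) = (D.qDiff i ^ D.negC i j)⁻¹ *
      ((-1) ^ k * qHalf ((D.d i : ℤ) * (D.negC i j - 2 * k))) := by
  have h1 : (qPow (D.form i j) * (D.qi i)⁻¹) ^ k * D.qi i ^ (k * D.negC i j) =
      qPow (-(D.d i * k)) := by
    rw [mul_comm k, pow_mul, ← mul_pow, mul_right_comm, qPow_form_mul hij, one_mul, qi, ← qPow_neg,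
      qPow_pow]
    congr 1; ring
  have h2 : qHalf ((D.d i : ℤ) * (D.negC i j - 2 * k)) =
      qHalf (D.d i) ^ D.negC i j * qPow (-(D.d i * k)) := by
    rw [← qHalf_mul_nat, qPow, ← qHalf_add]; congr 1; ring
  rw [mul_assoc ((-1) ^ k), h1, h2, eta, div_pow]
  have := pow_ne_zero (D.negC i j) (qHalf_ne_zero (D.d i))
  field_simp

variable {D} in
lemma braidImage_of_ne {i j : I} (hij : i ≠ j) (m : ℤ) : D.braidImage i j m =
    D.braidScalar i (D.negC i j) •
      qad (D.qi i) (qPow (D.form i j)) (D.y i m) (D.y j m) (D.negC i j) := by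
  unfold braidImage
  rw [if_neg hij]
  split_ifs with h
  · have : D.negC i j = 0 := by
      have := negC_cast (D := D) hij
      omega
    rw [this, braidScalar_zero, one_smul, qad_zero, add_zero]
  · rw [braidScalar, mul_inv, mul_comm, mul_smul, (D.generic_qi i).qad_eq_sum, Finset.smul_sum,
      Finset.smul_sum]
    refine Finset.sum_congr rfl fun k _ => ?_
    rw [yDiv_eq, yDiv_eq, smul_smul, smul_smul, braidScalar_coeff hij]

variable {D} in
lemma braidInvImage_of_ne {i j : I} (hij : i ≠ j) (m : ℤ) : D.braidInvImage i j m =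
    D.braidScalar i (D.negC i j) •
      rqad (D.qi i) (qPow (D.form i j)) (D.y i m) (D.y j m) (D.negC i j) := by
  unfold braidInvImage
  rw [if_neg hij]
  split_ifs with h
  · have : D.negC i j = 0 := by
      have := negC_cast (D := D) hij
      omega
    rw [this, braidScalar_zero, one_smul, rqad_zero, sub_zero]
  · rw [braidScalar, mul_inv, mul_comm, mul_smul, (D.generic_qi i).rqad_eq_sum, Finset.smul_sum,
      Finset.smul_sum]
    refine Finset.sum_congr rfl fun k _ => ?_
    rw [yDiv_eq, yDiv_eq, smul_smul, smul_smul, braidScalar_coeff hij]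

variable {D} in
lemma isTopPower_braidImage {i j : I} (hij : i ≠ j) (m : ℤ) :
    IsTopPower (D.qi i) (D.eta i) (D.y i m) (D.negC i j) (D.y j m) (D.braidImage i j m) := by
  rw [IsTopPower, ← qPow_form_eq hij, y_qad hij, braidImage_of_ne hij, smul_smul, braidScalar,
    mul_inv_cancel₀ (mul_ne_zero ((D.generic_qi i).qFac_ne_zero _)
      (pow_ne_zero _ (D.eta_ne_zero i))), one_smul]
  exact ⟨rfl, rfl⟩

end SimpleCartanDatum
end

/-! ### `T_i` as an endomorphism, and the reversal of levels -/

noncomputable section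

namespace SimpleCartanDatum

open QuantumAdjoint

variable {I : Type*} [Fintype I] [DecidableEq I] {D : SimpleCartanDatum I}

/-! ### The braid images satisfy the defining relations -/

lemma y_next_comm {i j : I} (hij : i ≠ j) (k : ℤ) : D.y j k * D.y i (k + 1) =
    qPow (D.form i j) • (D.y i (k + 1) * D.y j k) := by
  rw [D.y_next hij.symm, form_comm]

lemma smul_mul_smul_eq {K B : Type*} [Field K] [Ring B] [Algebra K B] {u v : B} {c c' κ : K}
    (h : u * v = κ • (v * u)) : (c • u) * (c' • v) = κ • ((c' • v) * (c • u)) := by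
  simp only [smul_mul_assoc, mul_smul_comm, h]
  module

lemma mul_smul_eq {K B : Type*} [Field K] [Ring B] [Algebra K B] {u v : B} {c κ : K}
    (h : u * v = κ • (v * u)) : u * (c • v) = κ • ((c • v) * u) := by
  simp only [smul_mul_assoc, mul_smul_comm, h]
  module

lemma smul_mul_eq {K B : Type*} [Field K] [Ring B] [Algebra K B] {u v : B} {c κ : K}
    (h : u * v = κ • (v * u)) : (c • u) * v = κ • (v * (c • u)) := by
  simp only [smul_mul_assoc, mul_smul_comm, h]
  module

lemma smul_mul_smul_eq_add {K B : Type*} [Field K] [Ring B] [Algebra K B] {u v : B}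
    {c κ P δ : K} (h : u * v = κ • (v * u) + (P * δ) • 1) (hc : c ^ 2 * P = 1) :
    (c • u) * (c • v) = κ • ((c • v) * (c • u)) + δ • 1 := by
  have h3 : c * (c * (P * δ)) = δ := by linear_combination δ * hc
  simp only [smul_mul_assoc, mul_smul_comm, h, smul_add, smul_smul, h3]
  module

lemma qPow_form_sq_mul {i j : I} (hij : i ≠ j) :
    qPow (D.form i j) * D.qi i ^ (2 * D.negC i j) = qPow (-D.form i j) := by
  rw [qi_pow, ← qPow_add, form_eq hij]; congr 1; push_cast; ring

/-- `T_i` replaces `f` by `e`, so the Serre element becomes `a + 1` lowerings of the top of a chain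
with `a` steps. -/
lemma braidImage_serre_left {i j : I} (hij : i ≠ j) (m : ℤ) :
    D.serreSum i j (D.braidImage i i m) (D.braidImage i j m) = 0 := by
  rw [serreSum_eq hij, braidImage_self, braidImage_of_ne hij, rqad_smul,
    rqad_qad_succ (D.y_same i m) (y_next_comm hij m) (qPow_form_mul hij), smul_zero]

lemma braidImage_serre_right {i j : I} (hij : i ≠ j) (m : ℤ) :
    D.serreSum j i (D.braidImage i j m) (D.braidImage i i m) = 0 := by
  have hr := qPow_form_mul (D := D) hij.symm
  rw [serreSum_eq hij.symm, ← (D.generic_qi j).qad_eq_zero_iff _ _ _ hr, braidImage_self,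
    braidImage_of_ne hij, qad_smul_left, D.form_comm j i]
  rw [D.form_comm j i] at hr
  have h2 := y_qad (D := D) hij.symm m
  rw [D.form_comm j i] at h2
  rw [serre_swap (D.generic_qi i) (D.generic_qi j) (negC_cases hij) (qPow_form_mul hij) hr
    (D.y_same i m) (y_next_comm hij m) (y_qad hij m) h2, smul_zero]

/-- The Serre element is homogeneous, so by multiplicativity its value on the images is the top
power of its value on the generators, which is zero. -/
lemma braidImage_serre {i j k : I} (hij : i ≠ j) (hik : i ≠ k) (hjk : j ≠ k) (m : ℤ) :
    D.serreSum j k (D.braidImage i j m) (D.braidImage i k m) = 0 := by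
  have hq := D.generic_qi i
  have h : IsTopPower (D.qi i) (D.eta i) (D.y i m)
      ((D.negC j k + 1) * D.negC i j + D.negC i k)
      (D.serreSum j k (D.y j m) (D.y k m))
      (D.serreSum j k (D.braidImage i j m) (D.braidImage i k m)) := by
    refine IsTopPower.sum _ fun s hs => IsTopPower.smul ?_ _
    have hs := Finset.mem_range.1 hs
    have h1 := isTopPower_braidImage (D := D) hij m
    have h2 := isTopPower_braidImage (D := D) hik m
    have := ((h1.pow hq (D.negC j k + 1 - s)).mul hq h2).mul hq (h1.pow hq s)
    convert this using 1
    obtain ⟨t, ht⟩ := Nat.exists_eq_add_of_le (show s ≤ D.negC j k + 1 by omega)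
    rw [ht, Nat.add_sub_cancel_left]
    ring
  rw [y_serreSum hjk] at h
  exact h.unique hq (D.eta_ne_zero i) isTopPower_zero

lemma braidImage_same {i j : I} (hij : i ≠ j) (m : ℤ) :
    D.braidImage i j m * D.braidImage i j (m + 1) =
      D.qi j ^ 2 • (D.braidImage i j (m + 1) * D.braidImage i j m) + (1 - D.qi j ^ 2) • 1 := by
  have h := qad_mul_qad_self (D.y_same i m) (y_next_comm hij m) (D.y_same j m) (D.y_next hij m)
    (D.negC i j)
  have hr := qPow_form_mul (D := D) hij
  have h1 : D.qi j ^ 2 * qPow (D.form i j) ^ D.negC i j * qPow (D.form i j) ^ D.negC i j *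
      D.qi i ^ (2 * D.negC i j * D.negC i j) = D.qi j ^ 2 := by
    have : qPow (D.form i j) ^ D.negC i j * qPow (D.form i j) ^ D.negC i j *
      D.qi i ^ (2 * D.negC i j * D.negC i j) =
        ((qPow (D.form i j) * D.qi i ^ D.negC i j) ^ D.negC i j) ^ 2 := by ring
    rw [hr, one_pow, one_pow] at this
    linear_combination D.qi j ^ 2 * this
  have h2 := D.braidScalar_sq_mul_prod i (a := D.negC i j) (by
    have := negC_cases (D := D) hij; omega) hr
  rw [h1] at h
  rw [braidImage_of_ne hij, braidImage_of_ne hij]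
  exact smul_mul_smul_eq_add h h2

/-- This is the Serre relation of level `m + 1`: the image of `y_{i,m}` is the element with which
the chain of `y_{j,m+1}` is built. -/
lemma braidImage_next_left {i j : I} (hij : i ≠ j) (m : ℤ) :
    D.braidImage i i m * D.braidImage i j (m + 1) =
      qPow (D.form i j) • (D.braidImage i j (m + 1) * D.braidImage i i m) := by
  rw [braidImage_self, braidImage_of_ne hij]
  refine mul_smul_eq (u := D.y i (m + 1)) ?_
  have h := y_qad (D := D) hij (m + 1)
  rw [qad_succ, sub_eq_zero] at h
  rw [h, smul_smul, qPow_form_sq_mul hij, ← qPow_add, add_neg_cancel, qPow_zero, one_smul]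

lemma braidImage_next_right {i j : I} (hij : i ≠ j) (m : ℤ) :
    D.braidImage i j m * D.braidImage i i (m + 1) =
      qPow (D.form j i) • (D.braidImage i i (m + 1) * D.braidImage i j m) := by
  rw [braidImage_self, braidImage_of_ne hij]
  refine smul_mul_eq (v := D.y i (m + 1 + 1)) ?_
  have h1 := D.y_far j i (show m + 1 < m + 1 + 1 by omega)
  have h2 := D.y_far i i (show m + 1 < m + 1 + 1 by omega)
  rw [qad_mul_of_comm h1 h2, qPow_pow, ← qPow_add]
  congr 2
  have : (m + (m + 1 + 1) + 1).negOnePow = -1 := Int.negOnePow_odd _ ⟨m + 1, by ring⟩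
  rw [this, D.form_comm j i, form_self, form_eq hij]
  push_cast
  ring

lemma braidImage_next {i j k : I} (hij : i ≠ j) (hik : i ≠ k) (hjk : j ≠ k) (m : ℤ) :
    D.braidImage i j m * D.braidImage i k (m + 1) =
      qPow (D.form j k) • (D.braidImage i k (m + 1) * D.braidImage i j m) := by
  rw [braidImage_of_ne hij, braidImage_of_ne hik]
  refine smul_mul_smul_eq (K := QField) (B := D.AHat) ?_
  rw [qad_mul_qad (D.y_same i m) (y_next_comm hij m) (D.y_next hjk m) (D.y_next hik m), qi_pow,
    qPow_pow, qPow_pow, ← qPow_add, ← qPow_add, ← qPow_add]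
  congr 2
  rw [form_eq hij, form_eq hik]
  push_cast
  ring

lemma braidImage_far_left {i j : I} (hij : i ≠ j) {k l : ℤ} (h : k + 1 < l) :
    D.braidImage i i k * D.braidImage i j l =
      qPow (((k + l + 1).negOnePow : ℤ) * D.form i j) •
        (D.braidImage i j l * D.braidImage i i k) := by
  rw [braidImage_self, braidImage_of_ne hij]
  refine mul_smul_eq (u := D.y i (k + 1)) ?_
  -- Since `T_i` raises the level of `y_i`, the case `l = k + 2` now concerns adjacent levels.
  rcases eq_or_lt_of_le (show k + 1 + 1 ≤ l by omega) with rfl | h'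
  · rw [prev_mul_qad (D.y_same i (k + 1)) (D.y_next hij (k + 1)), qPow_form_sq_mul hij]
    have : (k + (k + 1 + 1) + 1).negOnePow = -1 := Int.negOnePow_odd _ ⟨k + 1, by ring⟩
    rw [this]
    simp
  · rw [mul_qad_of_comm (D.y_far i j h') (D.y_far i i h'), qPow_pow, ← qPow_add]
    congr 2
    have : (k + 1 + l + 1).negOnePow = -(k + l + 1).negOnePow := by
      rw [show k + 1 + l + 1 = k + l + 1 + 1 by ring, Int.negOnePow_succ]
    rw [this, form_self, form_eq hij]
    push_cast
    ring

lemma braidImage_far_right {i j : I} (hij : i ≠ j) {k l : ℤ} (h : k + 1 < l) :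
    D.braidImage i j k * D.braidImage i i l =
      qPow (((k + l + 1).negOnePow : ℤ) * D.form j i) •
        (D.braidImage i i l * D.braidImage i j k) := by
  rw [braidImage_self, braidImage_of_ne hij]
  refine smul_mul_eq (v := D.y i (l + 1)) ?_
  have h' : k + 1 < l + 1 := by omega
  rw [qad_mul_of_comm (D.y_far j i h') (D.y_far i i h'), qPow_pow, ← qPow_add]
  congr 2
  have : (k + (l + 1) + 1).negOnePow = -(k + l + 1).negOnePow := by
    rw [show k + (l + 1) + 1 = k + l + 1 + 1 by ring, Int.negOnePow_succ]
  rw [this, form_self, form_comm D j i, form_eq hij]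
  push_cast
  ring

lemma braidImage_far {i j j' : I} (hij : i ≠ j) (hij' : i ≠ j') {k l : ℤ} (h : k + 1 < l) :
    D.braidImage i j k * D.braidImage i j' l =
      qPow (((k + l + 1).negOnePow : ℤ) * D.form j j') •
        (D.braidImage i j' l * D.braidImage i j k) := by
  rw [braidImage_of_ne hij, braidImage_of_ne hij']
  refine smul_mul_smul_eq (K := QField) (B := D.AHat) ?_
  have h1 := qad_mul_of_comm (q := D.qi i) (r := qPow (D.form i j))
    (D.y_far j j' h) (D.y_far i j' h) (D.negC i j)
  have h2 := qad_mul_of_comm (q := D.qi i) (r := qPow (D.form i j))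
    (D.y_far j i h) (D.y_far i i h) (D.negC i j)
  rw [mul_qad_of_comm h1 h2]
  simp only [qPow_pow, ← qPow_add]
  congr 2
  rw [form_self, form_comm D j i, form_eq hij, form_eq hij']
  push_cast
  ring

variable (D) in
lemma isSolution_braidImage (i : I) : D.IsSolution (D.braidImage i) where
  serre j k m hjk := by
    by_cases hj : i = j
    · subst hj; exact braidImage_serre_left hjk m
    by_cases hk : i = k
    · subst hk; exact braidImage_serre_right hj m
    exact braidImage_serre hj hk hjk m
  same j m := by
    by_cases hj : i = j
    · subst hj; rw [braidImage_self, braidImage_self]; exact D.y_same i (m + 1)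
    exact braidImage_same hj m
  next j k m hjk := by
    by_cases hj : i = j
    · subst hj; exact braidImage_next_left hjk m
    by_cases hk : i = k
    · subst hk; exact braidImage_next_right hj m
    exact braidImage_next hj hk hjk m
  far j k m l h := by
    by_cases hj : i = j
    · subst hj
      by_cases hk : i = k
      · subst hk
        rw [braidImage_self, braidImage_self, D.y_far i i (show m + 1 + 1 < l + 1 by omega)]
        rw [show m + 1 + (l + 1) + 1 = m + l + 1 + 1 + 1 by ring, Int.negOnePow_succ,
          Int.negOnePow_succ, neg_neg]
      · exact braidImage_far_left hk h
    by_cases hk : i = k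
    · subst hk; exact braidImage_far_right hj h
    exact braidImage_far hj hk h

variable (D) in
/-- The endomorphism `T_i`. -/
def braidHom (i : I) : D.AHat →ₐ[QField] D.AHat := (D.isSolution_braidImage i).lift

@[simp] lemma braidHom_y (i j : I) (m : ℤ) :
    D.braidHom i (D.y j m) = D.braidImage i j m := IsSolution.lift_y _ _ _

/-! ### The anti-automorphism reversing the levels -/

/-- Reversing products exchanges `qad` and `rqad`, whose Serre relations are equivalent. -/
lemma op_serreSum {B : Type*} [Ring B] [Algebra QField B] {i j : I} (hij : i ≠ j) (u v : B) :
    D.serreSum i j (MulOpposite.op u) (MulOpposite.op v) = 0 ↔ D.serreSum i j u v = 0 := by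
  rw [serreSum_eq hij, serreSum_eq hij, ← op_qad, MulOpposite.op_eq_zero_iff,
    (D.generic_qi i).qad_eq_zero_iff _ _ _ (qPow_form_mul hij)]

variable (D) in
lemma isSolution_op : D.IsSolution fun i m => MulOpposite.op (D.y i (-m)) where
  serre i j k hij := by
    rw [op_serreSum hij]; exact y_serreSum hij _
  same i k := by
    have := congrArg MulOpposite.op (D.y_same i (-(k + 1)))
    rw [show -(k + 1) + 1 = -k by ring] at this
    simpa using this
  next i j k hij := by
    have := congrArg MulOpposite.op (y_next_comm (D := D) hij (-(k + 1)))
    rw [show -(k + 1) + 1 = -k by ring] at this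
    simpa using this
  far i j k l h := by
    have := congrArg MulOpposite.op (D.y_far j i (show -l + 1 < -k by omega))
    have h2 : (-l + -k + 1).negOnePow = (k + l + 1).negOnePow := by
      rw [Int.negOnePow_succ, Int.negOnePow_succ, ← neg_add, Int.negOnePow_neg, add_comm]
    rw [h2, form_comm] at this
    simpa using this

variable (D) in
/-- The anti-automorphism `y_{i,m} ↦ y_{i,-m}`. -/
def star : D.AHat →ₐ[QField] D.AHatᵐᵒᵖ := D.isSolution_op.lift

@[simp] lemma star_y (i : I) (m : ℤ) : D.star (D.y i m) = MulOpposite.op (D.y i (-m)) :=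
  IsSolution.lift_y _ _ _

lemma star_star_comp : (AlgHom.opComm D.star).comp D.star = AlgHom.id QField D.AHat := by
  apply algHom_ext
  intro i m
  simp

end SimpleCartanDatum
end

/-! ### Inverses of the `T_i`, and rank two computations -/

noncomputable section

namespace SimpleCartanDatum

open QuantumAdjoint

variable {I : Type*} [Fintype I] [DecidableEq I] {D : SimpleCartanDatum I}

/-! ### The automorphisms `T_i` -/

/-- The anti-automorphism `star` as a self-map of the algebra. -/
def rev (x : D.AHat) : D.AHat := (D.star x).unop

@[simp] lemma rev_y (i : I) (m : ℤ) : rev (D.y i m) = D.y i (-m) := by simp [rev]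

@[simp] lemma rev_rev (x : D.AHat) : rev (rev x) = x := by
  have := DFunLike.congr_fun (star_star_comp (D := D)) x
  simpa [rev] using this

lemma rev_smul (c : QField) (x : D.AHat) : rev (c • x) = c • rev x := by simp [rev]

lemma rev_mul (x y : D.AHat) : rev (x * y) = rev y * rev x := by simp [rev]

lemma rev_sub (x y : D.AHat) : rev (x - y) = rev x - rev y := by simp [rev]

lemma rev_qad (q r : QField) (f x : D.AHat) (s : ℕ) :
    rev (qad q r f x s) = rqad q r (rev f) (rev x) s := by
  rw [rev, map_qad, ← MulOpposite.op_unop (D.star f), ← MulOpposite.op_unop (D.star x), ← op_rqad]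
  rfl

lemma rev_rqad (q r : QField) (f x : D.AHat) (s : ℕ) :
    rev (rqad q r f x s) = qad q r (rev f) (rev x) s := by
  rw [← rev_rev (qad q r (rev f) (rev x) s), rev_qad, rev_rev, rev_rev]

variable (D) in
/-- The endomorphism `T_i⁻¹`. -/
def braidInvHom (i : I) : D.AHat →ₐ[QField] D.AHat :=
  (AlgHom.opComm D.star).comp ((AlgHom.op (D.braidHom i)).comp D.star)

lemma braidInvHom_apply (i : I) (x : D.AHat) :
    D.braidInvHom i x = rev (D.braidHom i (rev x)) := rfl

/-- On `y_j` the mirrored image is a chain of mirror commutators with `f`. `T_i` turns these into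
lowerings of the top vector, and `a` of them return to `y_j`; the scalar is one by the
normalization. -/
lemma braidHom_comp_braidInvHom (i : I) :
    (D.braidHom i).comp (D.braidInvHom i) = AlgHom.id QField D.AHat := by
  apply algHom_ext
  intro j m
  rw [AlgHom.comp_apply, braidInvHom_apply, rev_y, braidHom_y, AlgHom.id_apply]
  by_cases hij : i = j
  · subst hij
    rw [braidImage_self, rev_y, braidHom_y, braidImage_self]
    congr 1; ring
  · have hr := qPow_form_mul (D := D) hij
    have h2 := D.braidScalar_sq_mul_prod i (a := D.negC i j) (by
      have := negC_cases (D := D) hij; omega) hr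
    -- Lowering meets the coefficients in reverse order, which does not affect their product.
    have h3 : ∏ u ∈ Finset.range (D.negC i j), (-(qPow (D.form i j) * D.qi i ^ (2 * u)) *
        lowerCoeff (D.qi i) (qPow (D.form i j)) (D.negC i j - 1 - u)) =
        ∏ t ∈ Finset.range (D.negC i j), (-(qPow (D.form i j) * D.qi i ^ (2 * t)) *
          lowerCoeff (D.qi i) (qPow (D.form i j)) t) := by
      rw [Finset.prod_mul_distrib, Finset.prod_mul_distrib, Finset.prod_range_reflect
        (fun u => lowerCoeff (D.qi i) (qPow (D.form i j)) u)]
    rw [braidImage_of_ne hij, rev_smul, rev_qad, rev_y, rev_y, neg_neg, map_smul, map_rqad,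
      braidHom_y, braidHom_y, braidImage_self, braidImage_of_ne hij, rqad_smul,
      rqad_qad (D.y_same i m) (y_next_comm hij m) hr _ 0 (by simp), h3, smul_smul, smul_smul,
      qad_zero, ← sq, h2, one_smul]

lemma braidInvHom_comp_braidHom (i : I) :
    (D.braidInvHom i).comp (D.braidHom i) = AlgHom.id QField D.AHat := by
  refine AlgHom.ext fun x => ?_
  have h := DFunLike.congr_fun (braidHom_comp_braidInvHom (D := D) i) (rev x)
  simp only [AlgHom.comp_apply, braidInvHom_apply, rev_rev, AlgHom.id_apply] at h ⊢
  rw [h, rev_rev]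

variable (D) in
/-- The automorphism `T_i`. -/
def braidEquiv (i : I) : D.AHat ≃ₐ[QField] D.AHat :=
  AlgEquiv.ofAlgHom (D.braidHom i) (D.braidInvHom i) (braidHom_comp_braidInvHom i)
    (braidInvHom_comp_braidHom i)

@[simp] lemma braidEquiv_y (i j : I) (m : ℤ) :
    D.braidEquiv i (D.y j m) = D.braidImage i j m := braidHom_y i j m

lemma braidEquiv_symm_apply (i : I) (x : D.AHat) :
    (D.braidEquiv i).symm x = rev (D.braidEquiv i (rev x)) := rfl

lemma braidEquiv_symm_y (i j : I) (m : ℤ) :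
    (D.braidEquiv i).symm (D.y j m) = D.braidInvImage i j m := by
  rw [braidEquiv_symm_apply, rev_y, braidEquiv_y]
  by_cases hij : i = j
  · subst hij
    rw [braidImage_self, braidInvImage_self, rev_y]
    congr 1; ring
  · rw [braidImage_of_ne hij, braidInvImage_of_ne hij, rev_smul, rev_qad, rev_y, rev_y, neg_neg]

variable (D) in
lemma isBraidFamily_braidEquiv : D.IsBraidFamily D.braidEquiv := fun i j m =>
  ⟨braidEquiv_y i j m, braidEquiv_symm_y i j m⟩

lemma map_qad' (T : D.AHat ≃ₐ[QField] D.AHat) (q r : QField) (f x : D.AHat) (s : ℕ) :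
    T (qad q r f x s) = qad q r (T f) (T x) s := map_qad q r f x T.toAlgHom s

lemma map_rqad' (T : D.AHat ≃ₐ[QField] D.AHat) (q r : QField) (f x : D.AHat) (s : ℕ) :
    T (rqad q r f x s) = rqad q r (T f) (T x) s := map_rqad q r f x T.toAlgHom s

lemma braidEquiv_y_self (i : I) (m : ℤ) : D.braidEquiv i (D.y i m) = D.y i (m + 1) := by
  rw [braidEquiv_y, braidImage_self]

lemma braidEquiv_y_of_ne {i j : I} (hij : i ≠ j) (m : ℤ) :
    D.braidEquiv i (D.y j m) = D.braidScalar i (D.negC i j) •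
      qad (D.qi i) (qPow (D.form i j)) (D.y i m) (D.y j m) (D.negC i j) := by
  rw [braidEquiv_y, braidImage_of_ne hij]

lemma braidEquiv_symm_y_of_ne {i j : I} (hij : i ≠ j) (m : ℤ) :
    (D.braidEquiv i).symm (D.y j m) = D.braidScalar i (D.negC i j) •
      rqad (D.qi i) (qPow (D.form i j)) (D.y i m) (D.y j m) (D.negC i j) := by
  rw [braidEquiv_symm_y, braidInvImage_of_ne hij]

lemma braidEquiv_y_of_C_eq_zero {i j : I} (hij : i ≠ j) (h : D.C i j = 0) (m : ℤ) :
    D.braidEquiv i (D.y j m) = D.y j m := by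
  have : D.negC i j = 0 := by simp [negC, h]
  rw [braidEquiv_y_of_ne hij, this, braidScalar_zero, one_smul, qad_zero]

/-! ### Rank two -/

section RankTwo

variable {i j : I}

/-- The scalar produced by `T_i T_j (y_i)` if `c_{j,i} = -1`. -/
def rankTwoScalar (D : SimpleCartanDatum I) (i j : I) : QField :=
  D.braidScalar j 1 * (D.braidScalar i (D.negC i j) *
    (-qPow (D.form i j) * lowerCoeff (D.qi i) (qPow (D.form i j)) (D.negC i j - 1)))

lemma qad_one_qad {K B : Type*} [Field K] [Ring B] [Algebra K B] {p q r : K} {e f x : B}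
    (hfe : f * e = q ^ 2 • (e * f) + (1 - q ^ 2) • 1)
    (hxe : x * e = r • (e * x)) {b : ℕ} (hr : r * q ^ (b + 1) = 1) :
    qad p r (qad q r f x (b + 1)) e 1 = (-r * lowerCoeff q r b) • qad q r f x b := by
  rw [qad_succ, qad_zero, qad_mul_next hfe hxe b, mul_zero, pow_zero, mul_one, smul_add, smul_smul,
    show r * (r * q ^ (2 * (b + 1))) = (r * q ^ (b + 1)) ^ 2 by ring, hr]
  module

/-- As `c_{j,i} = -1`, `T_j(y_i)` is a single commutator of `y_i` with `y_j`. Applying `T_i` makes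
it a commutator of `y_{i,m+1}` with the top of a chain, that is, one lowering. -/
lemma braidEquiv_braidEquiv_y (hij : i ≠ j) (hji : D.negC j i = 1) (m : ℤ) :
    D.braidEquiv i (D.braidEquiv j (D.y i m)) = D.rankTwoScalar i j •
      qad (D.qi i) (qPow (D.form i j)) (D.y i m) (D.y j m) (D.negC i j - 1) := by
  obtain ⟨b, hb⟩ : ∃ b, D.negC i j = b + 1 := by
    have := negC_cases (D := D) hij
    exact ⟨D.negC i j - 1, by omega⟩
  have hr := qPow_form_mul (D := D) hij
  rw [hb] at hr
  rw [braidEquiv_y_of_ne hij.symm, map_smul, map_qad', braidEquiv_y_self, braidEquiv_y_of_ne hij,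
    qad_smul_left, hji, D.form_comm j i, rankTwoScalar, hb, Nat.add_sub_cancel,
    qad_one_qad (D.y_same i m) (y_next_comm hij m) hr, smul_smul, smul_smul, pow_one, mul_assoc]

/-- `T_j` maps the second commutator with `y_i` to its mirror image if `c_{j,i} = -1`. -/
lemma braidEquiv_qad_two (hij : i ≠ j) (hji : D.negC j i = 1) (m : ℤ) :
    D.braidEquiv j (qad (D.qi i) (qPow (D.form i j)) (D.y i m) (D.y j m) 2) =
      rqad (D.qi i) (qPow (D.form i j)) (D.y i m) (D.y j m) 2 := by
  have hr := qPow_form_mul (D := D) hij.symm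
  rw [D.form_comm j i, hji] at hr
  have h2 := D.braidScalar_sq_mul_prod j (a := 1) (by norm_num) hr
  simp only [Finset.prod_range_one, mul_zero, pow_zero, mul_one] at h2
  have hn := y_next_comm (D := D) hij.symm m
  rw [D.form_comm j i] at hn
  rw [map_qad', braidEquiv_y_self, braidEquiv_y_of_ne hij.symm, qad_smul_left, hji,
    D.form_comm j i, show (2 : ℕ) = 1 + 1 from rfl, qad_shift,
    qad_one_qad (b := 0) (D.y_same j m) hn hr, qad_smul, smul_smul, show 1 + 1 = 2 from rfl, h2, one_smul]
  simp only [qad_succ, rqad_succ, qad_zero, rqad_zero, mul_zero, pow_zero, mul_one]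

lemma d_eq_of_negC_eq_one (hij : i ≠ j) (h : D.negC i j = 1) (hji : D.negC j i = 1) :
    D.d i = D.d j := by
  have := D.form_comm i j
  rw [form_eq hij, form_eq hij.symm, h, hji] at this
  push_cast at this
  omega

lemma rankTwoScalar_of_one (hij : i ≠ j) (h : D.negC i j = 1) (hji : D.negC j i = 1) :
    D.rankTwoScalar i j = 1 := by
  have hr := qPow_form_mul (D := D) hij
  have h2 := D.braidScalar_sq_mul_prod i (a := D.negC i j) (by omega) hr
  have hd := d_eq_of_negC_eq_one hij h hji
  have hs : D.braidScalar j 1 = D.braidScalar i 1 := by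
    simp only [braidScalar, eta, qDiff, qi, hd]
  rw [h] at h2
  simp only [Finset.prod_range_one, mul_zero, pow_zero, mul_one] at h2
  rw [rankTwoScalar, h, hs]
  linear_combination h2

lemma braid_y_of_one (hij : i ≠ j) (h : D.negC i j = 1) (hji : D.negC j i = 1) (m : ℤ) :
    D.braidEquiv i (D.braidEquiv j (D.y i m)) = D.y j m := by
  rw [braidEquiv_braidEquiv_y hij hji, rankTwoScalar_of_one hij h hji, h, Nat.sub_self, qad_zero,
    one_smul]

lemma braidScalar_two_mul (i : I) {r : QField} (hr : r * D.qi i ^ 2 = 1) :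
    D.braidScalar i 2 * (-r * lowerCoeff (D.qi i) r 1) = 1 := by
  have hq := D.generic_qi i
  have h0 := hq.ne_zero
  have h1 := hq.sub_inv_ne_zero
  have h3 : D.qi i ^ 2 - 1 ≠ 0 := sub_ne_zero.2 (hq.pow_ne_one 2 (by norm_num))
  have h2 := hq.qFac_ne_zero 2
  have hη := D.eta_sq i
  have hη0 := D.eta_ne_zero i
  rw [braidScalar, inv_mul_eq_one₀ (mul_ne_zero h2 (pow_ne_zero _ hη0)), hη,
    eq_inv_of_mul_eq_one_left hr]
  clear hr hq h2 hη
  generalize D.qi i = q at *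
  simp only [qFac, qNum, Finset.prod_range_succ, Finset.prod_range_zero, lowerCoeff]
  field_simp
  ring

lemma braid_y_of_two_left (hij : i ≠ j) (h : D.negC i j = 2) (hji : D.negC j i = 1) (m : ℤ) :
    D.braidEquiv j (D.braidEquiv i (D.braidEquiv j (D.y i m))) = D.y i m := by
  have hr := qPow_form_mul (D := D) hij
  rw [h] at hr
  -- One commutator of `y_j` with `y_i` is also the mirror commutator of `y_i` with `y_j`, so `T_i
  -- T_j(y_i)` and `T_j⁻¹(y_i)` agree once the scalars do.
  rw [← AlgEquiv.eq_symm_apply, braidEquiv_braidEquiv_y hij hji, braidEquiv_symm_y_of_ne hij.symm,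
    rankTwoScalar, h, hji, D.form_comm j i, braidScalar_two_mul i hr, mul_one]
  simp [qad_succ, rqad_succ]

lemma braid_y_of_two_right (hij : i ≠ j) (h : D.negC i j = 2) (hji : D.negC j i = 1) (m : ℤ) :
    D.braidEquiv i (D.braidEquiv j (D.braidEquiv i (D.y j m))) = D.y j m := by
  rw [← AlgEquiv.eq_symm_apply, braidEquiv_symm_y_of_ne hij, braidEquiv_y_of_ne hij, h, map_smul,
    braidEquiv_qad_two hij hji]

/-- Cut the word of length five and compare `T_j T_i T_j(y_i)` with `T_i⁻¹ T_j⁻¹(y_i)`. The latter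
is the reversal of `T_i T_j(y_i)`, and `braidEquiv_qad_two` identifies it with the former. -/
lemma braid_y_of_three_left (hij : i ≠ j) (h : D.negC i j = 3) (hji : D.negC j i = 1) (m : ℤ) :
    D.braidEquiv j (D.braidEquiv i (D.braidEquiv j (D.braidEquiv i (D.braidEquiv j (D.y i m))))) =
      D.y i m := by
  have e : (D.braidEquiv i).symm ((D.braidEquiv j).symm (D.y i m)) =
      D.braidEquiv j (D.braidEquiv i (D.braidEquiv j (D.y i m))) := by
    rw [braidEquiv_braidEquiv_y hij hji, h, map_smul, braidEquiv_qad_two hij hji,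
      braidEquiv_symm_apply, braidEquiv_symm_apply, rev_rev, rev_y, braidEquiv_braidEquiv_y hij hji,
      h, rev_smul, rev_qad, rev_y, rev_y, neg_neg]
  rw [← e, AlgEquiv.apply_symm_apply, AlgEquiv.apply_symm_apply]

lemma braidScalar_three_mul (i : I) {r : QField} (hr : r * D.qi i ^ 3 = 1) :
    D.braidScalar i 3 ^ 2 * (-r * lowerCoeff (D.qi i) r 2) *
      ((-r * lowerCoeff (D.qi i) r 2) * (-(r * D.qi i ^ 2) * lowerCoeff (D.qi i) r 1)) = 1 := by
  have h2 := D.braidScalar_sq_mul_prod i (a := 3) le_rfl hr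
  have h3 : lowerCoeff (D.qi i) r 2 = D.qi i ^ 4 * lowerCoeff (D.qi i) r 0 := by
    have h0 := (D.generic_qi i).ne_zero
    rw [eq_inv_of_mul_eq_one_left hr, lowerCoeff, lowerCoeff]
    field_simp
    ring
  rw [← h2]
  simp only [Finset.prod_range_succ, Finset.prod_range_zero]
  rw [show D.qi i ^ (2 * 2) = D.qi i ^ 4 by norm_num]
  linear_combination (D.braidScalar i 3 ^ 2 * r * lowerCoeff (D.qi i) r 2 * r * D.qi i ^ 2 *
    lowerCoeff (D.qi i) r 1 * (-r)) * h3

lemma smul_mul_sub_smul_mul {K B : Type*} [Field K] [Ring B] [Algebra K B] (a b ρ : K) (x z : B) :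
    a • (x * (b • z) - ρ • (b • z * x)) = (a * b) • (x * z - ρ • (z * x)) := by
  simp only [mul_smul_comm, smul_mul_assoc]
  module

lemma smul_commutator_eq {K B : Type*} [Field K] [Ring B] [Algebra K B] {a b κ : K} {c ρ : K}
    {x z w : B} (hz : c • z = κ • w) (h : a * b * κ = a * c) :
    (a * c) • (b • x * z - ρ • (z * (b • x))) = (a * c) • (x * w - ρ • (w * x)) := by
  rw [show (a * c) • (b • x * z - ρ • (z * (b • x))) =
    (a * b) • (x * (c • z) - ρ • ((c • z) * x)) by
      simp only [mul_smul_comm, smul_mul_assoc]; module, hz, smul_mul_sub_smul_mul, h]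

/-- Again the word is cut: `T_i T_j T_i(y_j)` is compared with `T_j⁻¹ T_i⁻¹(y_j)`. Both become the
same commutator of a single with a double commutator, and the scalars match by
`braidScalar_three_mul`. -/
lemma braid_y_of_three_right (hij : i ≠ j) (h : D.negC i j = 3) (hji : D.negC j i = 1) (m : ℤ) :
    D.braidEquiv i (D.braidEquiv j (D.braidEquiv i (D.braidEquiv j (D.braidEquiv i (D.y j m))))) =
      D.y j m := by
  have hr := qPow_form_mul (D := D) hij
  rw [h] at hr
  have e1 : ∀ m, D.braidEquiv j (D.braidEquiv i (D.y j m)) = (D.braidScalar i 3 *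
      D.braidScalar j 1) • (rqad (D.qi i) (qPow (D.form i j)) (D.y i m) (D.y j m) 2 *
        qad (D.qi j) (qPow (D.form i j)) (D.y j m) (D.y i m) 1 -
        (qPow (D.form i j) * D.qi i ^ (2 * 2)) •
        (qad (D.qi j) (qPow (D.form i j)) (D.y j m) (D.y i m) 1 *
          rqad (D.qi i) (qPow (D.form i j)) (D.y i m) (D.y j m) 2)) := by
    intro m
    rw [braidEquiv_y_of_ne hij, h, map_smul, qad_succ, map_sub, map_smul, map_mul, map_mul,
      braidEquiv_qad_two hij hji, braidEquiv_y_of_ne hij.symm, hji, D.form_comm j i]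
    exact smul_mul_sub_smul_mul (K := QField) (B := D.AHat) _ _ _ _ _
  have e2 : D.braidEquiv i (rqad (D.qi i) (qPow (D.form i j)) (D.y i m) (D.y j m) 2) =
      (D.braidScalar i 3 * ((-qPow (D.form i j) * lowerCoeff (D.qi i) (qPow (D.form i j)) 2) *
        (-(qPow (D.form i j) * D.qi i ^ 2) * lowerCoeff (D.qi i) (qPow (D.form i j)) 1))) •
        qad (D.qi i) (qPow (D.form i j)) (D.y i m) (D.y j m) 1 := by
    rw [map_rqad', braidEquiv_y_self, braidEquiv_y_of_ne hij, h, rqad_smul,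
      rqad_qad (D.y_same i m) (y_next_comm hij m) hr 2 1 rfl, smul_smul]
    simp [Finset.prod_range_succ]
  have e3 : D.braidScalar j 1 • D.braidEquiv i (qad (D.qi j) (qPow (D.form i j)) (D.y j m)
      (D.y i m) 1) = D.rankTwoScalar i j •
        qad (D.qi i) (qPow (D.form i j)) (D.y i m) (D.y j m) 2 := by
    have := braidEquiv_braidEquiv_y hij hji m
    rw [braidEquiv_y_of_ne hij.symm, hji, h, map_smul, D.form_comm j i] at this
    exact this
  have e4 : D.braidEquiv i (D.braidEquiv j (D.braidEquiv i (D.y j m))) =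
      (D.braidEquiv j).symm ((D.braidEquiv i).symm (D.y j m)) := by
    rw [braidEquiv_symm_apply, braidEquiv_symm_apply, rev_rev, rev_y, e1, e1, rev_smul, rev_sub,
      rev_smul, rev_mul, rev_mul, rev_rqad, rev_qad, rev_y, rev_y, neg_neg, map_smul, map_sub,
      map_smul, map_mul, map_mul, e2]
    refine (smul_commutator_eq (K := QField) (B := D.AHat) e3 ?_).trans ?_
    rotate_left
    · simp [rqad_succ, qad_succ]
    · rw [rankTwoScalar, h]
      linear_combination (D.braidScalar i 3 * D.braidScalar j 1) * braidScalar_three_mul i hr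
  rw [e4, AlgEquiv.apply_symm_apply, AlgEquiv.apply_symm_apply]

end RankTwo

end SimpleCartanDatum
end

/-! ### Braid relations -/

noncomputable section

namespace QuantumAdjoint

variable {K B : Type*} [Field K] [Ring B] [Algebra K B]

lemma qad_one (q r : K) (f x : B) : qad q r f x 1 = x * f - r • (f * x) := by
  rw [qad_succ, qad_zero, mul_zero, pow_zero, mul_one]

lemma rqad_one (q r : K) (f x : B) : rqad q r f x 1 = f * x - r • (x * f) := by
  rw [rqad_succ, rqad_zero, mul_zero, pow_zero, mul_one]

lemma qad_two (q r : K) (f x : B) : qad q r f x 2 =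
    (x * f - r • (f * x)) * f - (r * q ^ 2) • (f * (x * f - r • (f * x))) := by
  rw [qad_succ, qad_one, mul_one]

lemma rqad_two (q r : K) (f x : B) : rqad q r f x 2 =
    f * (f * x - r • (x * f)) - (r * q ^ 2) • ((f * x - r • (x * f)) * f) := by
  rw [rqad_succ, rqad_one, mul_one]

lemma qad_qad_comm {f g : B} (h : f * g = g * f) (q r p ρ : K) (x : B) (a b : ℕ) :
    qad q r f (qad p ρ g x a) b = qad p ρ g (qad q r f x b) a := by
  have key : ∀ (z : B) (c : K), qad p ρ g (z * f - c • (f * z)) a =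
      qad p ρ g z a * f - c • (f * qad p ρ g z a) := by
    intro z c
    induction a with
    | zero => rfl
    | succ a ih =>
      have h' : ∀ w, f * (g * w) = g * (f * w) := fun w => by rw [← mul_assoc, h, mul_assoc]
      rw [qad_succ, qad_succ, ih]
      generalize qad p ρ g z a = w
      simp only [mul_sub, sub_mul, mul_smul_comm, smul_mul_assoc, mul_assoc, h, h']
      module
  induction b with
  | zero => rfl
  | succ b ih => rw [qad_succ, qad_succ, key, ih]

lemma IsTopPower.qad {q η : K} {f : B} (hq : Generic q) {n : ℕ} {x X z Z : B} {p r : K}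
    (hz : IsTopPower q η f 1 z Z) (hx : IsTopPower q η f n x X) (s : ℕ) :
    IsTopPower q η f (n + s) (qad p r z x s) (qad p r Z X s) := by
  induction s with
  | zero => simpa only [qad_zero, add_zero] using hx
  | succ s ih =>
    have h1 := ih.mul hq hz
    have h2 := ((hz.mul hq ih).smul (-(r * p ^ (2 * s))))
    rw [add_comm 1] at h2
    have := h1.add h2
    simpa only [qad_succ, neg_smul, ← sub_eq_add_neg, ← add_assoc] using this

/-- The difference of the two sides is `q⁻²` times the commutator of `g` with the Serre element in
`x` and `f`. This serves a node attached to the short end of a double bond. -/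
lemma qad_rqad_eq_of_short {q p' p r : K} {f g x : B} (hp : p * q = 1) (hr : r * q ^ 2 = 1)
    (hxg : x * g = g * x) (hS : qad q p f x 2 = 0) :
    qad q p (rqad p' r g f 1) (qad q p f x 1) 1 = qad q p f (qad q p (qad p' r g f 1) x 1) 1 := by
  have hq : q ≠ 0 := right_ne_zero_of_mul_eq_one hp
  obtain rfl : p = q⁻¹ := eq_inv_of_mul_eq_one_left hp
  obtain rfl : r = (q ^ 2)⁻¹ := eq_inv_of_mul_eq_one_left hr
  have hxg' : ∀ w, x * (g * w) = g * (x * w) := fun w => by rw [← mul_assoc, hxg, mul_assoc]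
  rw [qad_two] at hS
  rw [← sub_eq_zero]
  simp only [qad_one, rqad_one]
  trans (q ^ 2)⁻¹ • (g * ((x * f - q⁻¹ • (f * x)) * f - (q⁻¹ * q ^ 2) •
    (f * (x * f - q⁻¹ • (f * x))))) - (q ^ 2)⁻¹ • (((x * f - q⁻¹ • (f * x)) * f - (q⁻¹ * q ^ 2) •
    (f * (x * f - q⁻¹ • (f * x)))) * g)
  · simp only [mul_sub, sub_mul, mul_smul_comm, smul_mul_assoc, mul_assoc, hxg, hxg']
    match_scalars <;> field_simp <;> ring
  · rw [hS, mul_zero, zero_mul, smul_zero, sub_zero]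

/-- After multiplication by `1 + p ^ 2` the difference is an explicit combination of the Serre
elements `S` in `x, g` and `R` in `f, g`. This serves a node attached to the long end of a double
bond. -/
lemma qad_rqad_eq_of_long {q p p' : K} {f g x : B} (hp : p * p' = 1) (hr : p * q ^ 2 = 1)
    (hp2 : 1 + p ^ 2 ≠ 0) (hxf : x * f = f * x) (hS : qad p' p g x 2 = 0)
    (hR : qad p' p g f 2 = 0) :
    qad p' p (rqad q p f g 2) (qad p' p g x 1) 1 =
      qad p' p g (qad p' p (qad q p f g 2) x 1) 1 := by
  have hp0 : p ≠ 0 := left_ne_zero_of_mul_eq_one hp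
  obtain rfl : p' = p⁻¹ := eq_inv_of_mul_eq_one_right hp
  have hxf' : ∀ w, x * (f * w) = f * (x * w) := fun w => by rw [← mul_assoc, hxf, mul_assoc]
  rw [qad_two] at hS hR
  simp only [qad_one, qad_two, rqad_two, hr, one_smul]
  have hc : p * p⁻¹ ^ 2 = p⁻¹ := by field_simp
  rw [hc] at hS hR
  generalize hSe : (x * g - p • (g * x)) * g - p⁻¹ • (g * (x * g - p • (g * x))) = S at hS
  generalize hRe : (f * g - p • (g * f)) * g - p⁻¹ • (g * (f * g - p • (g * f))) = R at hR
  rw [← sub_eq_zero, ← (smul_right_injective B hp2).eq_iff, smul_zero]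
  trans (p ^ 2 * (1 - p)) • (f * (f * S) - S * (f * f)) -
    (p * (1 + p)) • (f * (x * R) - x * (R * f)) +
    (p ^ 3 * (1 + p)) • (f * (R * x) - R * (f * x))
  · rw [← hSe, ← hRe]
    simp only [mul_sub, sub_mul, mul_smul_comm, smul_mul_assoc, mul_assoc, hxf, hxf']
    match_scalars <;> field_simp <;> ring
  · simp [hS, hR]

end QuantumAdjoint

namespace SimpleCartanDatum

open QuantumAdjoint
open CoxeterSystem (alternatingWord)

variable {I : Type*} [Fintype I] [DecidableEq I] {D : SimpleCartanDatum I}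

/-! ### Braid relations -/

lemma algEquiv_ext {S T : D.AHat ≃ₐ[QField] D.AHat} (h : ∀ i m, S (D.y i m) = T (D.y i m)) :
    S = T := by
  have : S.toAlgHom = T.toAlgHom := algHom_ext h
  exact AlgEquiv.ext fun x => DFunLike.congr_fun this x

variable {i j k : I}

lemma negC_eq_zero (h : D.C i j = 0) : D.negC i j = 0 := by simp [negC, h]

lemma C_eq_zero_of_negC (hij : i ≠ j) (h : D.negC i j = 0) : D.C i j = 0 := by
  have := negC_cast (D := D) hij
  omega

lemma y_comm (hij : i ≠ j) (h : D.C i j = 0) (m : ℤ) :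
    D.y i m * D.y j m = D.y j m * D.y i m := by
  have h1 := y_qad (D := D) hij m
  have h2 := qPow_form_mul (D := D) hij
  rw [negC_eq_zero h, pow_zero, mul_one] at h2
  rw [negC_eq_zero h, zero_add, qad_one, h2, one_smul, sub_eq_zero] at h1
  exact h1.symm

lemma braid_comm (hij : i ≠ j) (h : D.C i j = 0) :
    D.braidEquiv i * D.braidEquiv j = D.braidEquiv j * D.braidEquiv i := by
  have h' := D.C_eq_zero_of_C_eq_zero h
  refine algEquiv_ext fun k m => ?_
  simp only [AlgEquiv.mul_apply]
  by_cases hik : i = k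
  · subst hik
    rw [braidEquiv_y_of_C_eq_zero hij.symm h', braidEquiv_y_self,
      braidEquiv_y_of_C_eq_zero hij.symm h']
  by_cases hjk : j = k
  · subst hjk
    rw [braidEquiv_y_of_C_eq_zero hij h, braidEquiv_y_self, braidEquiv_y_of_C_eq_zero hij h]
  rw [braidEquiv_y_of_ne hjk, braidEquiv_y_of_ne hik, map_smul, map_smul, map_qad', map_qad',
    braidEquiv_y_of_C_eq_zero hij h, braidEquiv_y_of_C_eq_zero hij.symm h',
    braidEquiv_y_of_ne hjk, braidEquiv_y_of_ne hik, qad_smul, qad_smul, smul_comm,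
    qad_qad_comm (y_comm hij h m)]

/-- As `T_i` fixes `y_k`, the left side is an iterated commutator in `T_i(y_j)` and `y_k`, hence the
top power along `y_i` of the one in `y_j` and `y_k`. The right side is that top power too, because
`T_j T_i(y_j) = y_i`. -/
lemma braid_apply_of_three (hij : i ≠ j) (hik : i ≠ k) (hjk : j ≠ k) (h : D.negC i j = 1)
    (hji : D.negC j i = 1) (hk : D.C i k = 0) (m : ℤ) :
    D.braidEquiv i (D.braidEquiv j (D.braidEquiv i (D.y k m))) =
      D.braidEquiv j (D.braidEquiv i (D.braidEquiv j (D.y k m))) := by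
  have hd := d_eq_of_negC_eq_one hij h hji
  have hq : D.qi i = D.qi j := by rw [qi, qi, hd]
  have hη : D.eta i = D.eta j := by rw [eta, eta, qDiff, qDiff, hd]
  have t1 := isTopPower_braidImage (D := D) hij m
  have t2 := isTopPower_braidImage (D := D) hik m
  rw [← braidEquiv_y, braidEquiv_y_of_C_eq_zero hik hk, negC_eq_zero hk] at t2
  rw [← braidEquiv_y, h] at t1
  have t3 := (IsTopPower.qad (p := D.qi j) (r := qPow (D.form j k)) (D.generic_qi i) t1 t2
    (D.negC j k)).1
  rw [zero_add, hq, hη, ← qPow_form_eq hjk] at t3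
  rw [braidEquiv_y_of_C_eq_zero hik hk, braidEquiv_y_of_ne hjk, map_smul, map_smul,
    map_qad', map_qad', braidEquiv_y_of_C_eq_zero hik hk,
    braid_y_of_one hij.symm hji h, braidEquiv_y_of_ne hjk, qad_smul, t3, smul_smul (D.braidScalar j _)
    (_ * _), braidScalar, inv_mul_cancel₀, one_smul]
  exact mul_ne_zero ((D.generic_qi j).qFac_ne_zero _) (pow_ne_zero _ (D.eta_ne_zero j))

lemma eq_zero_or_eq_zero (hij : i ≠ j) (hik : i ≠ k) (hjk : j ≠ k) (h : D.negC i j ≠ 0) :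
    D.C i k = 0 ∨ D.C j k = 0 := by
  by_contra! hc
  have h0 : D.C i j ≠ 0 := fun h' => h (negC_eq_zero h')
  exact hc.1 (D.C_eq_zero_of_ne_zero hij hik hjk h0 hc.2)

lemma braid_of_three (hij : i ≠ j) (h : D.negC i j = 1) (hji : D.negC j i = 1) :
    D.braidEquiv i * (D.braidEquiv j * D.braidEquiv i) =
      D.braidEquiv j * (D.braidEquiv i * D.braidEquiv j) := by
  refine algEquiv_ext fun k m => ?_
  simp only [AlgEquiv.mul_apply]
  by_cases hik : i = k
  · subst hik
    rw [braid_y_of_one hij h hji, braidEquiv_y_self, braidEquiv_y_self, braid_y_of_one hij h hji]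
  by_cases hjk : j = k
  · subst hjk
    rw [braid_y_of_one hij.symm hji h, braidEquiv_y_self, braidEquiv_y_self,
      braid_y_of_one hij.symm hji h]
  rcases eq_zero_or_eq_zero (D := D) hij hik hjk (by omega) with h0 | h0
  · exact braid_apply_of_three hij hik hjk h hji h0 m
  · exact (braid_apply_of_three hij.symm hjk hik hji h h0 m).symm

/-- The braid relation of length four on `y_k`, reduced to an identity of iterated commutators. -/
lemma braid_apply_of_four (hik : i ≠ k) (hjk : j ≠ k) (hk : D.C j k = 0)
    (h1 : D.negC i k = 1) (m : ℤ)
    (hy : D.braidEquiv j (D.braidEquiv i (D.braidEquiv j (D.y i m))) = D.y i m)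
    (h : qad (D.qi i) (qPow (D.form i k)) ((D.braidEquiv j).symm (D.y i m))
        (qad (D.qi i) (qPow (D.form i k)) (D.y i m) (D.y k m) 1) 1 =
      qad (D.qi i) (qPow (D.form i k)) (D.y i m)
        (qad (D.qi i) (qPow (D.form i k)) (D.braidEquiv j (D.y i m)) (D.y k m) 1) 1) :
    D.braidEquiv i (D.braidEquiv j (D.braidEquiv i (D.braidEquiv j (D.y k m)))) =
      D.braidEquiv j (D.braidEquiv i (D.braidEquiv j (D.braidEquiv i (D.y k m)))) := by
  have e1 : D.braidEquiv i (D.braidEquiv j (D.y i m)) = (D.braidEquiv j).symm (D.y i m) := by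
    rw [AlgEquiv.eq_symm_apply, hy]
  have e2 := braidEquiv_y_of_ne (D := D) hik m
  rw [h1] at e2
  have e3 := braidEquiv_y_of_C_eq_zero (D := D) hjk hk m
  have e4 : D.braidEquiv i (D.braidEquiv j (D.braidEquiv i (D.y k m))) =
      D.braidScalar i 1 • D.braidScalar i 1 • qad (D.qi i) (qPow (D.form i k))
        ((D.braidEquiv j).symm (D.y i m))
        (qad (D.qi i) (qPow (D.form i k)) (D.y i m) (D.y k m) 1) 1 := by
    simp only [e3, e2, map_smul, map_qad', e1, qad_smul]
  rw [e3, e4]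
  simp only [map_smul, map_qad', AlgEquiv.apply_symm_apply, e3]
  rw [h]

lemma braid_of_four (hij : i ≠ j) (h : D.negC i j = 2) (hji : D.negC j i = 1) :
    D.braidEquiv i * (D.braidEquiv j * (D.braidEquiv i * D.braidEquiv j)) =
      D.braidEquiv j * (D.braidEquiv i * (D.braidEquiv j * D.braidEquiv i)) := by
  have hr := qPow_form_mul (D := D) hij
  rw [h] at hr
  have hr' := qPow_form_mul (D := D) hij.symm
  rw [hji, pow_one] at hr'
  have hc := negC_cast (D := D) hij
  have hc' := negC_cast (D := D) hij.symm
  rw [h] at hc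
  rw [hji] at hc'
  refine algEquiv_ext fun k m => ?_
  simp only [AlgEquiv.mul_apply]
  by_cases hik : i = k
  · subst hik
    rw [braid_y_of_two_left hij h hji, braidEquiv_y_self,
      braid_y_of_two_left hij h hji]
  by_cases hjk : j = k
  · subst hjk
    rw [braid_y_of_two_right hij h hji, braidEquiv_y_self,
      braid_y_of_two_right hij h hji]
  by_cases hi : D.C i k = 0
  · by_cases hj : D.C j k = 0
    · simp only [braidEquiv_y_of_C_eq_zero hik hi, braidEquiv_y_of_C_eq_zero hjk hj]
    -- The double bond at `j` leaves room for a simple bond only.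
    have h1 : D.negC j k = 1 := by
      have h2 := D.C_mul_C_add_lt hij hik hjk
      have h3 := negC_cast (D := D) hjk
      have h4 := negC_cast (D := D) (Ne.symm hjk)
      rw [show D.C i j = -2 by omega, show D.C j i = -1 by omega] at h2
      rcases negC_cases (D := D) hjk with h5 | h5 | h5 | h5 | h5 | h5 <;>
        rw [show D.C j k = -D.negC j k by omega, show D.C k j = -D.negC k j by omega, h5.1,
          h5.2] at h2 <;> simp at h2 <;> omega
    have hp := qPow_form_mul (D := D) hjk
    rw [h1, pow_one] at hp
    have hpr : qPow (D.form j k) = qPow (D.form i j) := by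
      rw [D.form_comm i j]
      exact mul_right_cancel₀ (D.generic_qi j).ne_zero (hp.trans hr'.symm)
    refine (braid_apply_of_four hjk hik hi h1 m (braid_y_of_two_right hij h hji m) ?_).symm
    rw [braidEquiv_symm_y_of_ne hij, braidEquiv_y_of_ne hij, h, qad_smul_left, qad_smul_left,
      qad_smul, hpr]
    congr 1
    have hS := y_qad (D := D) hjk m
    have hR := y_qad (D := D) hij.symm m
    rw [h1, hpr] at hS
    rw [hji, D.form_comm j i] at hR
    refine qad_rqad_eq_of_long (hpr ▸ hp) hr ?_ (y_comm (Ne.symm hik) (D.C_eq_zero_of_C_eq_zero hi) m)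
      hS hR
    -- Here `p = q_i⁻²`, so `1 + p ^ 2 = 0` would force `q_i ^ 8 = 1`.
    intro h0
    have := (D.generic_qi i).pow_ne_one 8 (by norm_num)
    apply this
    have h8 : (qPow (D.form i j) * D.qi i ^ 2) ^ 4 = 1 := by rw [hr, one_pow]
    linear_combination h8 - D.qi i ^ 8 * (qPow (D.form i j) ^ 2 - 1) * h0
  · have hj : D.C j k = 0 := (eq_zero_or_eq_zero hij hik hjk (by omega)).resolve_left hi
    have h1 : D.negC i k = 1 := by
      have h2 := D.C_mul_C_add_lt hij.symm hjk hik
      have h3 := negC_cast (D := D) hik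
      have h4 := negC_cast (D := D) (Ne.symm hik)
      rw [show D.C i j = -2 by omega, show D.C j i = -1 by omega] at h2
      rcases negC_cases (D := D) hik with h5 | h5 | h5 | h5 | h5 | h5 <;>
        rw [show D.C i k = -D.negC i k by omega, show D.C k i = -D.negC k i by omega, h5.1,
          h5.2] at h2 <;> simp at h2 <;> omega
    have hp := qPow_form_mul (D := D) hik
    rw [h1, pow_one] at hp
    refine braid_apply_of_four hik hjk hj h1 m (braid_y_of_two_left hij h hji m) ?_
    rw [braidEquiv_symm_y_of_ne hij.symm, braidEquiv_y_of_ne hij.symm, hji, qad_smul_left,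
      qad_smul_left, qad_smul, D.form_comm j i]
    congr 1
    have hS := y_qad (D := D) hik m
    rw [h1] at hS
    exact qad_rqad_eq_of_short hp hr (y_comm (Ne.symm hjk) (D.C_eq_zero_of_C_eq_zero hj) m) hS

lemma braid_of_six (hij : i ≠ j) (h : D.negC i j = 3) (hji : D.negC j i = 1) :
    D.braidEquiv i * (D.braidEquiv j * (D.braidEquiv i * (D.braidEquiv j *
      (D.braidEquiv i * D.braidEquiv j)))) =
      D.braidEquiv j * (D.braidEquiv i * (D.braidEquiv j * (D.braidEquiv i *
      (D.braidEquiv j * D.braidEquiv i)))) := by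
  have hc := negC_cast (D := D) hij
  have hc' := negC_cast (D := D) hij.symm
  rw [h] at hc
  rw [hji] at hc'
  refine algEquiv_ext fun k m => ?_
  simp only [AlgEquiv.mul_apply]
  by_cases hik : i = k
  · subst hik
    rw [braid_y_of_three_left hij h hji, braidEquiv_y_self,
      braid_y_of_three_left hij h hji]
  by_cases hjk : j = k
  · subst hjk
    rw [braid_y_of_three_right hij h hji, braidEquiv_y_self,
      braid_y_of_three_right hij h hji]
  -- A triple bond exhausts the bound at both of its ends, so `k` is joined to neither node and both
  -- sides fix `y_k`.
  have key : ∀ {i j : I}, i ≠ j → i ≠ k → j ≠ k → D.C i j * D.C j i = 3 → D.C j k = 0 := by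
    intro i j hij hik hjk h3
    have h2 := D.C_mul_C_add_lt hij hik hjk
    have a1 := D.off_diag j k hjk
    have a2 := D.off_diag k j hjk.symm
    by_contra h4
    have h5 : D.C k j ≠ 0 := fun h => h4 (D.C_eq_zero_of_C_eq_zero h)
    have b1 : D.C j k ≤ -1 := by omega
    have b2 : D.C k j ≤ -1 := by omega
    nlinarith
  have e1 : D.C i j = -3 := by omega
  have e2 : D.C j i = -1 := by omega
  have hj := key hij hik hjk (by rw [e1, e2]; norm_num)
  have hi := key hij.symm hjk hik (by rw [e1, e2]; norm_num)
  simp only [braidEquiv_y_of_C_eq_zero hik hi, braidEquiv_y_of_C_eq_zero hjk hj]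

lemma braidOrder_eq (hij : i ≠ j) : D.braidOrder i j =
    if D.negC i j * D.negC j i = 0 then 2 else if D.negC i j * D.negC j i = 1 then 3
    else if D.negC i j * D.negC j i = 2 then 4 else 6 := by
  have h : D.C i j * D.C j i = ((D.negC i j * D.negC j i : ℕ) : ℤ) := by
    rw [Nat.cast_mul, negC_cast hij, negC_cast hij.symm]; ring
  simp only [braidOrder, h]
  norm_cast

lemma braidRelations_braidEquiv : D.BraidRelations D.braidEquiv := by
  intro i j hij
  rw [braidOrder_eq hij]
  rcases negC_cases (D := D) hij with h | h | h | h | h | h <;> rw [h.1, h.2] <;>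
    norm_num [alternatingWord, mul_assoc]
  · exact braid_comm hij (C_eq_zero_of_negC hij h.1)
  · exact (braid_of_three hij h.1 h.2).symm
  · exact (braid_of_four hij.symm h.2 h.1).symm
  · exact braid_of_four hij h.1 h.2
  · exact (braid_of_six hij.symm h.2 h.1).symm
  · exact braid_of_six hij h.1 h.2

lemma braidEquiv_alternatingWord_y (m : ℤ) (i j : I) (hij : i ≠ j) :
    ((alternatingWord i j (D.braidOrder i j - 1)).map D.braidEquiv).prod (D.y i m) =
      D.y (if D.braidOrder i j = 3 then j else i) m := by
  rw [braidOrder_eq hij]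
  rcases negC_cases (D := D) hij with h | h | h | h | h | h <;> rw [h.1, h.2] <;>
    norm_num [alternatingWord, -braidEquiv_y]
  · exact braidEquiv_y_of_C_eq_zero hij.symm (C_eq_zero_of_negC hij.symm h.2) m
  · exact braid_y_of_one hij h.1 h.2 m
  · exact braid_y_of_two_right hij.symm h.2 h.1 m
  · exact braid_y_of_two_left hij h.1 h.2 m
  · exact braid_y_of_three_right hij.symm h.2 h.1 m
  · exact braid_y_of_three_left hij h.1 h.2 m

end SimpleCartanDatum

end

/-! ### Images of generators under words in the `T_i` -/

noncomputable section

namespace SimpleCartanDatum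

variable {I : Type*} [Fintype I] [DecidableEq I] {D : SimpleCartanDatum I}

/-! ### Words in the automorphisms `T_i` -/

lemma braidInvWord_apply (l : List I) (x : D.AHat) :
    D.braidInvWord D.braidEquiv l x = rev (D.braidWord D.braidEquiv l (rev x)) := by
  induction l generalizing x with
  | nil => exact (rev_rev x).symm
  | cons i l ih =>
    simp only [braidInvWord, braidWord, List.map_cons, List.prod_cons, AlgEquiv.mul_apply] at ih ⊢
    rw [ih, braidEquiv_symm_apply, rev_rev]

lemma braidWord_y {l : List I} {i j : I} (hl : D.Reduced (l ++ [i]))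
    (h : D.wordProd l (D.simpleRoot i) = D.simpleRoot j) (m : ℤ) :
    D.braidWord D.braidEquiv l (D.y i m) = D.y j m :=
  hl.prod_map_apply_eq braidRelations_braidEquiv (fun i => D.y i m)
    (braidEquiv_alternatingWord_y m) h

/-- Choose a reduced word `p ++ [i]` for the longest element. The last factor raises the level of
`y_i`, and `p` sends `α_i` to the simple root `α_j`, so (a) applies to it. -/
lemma braidWord_longest_y {l : List I} (hw : D.IsLongest (D.wordProd l)) (hl : D.Reduced l)
    {i j : I} (h : D.wordProd l (D.simpleRoot i) = -D.simpleRoot j) (m : ℤ) :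
    D.braidWord D.braidEquiv l (D.y i m) = D.y j (m + 1) := by
  obtain ⟨p, hp, hlen⟩ := exists_eq_append_of_not_reduced hl (hw.not_reduced hl i)
  have hp' := hl.congr hp hlen.le
  rw [braidWord, hl.prod_map_eq braidRelations_braidEquiv hp' hp.symm, List.map_append,
    List.prod_append, List.map_singleton, List.prod_singleton, AlgEquiv.mul_apply,
    braidEquiv_y_self]
  refine braidWord_y hp' ?_ _
  rw [← hp, wordProd_append, wordProd_cons, wordProd_nil, mul_one, LinearEquiv.mul_apply,
    simpleReflection_simpleRoot, D.diag, two_smul, sub_add_cancel_left, map_neg, neg_inj] at h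
  exact h

lemma y_mem_level (i : I) (m : ℤ) : D.y i m ∈ D.level m := Algebra.subset_adjoin ⟨i, rfl⟩

end SimpleCartanDatum
end

theorem mainTheorem9 {I : Type*} [Fintype I] [DecidableEq I] (D : SimpleCartanDatum I) :
    ∃ T : I → (D.AHat ≃ₐ[SimpleCartanDatum.QField] D.AHat), D.IsBraidFamily T ∧
      (∀ (w : (I → ℤ) ≃ₗ[ℤ] (I → ℤ)) (l : List I) (i j : I),
        D.IsReducedWord w (l ++ [i]) →
        D.wordProd l (D.simpleRoot i) = D.simpleRoot j →
        ∀ m : ℤ, D.braidWord T l (D.y i m) = D.y j m ∧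
          D.braidInvWord T l (D.y i m) = D.y j m) ∧
      (∀ w₀ : (I → ℤ) ≃ₗ[ℤ] (I → ℤ), D.IsLongest w₀ →
        ∃ star : I → I, (∀ i, w₀ (D.simpleRoot i) = -D.simpleRoot (star i)) ∧
          ∀ l : List I, D.IsReducedWord w₀ l → ∀ (i : I) (m : ℤ),
            (D.braidWord T l (D.y i m) = D.y (star i) (m + 1) ∧
              D.y (star i) (m + 1) ∈ D.level (m + 1)) ∧
            (D.braidInvWord T l (D.y i m) = D.y (star i) (m - 1) ∧
              D.y (star i) (m - 1) ∈ D.level (m - 1))) := by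
  refine ⟨D.braidEquiv, D.isBraidFamily_braidEquiv, fun w l i j hl h m => ?_, fun w₀ hw => ?_⟩
  · have hl' := ((D.isReducedWord_iff w _).1 hl).2
    refine ⟨SimpleCartanDatum.braidWord_y hl' h m, ?_⟩
    -- Conjugation by the level reversal reduces the inverse case to level `-m`.
    rw [SimpleCartanDatum.braidInvWord_apply, SimpleCartanDatum.rev_y,
      SimpleCartanDatum.braidWord_y hl' h, SimpleCartanDatum.rev_y, neg_neg]
  · choose star hstar using hw.exists_apply_eq
    refine ⟨star, hstar, fun l hl i m => ?_⟩
    obtain ⟨rfl, hl'⟩ := (D.isReducedWord_iff w₀ l).1 hl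
    refine ⟨⟨SimpleCartanDatum.braidWord_longest_y hw hl' (hstar i) m,
      SimpleCartanDatum.y_mem_level _ _⟩, ?_, SimpleCartanDatum.y_mem_level _ _⟩
    rw [SimpleCartanDatum.braidInvWord_apply, SimpleCartanDatum.rev_y,
      SimpleCartanDatum.braidWord_longest_y hw hl' (hstar i), SimpleCartanDatum.rev_y]
    congr 1
    ring
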